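/- **Model.** Write points of the hyperbolic plane of curvature $-1$ in polar coordinates $(r,\phi)$, with distance $d(u,v)=\operatorname{arcosh}\bigl(\cosh r_u\cosh r_v-\sinh r_u\sinh r_v\cos(\phi_u-\phi_v)\bigr)$. The hyperbolic unit disk graph of points $x_1,\dots,x_n$ with radius threshold $R$ has vertices $1,\dots,n$, and two distinct vertices are adjacent iff their points have distance at most $R$. For $n\ge 1$ and real $\alpha>0$, $C$ with $R:=2\ln n+C>0$, the hyperbolic random graph $\mathcal G_{n,\alpha,C}$ is the hyperbolic unit disk graph with threshold $R$ of $n$ independent random points, each with radius of density $\rho(r)=\frac{\alpha\sinh(\alpha r)}{\cosh(\alpha R)-1}$ on $[0,R]$ and independent angle uniform on $[0,2\pi)$. Algorithms are programs for a unit-cost real RAM with natural-number and real registers and arrays. The input is the graph as adjacency lists (in arbitrary order) together with the points (the geometric representation). One step is an increment, decrement, comparison, copy or (indirectly addressed) array access, a field operation or comparison of reals, the reading of an input item, or the evaluation of the hyperbolic distance of two input points. **Theorem.** There is a program (not depending on $n,\alpha,C$) such that: 1. on every hyperbolic unit disk graph, given with its geometric representation, it halts and outputs a maximum clique; 2. for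 all $\frac12<\alpha<1$ and all real $C$ its expected running time on $G\sim\mathcal G_{n,\alpha,C}$, given with its geometric representation, is $O\bigl(m+n^{4.5(1-\alpha)}\bigr)$. That is, there is a constant $K$ depending only on $\alpha$ and $C$ such that for all $n\ge1$ with $2\ln n+C>0$, $$\mathbb E[T]\le K\cdot\mathbb E\bigl[m+n^{4.5(1-\alpha)}\bigr],$$ where $m$ is the number of edges of $G$ and $T$ is the number of steps (for the worst order of the adjacency lists). -/

import Mathlib

open MeasureTheory
open scoped ENNReal NNReal

namespace HyperbolicClique

noncomputable section

/-! ### Hyperbolic random graphs -/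

/-- A point of the hyperbolic plane of curvature `-1` in polar coordinates `(r, φ)`. -/
abbrev Point : Type := ℝ × ℝ

/-- The hyperbolic distance of two points in polar coordinates (hyperbolic law of cosines). -/
def hdist (p q : Point) : ℝ :=
  Real.arcosh (Real.cosh p.1 * Real.cosh q.1
    - Real.sinh p.1 * Real.sinh q.1 * Real.cos (p.2 - q.2))

theorem hdist_comm (p q : Point) : hdist p q = hdist q p := by
  unfold hdist
  rw [← Real.cos_neg (p.2 - q.2), neg_sub, mul_comm (Real.cosh p.1), mul_comm (Real.sinh p.1)]

/-- The hyperbolic unit disk graph of the points `x` with radius threshold `R`. -/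
def unitDiskGraph {n : ℕ} (R : ℝ) (x : Fin n → Point) : SimpleGraph (Fin n) where
  Adj u v := u ≠ v ∧ hdist (x u) (x v) ≤ R
  symm := ⟨fun u v h => ⟨h.1.symm, by rw [hdist_comm]; exact h.2⟩⟩
  loopless := ⟨fun _ h => h.1 rfl⟩

/-- The radius `R = 2 ln n + C` of the disk, which is also the radius threshold. -/
def diskRadius (n : ℕ) (C : ℝ) : ℝ := 2 * Real.log n + C

/-- The law on `[0, R]` with density `α sinh (α r) / (cosh (α R) - 1)`. -/
def radialLaw (α R : ℝ) : Measure ℝ :=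
  (volume.restrict (Set.Icc 0 R)).withDensity
    (fun r => ENNReal.ofReal (α * Real.sinh (α * r) / (Real.cosh (α * R) - 1)))

/-- The uniform law on `[0, 2π)`. -/
def angularLaw : Measure ℝ :=
  (ENNReal.ofReal (2 * Real.pi))⁻¹ • volume.restrict (Set.Ico 0 (2 * Real.pi))

/-- The law of one random point: independent radial and angular coordinates. -/
def pointLaw (α R : ℝ) : Measure Point := (radialLaw α R).prod angularLaw

/-- The law of the `n` independent points underlying the hyperbolic random graph with
parameters `n`, `α`, `C`. The random graph is `randomGraph C x` for `x` with this law. -/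
def sampleLaw (n : ℕ) (α C : ℝ) : Measure (Fin n → Point) :=
  Measure.pi (fun _ => pointLaw α (diskRadius n C))

/-- The graph of the sample `x`: the unit disk graph with radius threshold `2 ln n + C`. -/
def randomGraph {n : ℕ} (C : ℝ) (x : Fin n → Point) : SimpleGraph (Fin n) :=
  unitDiskGraph (diskRadius n C) x

/-! ### The machine model

A real RAM with unit costs, as a structured programming language. A program is a finite term that
does not depend on the input. There are registers and (zero-initialised, two-index) arrays for
natural numbers and for reals; registers and arrays are named by natural numbers.

The only arithmetic on natural numbers is incrementing and decrementing by one, so after `t` steps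
all of them are at most `t` plus the largest number in the input and in the program: they fit in
words of `O(log (n + t))` bits, and huge integers cannot be abused at unit cost.
The real numbers admit the field operations and comparisons, and the hyperbolic distance of two
input points can be evaluated in one step. There is no rounding, that is, no conversion of
reals to natural numbers, and a program has no real constants. -/

/-- The input of a program: `n` points in polar coordinates (the geometric representation) and an
adjacency list for each of the vertices `0, …, n - 1`. -/
structure Input (n : ℕ) where
  pts : Fin n → Point
  nbrs : Fin n → List (Fin n)

/-- `nbrs` is an adjacency-list representation of `G`; the neighbours of a vertex are listed
without repetition, in any order. -/
def IsAdjacencyList {n : ℕ} (G : SimpleGraph (Fin n)) (nbrs : Fin n → List (Fin n)) : Prop :=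
  ∀ v, (nbrs v).Nodup ∧ ∀ w, w ∈ nbrs v ↔ G.Adj v w

/-- Length of the adjacency list of vertex number `v` (0 if there is no such vertex). -/
def Input.degree {n : ℕ} (I : Input n) (v : ℕ) : ℕ :=
  if h : v < n then (I.nbrs ⟨v, h⟩).length else 0

/-- The entry number `i` (counted from 0) of the adjacency list of vertex number `v`
(0 if out of range). -/
def Input.neighbour {n : ℕ} (I : Input n) (v i : ℕ) : ℕ :=
  if h : v < n then ((I.nbrs ⟨v, h⟩)[i]?.map Fin.val).getD 0 else 0

/-- The point of vertex number `v` (the origin if there is no such vertex). -/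
def Input.point {n : ℕ} (I : Input n) (v : ℕ) : Point :=
  if h : v < n then I.pts ⟨v, h⟩ else (0, 0)

/-- Elementary instructions. Below, `x`, `y`, `i`, `j`, `v`, `w` are names of registers, and `a`
is the name of an array. -/
inductive Instr : Type
  -- do nothing
  | skip
  -- instructions for natural numbers: `x := k`, `x := y`, `x := x + 1`, `x := x - 1`
  -- (with `0 - 1 = 0`), `x := a[i, j]`, `a[i, j] := x`
  | const (x k : ℕ)
  | copy (x y : ℕ)
  | succ (x : ℕ)
  | pred (x : ℕ)
  | load (x a i j : ℕ)
  | store (a i j x : ℕ)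
  -- access to the graph: number of vertices, length of the list of `v`, entry `i` of that list
  | size (x : ℕ)
  | degree (x v : ℕ)
  | neighbour (x v i : ℕ)
  -- instructions for reals (in `rcast`, the natural number in register `i` becomes a real)
  | rcast (x i : ℕ)
  | rcopy (x y : ℕ)
  | radd (x y z : ℕ)
  | rsub (x y z : ℕ)
  | rmul (x y z : ℕ)
  | rdiv (x y z : ℕ)
  | rload (x a i j : ℕ)
  | rstore (a i j x : ℕ)
  -- access to the geometric representation: coordinates of `v`, distance of `v` and `w`
  | radius (x v : ℕ)
  | angle (x v : ℕ)
  | distance (x v w : ℕ)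

/-- Tests: comparisons of two natural-number registers or of two real registers. -/
inductive Test : Type
  | eq (x y : ℕ)
  | ne (x y : ℕ)
  | lt (x y : ℕ)
  | le (x y : ℕ)
  | rlt (x y : ℕ)
  | rle (x y : ℕ)

/-- Programs. -/
inductive Program : Type
  | instr (c : Instr)
  | seq (p q : Program)
  | ite (b : Test) (p q : Program)
  | loop (b : Test) (p : Program)

/-- Contents of the registers and arrays. -/
structure State : Type where
  reg : ℕ → ℕ
  mem : ℕ → ℕ → ℕ → ℕ
  rreg : ℕ → ℝ
  rmem : ℕ → ℕ → ℕ → ℝ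

/-- All registers and arrays are zero at the start. -/
def State.init : State where
  reg _ := 0
  mem _ _ _ := 0
  rreg _ := 0
  rmem _ _ _ := 0

/-- Assignment to a natural-number register. -/
def State.setReg (s : State) (x k : ℕ) : State :=
  { s with reg := Function.update s.reg x k }

/-- Assignment to a real register. -/
def State.setReal (s : State) (x : ℕ) (c : ℝ) : State :=
  { s with rreg := Function.update s.rreg x c }

/-- Assignment to an array cell holding a natural number. -/
def State.setMem (s : State) (a i j k : ℕ) : State :=
  { s with mem := fun a' i' j' => if a' = a ∧ i' = i ∧ j' = j then k else s.mem a' i' j' }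

/-- Assignment to an array cell holding a real. -/
def State.setRealMem (s : State) (a i j : ℕ) (c : ℝ) : State :=
  { s with rmem := fun a' i' j' => if a' = a ∧ i' = i ∧ j' = j then c else s.rmem a' i' j' }

/-- The effect of an instruction. -/
def Instr.apply {n : ℕ} (I : Input n) (s : State) : Instr → State
  | .skip => s
  | .const x k => s.setReg x k
  | .copy x y => s.setReg x (s.reg y)
  | .succ x => s.setReg x (s.reg x + 1)
  | .pred x => s.setReg x (s.reg x - 1)
  | .load x a i j => s.setReg x (s.mem a (s.reg i) (s.reg j))
  | .store a i j x => s.setMem a (s.reg i) (s.reg j) (s.reg x)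
  | .size x => s.setReg x n
  | .degree x v => s.setReg x (I.degree (s.reg v))
  | .neighbour x v i => s.setReg x (I.neighbour (s.reg v) (s.reg i))
  | .rcast x i => s.setReal x (s.reg i : ℝ)
  | .rcopy x y => s.setReal x (s.rreg y)
  | .radd x y z => s.setReal x (s.rreg y + s.rreg z)
  | .rsub x y z => s.setReal x (s.rreg y - s.rreg z)
  | .rmul x y z => s.setReal x (s.rreg y * s.rreg z)
  | .rdiv x y z => s.setReal x (s.rreg y / s.rreg z)
  | .rload x a i j => s.setReal x (s.rmem a (s.reg i) (s.reg j))
  | .rstore a i j x => s.setRealMem a (s.reg i) (s.reg j) (s.rreg x)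
  | .radius x v => s.setReal x (I.point (s.reg v)).1
  | .angle x v => s.setReal x (I.point (s.reg v)).2
  | .distance x v w => s.setReal x (hdist (I.point (s.reg v)) (I.point (s.reg w)))

/-- The truth of a test. -/
def Test.Holds (s : State) : Test → Prop
  | .eq x y => s.reg x = s.reg y
  | .ne x y => s.reg x ≠ s.reg y
  | .lt x y => s.reg x < s.reg y
  | .le x y => s.reg x ≤ s.reg y
  | .rlt x y => s.rreg x < s.rreg y
  | .rle x y => s.rreg x ≤ s.rreg y

/-- `Runs I p s s' t`: on input `I`, the program `p` started in state `s` halts in state `s'` after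
exactly `t` steps, where each executed instruction and each evaluated test is one step. -/
inductive Runs {n : ℕ} (I : Input n) : Program → State → State → ℕ → Prop
  | instr (c : Instr) (s : State) : Runs I (.instr c) s (c.apply I s) 1
  | seq {p q : Program} {s s' s'' : State} {t t' : ℕ} :
      Runs I p s s' t → Runs I q s' s'' t' → Runs I (.seq p q) s s'' (t + t')
  | ite_true {b : Test} {p q : Program} {s s' : State} {t : ℕ} :
      b.Holds s → Runs I p s s' t → Runs I (.ite b p q) s s' (t + 1)
  | ite_false {b : Test} {p q : Program} {s s' : State} {t : ℕ} :
      ¬ b.Holds s → Runs I q s s' t → Runs I (.ite b p q) s s' (t + 1)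
  | loop_true {b : Test} {p : Program} {s s' s'' : State} {t t' : ℕ} :
      b.Holds s → Runs I p s s' t → Runs I (.loop b p) s' s'' t' →
        Runs I (.loop b p) s s'' (t + t' + 1)
  | loop_false {b : Test} {p : Program} {s : State} :
      ¬ b.Holds s → Runs I (.loop b p) s s 1

/-- The running time of `p` on input `I`: the number of steps until it halts, and `∞` if it does
not halt. (There is at most one such number, since `Runs` is deterministic.) -/
def runTime {n : ℕ} (p : Program) (I : Input n) : ℝ≥0∞ :=
  ⨅ (t : ℕ) (_ : ∃ s, Runs I p State.init s t), (t : ℝ≥0∞)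

/-- The running time of `p` on the graph `G` with geometric representation `x`, for the
worst order of the adjacency lists. -/
def graphTime {n : ℕ} (p : Program) (G : SimpleGraph (Fin n)) (x : Fin n → Point) : ℝ≥0∞ :=
  ⨆ (nbrs : Fin n → List (Fin n)) (_ : IsAdjacencyList G nbrs), runTime p ⟨x, nbrs⟩

/-- The set of vertices that is output: those `v` for which the cell `[v, 0]` of array 0 is 1. -/
def State.output (s : State) (n : ℕ) : Finset (Fin n) :=
  Finset.univ.filter (fun v => s.mem 0 v 0 = 1)

/-- On the graph `G` with geometric representation `x`, for each order of the adjacency lists, the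
program `p` halts and outputs a maximum clique. -/
def ComputesMaximumClique {n : ℕ} (p : Program) (G : SimpleGraph (Fin n)) (x : Fin n → Point) :
    Prop :=
  ∀ nbrs : Fin n → List (Fin n), IsAdjacencyList G nbrs →
    ∃ s t, Runs ⟨x, nbrs⟩ p State.init s t ∧ G.IsMaximumClique (s.output n)

end

end HyperbolicClique

/-!
Order the vertices by their radius. The vertex of largest radius in a clique sees the whole clique
in its *inner neighbourhood*: itself and those of its neighbours that are not further from the
origin. If all radii are at most `R`, then the line through the origin and the point of `v` divides
the inner neighbourhood of `v` into two cliques (`splits`), because the hyperbolic cosine of the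
distance to a fixed point is convex along rays (`coshDist_le_of_le`). The complement of the inner
neighbourhood is therefore bipartite, and a largest clique in it is a maximum independent set of a
bipartite graph.

The machine has no constant `π`, so it cannot compute on which side of the line a point lies.
Instead the inner neighbours are sorted by angle, starting from `v`, and a neighbour is put on the
second side as soon as it is not adjacent to one before it (`Input.Late`). If this division fails
to give two cliques, which cannot happen when all points lie in the disk of radius `R`, a flag is
raised, and all cliques of the graph are enumerated (`enumerateCliques`). This makes the output
correct on every graph (`computesMaximumClique_cliqueProgram`), and it costs nothing on almost all
samples.

Matchings are found by an auction instead of by augmenting paths: a free bidder takes the cheapest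
good that it wants, raises its price by one, and displaces the previous owner. Prices are at most
the number `K` of positions, so this takes `O(K ^ 2)` bids of `O(K)` steps each. Each owner holds a
good that is cheapest for it up to one unit, so a price level that no good has separates a maximum
independent set (`Auction.selected_indep`, `Auction.card_le_card_selected`). In all, the running
time is `O(n + m + ∑ v, k v ^ 3)`, where `k v` is the size of the inner neighbourhood of `v`
(`graphTime_cliqueProgram_le`).

For the expectation, the inner neighbours of a vertex at radius `r` are the hits of independent
points in a lens, so that `k v` has binomial moments (`lintegral_hits_cube_le`). The expected
number of hits is `O(exp ((1 - α) (R - r)))` by `pointLaw_lens_le`, and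
`O(exp (R / 2 - α (R - r)))` by `pointLaw_lens_le_of_radius`. A weighted geometric mean of the two
bounds, integrated against the radial density, gives
`∑ v, 𝔼 (k v ^ 3) = O(n + n ^ (4.5 (1 - α)))` (`exists_lintegral_lens_cube_le`). Finally, any two
points of the disk whose angles differ by at most `exp (-R / 2) = exp (-C / 2) / n` are adjacent,
so the expected number of edges is at least a constant times `n - 1`
(`le_lintegral_ncard_edgeSet`), which accounts for the terms linear in `n`.

The parts of the program share the following registers for natural numbers: 0 and 1 hold the
constants zero and one, 2 the number of vertices, 3 the current vertex `v`, 8 the first free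
position of the list of its inner neighbourhood, 13 the flag, 14 and 15 the size and the row of the
best clique found, 16 the active bidder (in the enumeration: the number of rows), 17 the last bidder
that has entered, 18 and 19 the chosen good and its price, 23 the price level and 25 the size of
the current clique; the others are for loops and temporary values. Array 0 is the output, array 1
the adjacency matrix, arrays 8 and 9 the cliques enumerated and their sizes. In row `v`, array 2
holds the list, array 3 the sides, array 4 the owners, array 5 the prices, array 6 the bidders that
gave up and array 7 the clique found, and array 0 of reals holds the keys.
-/

namespace HyperbolicClique

/-! ### A program logic with running times -/

/-- Weakest precondition: started in `s`, the program `p` halts in a state `s'` after `t` steps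
such that `Q s' t` holds. -/
def wp {n : ℕ} (I : Input n) (p : Program) (s : State) (Q : State → ℕ → Prop) : Prop :=
  ∃ s' t, Runs I p s s' t ∧ Q s' t

section wp

variable {n : ℕ} {I : Input n}

theorem wp.mono {p : Program} {s : State} {Q Q' : State → ℕ → Prop} (h : wp I p s Q)
    (hQ : ∀ s' t, Q s' t → Q' s' t) : wp I p s Q' := by
  obtain ⟨s', t, hr, hq⟩ := h
  exact ⟨s', t, hr, hQ _ _ hq⟩

theorem wp_instr {c : Instr} {s : State} {Q : State → ℕ → Prop} :
    wp I (.instr c) s Q ↔ Q (c.apply I s) 1 := by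
  constructor
  · rintro ⟨s', t, hr, hq⟩
    cases hr
    exact hq
  · exact fun h => ⟨_, _, .instr c s, h⟩

theorem wp_seq {p q : Program} {s : State} {Q : State → ℕ → Prop} :
    wp I (.seq p q) s Q ↔ wp I p s fun s' t => wp I q s' fun s'' t' => Q s'' (t + t') := by
  constructor
  · rintro ⟨s', t, hr, hq⟩
    cases hr with
    | seq h1 h2 => exact ⟨_, _, h1, _, _, h2, hq⟩
  · rintro ⟨s', t, hr, s'', t', hr', hq⟩
    exact ⟨_, _, .seq hr hr', hq⟩

theorem wp_ite {b : Test} {p q : Program} {s : State} {Q : State → ℕ → Prop} :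
    wp I (.ite b p q) s Q ↔
      (b.Holds s → wp I p s fun s' t => Q s' (t + 1)) ∧
        (¬ b.Holds s → wp I q s fun s' t => Q s' (t + 1)) := by
  constructor
  · rintro ⟨s', t, hr, hq⟩
    cases hr with
    | ite_true hb h => exact ⟨fun _ => ⟨_, _, h, hq⟩, fun hb' => absurd hb hb'⟩
    | ite_false hb h => exact ⟨fun hb' => absurd hb' hb, fun _ => ⟨_, _, h, hq⟩⟩
  · rintro ⟨h1, h2⟩
    by_cases hb : b.Holds s
    · obtain ⟨s', t, hr, hq⟩ := h1 hb
      exact ⟨_, _, .ite_true hb hr, hq⟩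
    · obtain ⟨s', t, hr, hq⟩ := h2 hb
      exact ⟨_, _, .ite_false hb hr, hq⟩

/-- The rule for loops: `Inv s t` holds whenever the loop test is about to be evaluated in state
`s`, after `t` steps, and the measure `μ` decreases with each iteration. -/
theorem wp_loop {b : Test} {p : Program} (Inv : State → ℕ → Prop) (μ : State → ℕ) {s : State}
    (h0 : Inv s 0)
    (hstep : ∀ s t, Inv s t → b.Holds s →
      wp I p s fun s' t' => Inv s' (t + t' + 1) ∧ μ s' < μ s) :
    wp I (.loop b p) s fun s' t => ∃ t₀, Inv s' t₀ ∧ ¬ b.Holds s' ∧ t = t₀ + 1 := by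
  suffices H : ∀ m s t, μ s = m → Inv s t →
      wp I (.loop b p) s fun s' t' => ∃ t₀, Inv s' t₀ ∧ ¬ b.Holds s' ∧ t + t' = t₀ + 1 by
    simpa using H _ s 0 rfl h0
  intro m
  induction m using Nat.strong_induction_on with
  | _ m ih =>
    intro s t hm hs
    by_cases hb : b.Holds s
    · obtain ⟨s', t', hr, hI, hlt⟩ := hstep s t hs hb
      obtain ⟨s'', t'', hr', t₀, h1, h2, h3⟩ := ih _ (hm ▸ hlt) s' _ rfl hI
      exact ⟨_, _, .loop_true hb hr hr', t₀, h1, h2, by omega⟩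
    · exact ⟨_, _, .loop_false hb, t, hs, hb, rfl⟩

end wp

/-! ### Frame conditions -/

/-- The natural-number register to which an instruction assigns. -/
def Instr.target : Instr → Option ℕ
  | .const x _ | .copy x _ | .succ x | .pred x | .load x _ _ _ | .size x | .degree x _
  | .neighbour x _ _ => some x
  | _ => none

/-- The real register to which an instruction assigns. -/
def Instr.realTarget : Instr → Option ℕ
  | .rcast x _ | .rcopy x _ | .radd x _ _ | .rsub x _ _ | .rmul x _ _ | .rdiv x _ _
  | .rload x _ _ _ | .radius x _ | .angle x _ | .distance x _ _ => some x
  | _ => none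

/-- The array of natural numbers into which an instruction stores, together with the register that
holds the row number. -/
def Instr.storeTarget : Instr → Option (ℕ × ℕ)
  | .store a i _ _ => some (a, i)
  | _ => none

/-- The array of reals into which an instruction stores. -/
def Instr.realStoreTarget : Instr → Option ℕ
  | .rstore a _ _ _ => some a
  | _ => none

/-- All instructions occurring in a program satisfy `f`. -/
def Program.all (f : Instr → Bool) : Program → Bool
  | .instr c => f c
  | .seq p q => p.all f && q.all f
  | .ite _ p q => p.all f && q.all f
  | .loop _ p => p.all f

/-- The program does not assign to the register `r`. -/
def Program.keepsReg (p : Program) (r : ℕ) : Bool := p.all fun c => c.target != some r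

/-- The program does not assign to the real register `r`. -/
def Program.keepsReal (p : Program) (r : ℕ) : Bool := p.all fun c => c.realTarget != some r

/-- The program does not store into the array `a`. -/
def Program.keepsMem (p : Program) (a : ℕ) : Bool :=
  p.all fun c => c.storeTarget.all fun x => x.1 != a

/-- The program does not store into the array `a` of reals. -/
def Program.keepsRealMem (p : Program) (a : ℕ) : Bool := p.all fun c => c.realStoreTarget != some a

/-- All stores into the array `a` are into the row whose number is in the register `r`, and the
program does not change that register. -/
def Program.storesInRow (p : Program) (r a : ℕ) : Bool :=
  p.keepsReg r && p.all fun c => c.storeTarget.all fun x => x.1 != a || x.2 == r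

/-- A property of states relative to a starting state is preserved along a run if each instruction
of the program preserves it. -/
theorem Runs.induct {n : ℕ} {I : Input n} (P : State → Prop) {f : Instr → Bool}
    (hf : ∀ c s, f c = true → P s → P (c.apply I s)) {p : Program} {s s' : State} {t : ℕ}
    (h : Runs I p s s' t) (hp : p.all f = true) (hs : P s) : P s' := by
  induction h with
  | instr c s => exact hf c s hp hs
  | seq _ _ ih1 ih2 =>
    simp only [Program.all, Bool.and_eq_true] at hp
    exact ih2 hp.2 (ih1 hp.1 hs)
  | ite_true _ _ ih =>
    simp only [Program.all, Bool.and_eq_true] at hp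
    exact ih hp.1 hs
  | ite_false _ _ ih =>
    simp only [Program.all, Bool.and_eq_true] at hp
    exact ih hp.2 hs
  | loop_true _ _ _ ih1 ih2 => exact ih2 hp (ih1 hp hs)
  | loop_false _ => exact hs

theorem Runs.reg_eq {n : ℕ} {I : Input n} {p : Program} {s s' : State} {t r : ℕ}
    (h : Runs I p s s' t) (hp : p.keepsReg r = true) : s'.reg r = s.reg r := by
  refine h.induct (fun s' => s'.reg r = s.reg r) ?_ hp rfl
  intro c s' hc hs'
  rw [← hs']
  cases c <;> simp [Instr.apply, Instr.target, State.setReg, State.setReal, State.setMem,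
    State.setRealMem, Function.update_apply] at hc ⊢ <;> exact fun h => absurd h.symm hc

theorem Runs.rreg_eq {n : ℕ} {I : Input n} {p : Program} {s s' : State} {t r : ℕ}
    (h : Runs I p s s' t) (hp : p.keepsReal r = true) : s'.rreg r = s.rreg r := by
  refine h.induct (fun s' => s'.rreg r = s.rreg r) ?_ hp rfl
  intro c s' hc hs'
  rw [← hs']
  cases c <;> simp [Instr.apply, Instr.realTarget, State.setReg, State.setReal, State.setMem,
    State.setRealMem, Function.update_apply] at hc ⊢ <;> exact fun h => absurd h.symm hc

theorem Runs.mem_eq {n : ℕ} {I : Input n} {p : Program} {s s' : State} {t a : ℕ}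
    (h : Runs I p s s' t) (hp : p.keepsMem a = true) : s'.mem a = s.mem a := by
  refine h.induct (fun s' => s'.mem a = s.mem a) ?_ hp rfl
  intro c s' hc hs'
  rw [← hs']
  cases c <;> simp_all [Instr.apply, Instr.storeTarget, State.setReg, State.setReal, State.setMem,
    State.setRealMem]
  funext i j
  exact if_neg fun h => hc h.1.symm

theorem Runs.rmem_eq {n : ℕ} {I : Input n} {p : Program} {s s' : State} {t a : ℕ}
    (h : Runs I p s s' t) (hp : p.keepsRealMem a = true) : s'.rmem a = s.rmem a := by
  refine h.induct (fun s' => s'.rmem a = s.rmem a) ?_ hp rfl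
  intro c s' hc hs'
  rw [← hs']
  cases c <;> simp_all [Instr.apply, Instr.realStoreTarget, State.setReg, State.setReal,
    State.setMem, State.setRealMem]
  funext i j
  exact if_neg fun h => hc h.1.symm

theorem Runs.row_eq {n : ℕ} {I : Input n} {p : Program} {s s' : State} {t r a : ℕ}
    (h : Runs I p s s' t) (hp : p.storesInRow r a = true) {i : ℕ} (hi : i ≠ s.reg r) :
    s'.mem a i = s.mem a i := by
  simp only [Program.storesInRow, Bool.and_eq_true] at hp
  have hk := hp.1
  have hall : p.all (fun c => (c.target != some r) &&
      (c.storeTarget.all fun x => x.1 != a || x.2 == r)) = true := by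
    clear h
    have hk' : p.all (fun c => c.target != some r) = true := hk
    have h2 := hp.2
    clear hk hp
    induction p <;> simp_all [Program.all]
  refine (h.induct (fun s' => s'.mem a i = s.mem a i ∧ s'.reg r = s.reg r) ?_ hall
    ⟨rfl, rfl⟩).1
  rintro c s' hc ⟨hm, hr⟩
  rw [← hm, ← hr]
  rw [← hr] at hi
  cases c <;> simp [Instr.apply, Instr.storeTarget, Instr.target, State.setReg, State.setReal,
    State.setMem, State.setRealMem, Function.update_apply] at hc ⊢ <;>
    try exact fun h => absurd h.symm hc
  funext j
  refine if_neg fun h => ?_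
  rcases hc with hc | hc
  · exact hc h.1.symm
  · exact hi (hc ▸ h.2.1)

/-- `s'` agrees with `s` in all that the program `p` leaves alone. -/
structure Frame (p : Program) (s s' : State) : Prop where
  reg : ∀ r, p.keepsReg r = true → s'.reg r = s.reg r
  real : ∀ r, p.keepsReal r = true → s'.rreg r = s.rreg r
  mem : ∀ a, p.keepsMem a = true → s'.mem a = s.mem a
  rmem : ∀ a, p.keepsRealMem a = true → s'.rmem a = s.rmem a
  row : ∀ r a i, p.storesInRow r a = true → i ≠ s.reg r → s'.mem a i = s.mem a i

theorem Runs.frame {n : ℕ} {I : Input n} {p : Program} {s s' : State} {t : ℕ}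
    (h : Runs I p s s' t) : Frame p s s' :=
  ⟨fun _ => h.reg_eq, fun _ => h.rreg_eq, fun _ => h.mem_eq, fun _ => h.rmem_eq,
    fun _ _ _ hp hi => h.row_eq hp hi⟩

theorem wp.frame {n : ℕ} {I : Input n} {p : Program} {s : State} {Q : State → ℕ → Prop}
    (h : wp I p s Q) : wp I p s fun s' t => Q s' t ∧ Frame p s s' := by
  obtain ⟨s', t, hr, hq⟩ := h
  exact ⟨s', t, hr, hq, hr.frame⟩

/-! ### Counting loops -/

/-- `forLoop i a b body` runs `body` with the register `i` equal to `a`, `a + 1`, … while `i` is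
less than the register `b`. -/
def forLoop (i a b : ℕ) (body : Program) : Program :=
  .seq (.instr (.const i a)) (.loop (.lt i b) (.seq body (.instr (.succ i))))

theorem Frame.refl (p : Program) (s : State) : Frame p s s :=
  ⟨fun _ _ => rfl, fun _ _ => rfl, fun _ _ => rfl, fun _ _ => rfl, fun _ _ _ _ _ => rfl⟩

theorem Frame.trans {p : Program} {s s' s'' : State} (h : Frame p s s') (h' : Frame p s' s'') :
    Frame p s s'' where
  reg r hr := (h'.reg r hr).trans (h.reg r hr)
  real r hr := (h'.real r hr).trans (h.real r hr)
  mem a ha := (h'.mem a ha).trans (h.mem a ha)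
  rmem a ha := (h'.rmem a ha).trans (h.rmem a ha)
  row r a i ha hi := by
    have hr : p.keepsReg r = true := by
      simp only [Program.storesInRow, Bool.and_eq_true] at ha
      exact ha.1
    rw [h'.row r a i ha (by rwa [h.reg r hr]), h.row r a i ha hi]

theorem Frame.of_part {p q : Program} (hpq : ∀ f, q.all f = true → p.all f = true) {s s' : State}
    (h : Frame p s s') : Frame q s s' where
  reg r hr := h.reg r (hpq _ hr)
  real r hr := h.real r (hpq _ hr)
  mem a ha := h.mem a (hpq _ ha)
  rmem a ha := h.rmem a (hpq _ ha)
  row r a i ha hi := by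
    refine h.row r a i ?_ hi
    simp only [Program.storesInRow, Bool.and_eq_true] at ha ⊢
    exact ⟨hpq _ ha.1, hpq _ ha.2⟩

/-- The rule for counting loops: `Inv m s t` holds, after `t` steps, whenever the test is about to
be evaluated with `m` in the loop register. -/
theorem wp_forLoop {n : ℕ} {I : Input n} {i a b : ℕ} {body : Program}
    (Inv : ℕ → State → ℕ → Prop) {s₀ : State} (hab : a ≤ s₀.reg b)
    (hi : body.keepsReg i = true) (hb : (forLoop i a b body).keepsReg b = true)
    (h0 : Inv a (s₀.setReg i a) 1)
    (hstep : ∀ m s t, a ≤ m → m < s₀.reg b → s.reg i = m → s.reg b = s₀.reg b →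
      Frame (forLoop i a b body) s₀ s → Inv m s t →
      wp I body s fun s' t' => Inv (m + 1) (s'.setReg i (m + 1)) (t + t' + 2)) :
    wp I (forLoop i a b body) s₀ fun s' t =>
      (∃ t₀, Inv (s₀.reg b) s' t₀ ∧ t = t₀ + 1) ∧ Frame (forLoop i a b body) s₀ s' := by
  refine wp.frame ?_
  have hib : b ≠ i := by
    rintro rfl
    simp [forLoop, Program.keepsReg, Program.all, Instr.target] at hb
  have hF1 : Frame (forLoop i a b body) s₀ (s₀.setReg i a) :=
    (Runs.frame (Runs.instr (I := I) (.const i a) s₀)).of_part fun f hf => by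
      simp only [forLoop, Program.all, Bool.and_eq_true] at hf ⊢
      exact hf.1
  unfold forLoop
  rw [wp_seq, wp_instr]
  refine (wp_loop (fun s t => ∃ m, a ≤ m ∧ m ≤ s₀.reg b ∧ s.reg i = m ∧
    s.reg b = s₀.reg b ∧ Frame (forLoop i a b body) s₀ s ∧ Inv m s (t + 1))
    (fun s => s₀.reg b - s.reg i) ?_ ?_).mono ?_
  · exact ⟨a, le_rfl, hab, by simp [State.setReg, Instr.apply],
      by simp [State.setReg, Instr.apply, hib], hF1, h0⟩
  · rintro s t ⟨m, hm1, hm2, hm3, hm4, hF, hI⟩ hlt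
    have hlt' : m < s₀.reg b := by
      simpa [Test.Holds, hm3, hm4] using hlt
    rw [wp_seq]
    refine (hstep m s (t + 1) hm1 hlt' hm3 hm4 hF hI).frame.mono ?_
    rintro s' t' ⟨hI', hF'⟩
    rw [wp_instr]
    have hr : s'.reg i = m := (hF'.reg i hi).trans hm3
    have hap : (Instr.succ i).apply I s' = s'.setReg i (m + 1) := by
      simp [Instr.apply, hr]
    have hF2 : Frame (forLoop i a b body) s₀ (s'.setReg i (m + 1)) := by
      refine (hF.trans (hF'.of_part fun f hf => ?_)).trans (Frame.of_part (p := .instr (.succ i)) ?_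
        (hap ▸ (Runs.frame (Runs.instr (I := I) (.succ i) s'))))
      · simp only [forLoop, Program.all, Bool.and_eq_true] at hf
        exact hf.2.1
      · intro f hf
        simp only [forLoop, Program.all, Bool.and_eq_true] at hf ⊢
        exact hf.2.2
    rw [hap]
    refine ⟨⟨m + 1, by omega, hlt', by simp [State.setReg], ?_, hF2, ?_⟩, ?_⟩
    · rw [hF2.reg b hb]
    · convert hI' using 1
      ring
    · simp [State.setReg, hm3]
      omega
  · rintro s' t ⟨t₀, ⟨m, hm1, hm2, hm3, hm4, hF, hI⟩, hb', rfl⟩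
    have : m = s₀.reg b := by
      simp [Test.Holds, hm3, hm4] at hb'
      omega
    subst this
    exact ⟨t₀ + 1, hI, by ring⟩

/-! ### Reading registers and arrays after an assignment -/

section simp

variable (s : State) (x a i j k r : ℕ) (c : ℝ)

@[simp] theorem State.setReg_reg : (s.setReg x k).reg r = if r = x then k else s.reg r :=
  Function.update_apply ..
@[simp] theorem State.setReg_mem : (s.setReg x k).mem = s.mem := rfl
@[simp] theorem State.setReg_rreg : (s.setReg x k).rreg = s.rreg := rfl
@[simp] theorem State.setReg_rmem : (s.setReg x k).rmem = s.rmem := rfl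
@[simp] theorem State.setReal_reg : (s.setReal x c).reg = s.reg := rfl
@[simp] theorem State.setReal_mem : (s.setReal x c).mem = s.mem := rfl
@[simp] theorem State.setReal_rreg : (s.setReal x c).rreg r = if r = x then c else s.rreg r :=
  Function.update_apply ..
@[simp] theorem State.setReal_rmem : (s.setReal x c).rmem = s.rmem := rfl
@[simp] theorem State.setMem_reg : (s.setMem a i j k).reg = s.reg := rfl
@[simp] theorem State.setMem_mem (a' i' j' : ℕ) : (s.setMem a i j k).mem a' i' j' =
    if a' = a ∧ i' = i ∧ j' = j then k else s.mem a' i' j' := rfl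
@[simp] theorem State.setMem_rreg : (s.setMem a i j k).rreg = s.rreg := rfl
@[simp] theorem State.setMem_rmem : (s.setMem a i j k).rmem = s.rmem := rfl
@[simp] theorem State.setRealMem_reg : (s.setRealMem a i j c).reg = s.reg := rfl
@[simp] theorem State.setRealMem_mem : (s.setRealMem a i j c).mem = s.mem := rfl
@[simp] theorem State.setRealMem_rreg : (s.setRealMem a i j c).rreg = s.rreg := rfl
@[simp] theorem State.setRealMem_rmem (a' i' j' : ℕ) : (s.setRealMem a i j c).rmem a' i' j' =
    if a' = a ∧ i' = i ∧ j' = j then c else s.rmem a' i' j' := rfl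

end simp

/-! ### The adjacency matrix -/

/-- The program that does nothing. -/
def skip : Program := .instr .skip

/-- The instructions `cs`, followed by the program `p`. -/
def block : List Instr → Program → Program
  | [], p => p
  | c :: cs, p => .seq (.instr c) (block cs p)

/-- Symbolic execution of a block: whatever is known of the state after the instructions `cs` is
collected in `P`. -/
theorem wp_block {n : ℕ} {I : Input n} {cs : List Instr} {p : Program} {s : State}
    {Q : State → ℕ → Prop} (P : State → Prop) (h : P (cs.foldl (fun s c => c.apply I s) s))
    (h' : ∀ s', P s' → wp I p s' fun s'' t => Q s'' (cs.length + t)) :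
    wp I (block cs p) s Q := by
  induction cs generalizing s Q with
  | nil => simpa [block] using h' _ h
  | cons c cs ih =>
    rw [block, wp_seq, wp_instr]
    refine ih h fun s' hs' => (h' s' hs').mono fun s'' t hQ => ?_
    rw [← add_assoc, Nat.add_comm 1]
    exact hQ

theorem Frame.block {n : ℕ} (I : Input n) (cs : List Instr) (p : Program) (s : State) :
    Frame (block cs p) s (cs.foldl (fun s c => c.apply I s) s) := by
  induction cs generalizing s with
  | nil => exact .refl _ _
  | cons c cs ih =>
    refine ((Runs.instr (I := I) c s).frame.of_part ?_).trans ((ih _).of_part ?_)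
    all_goals
      intro f hf
      simp only [HyperbolicClique.block, Program.all, Bool.and_eq_true] at hf ⊢
    · exact hf.1
    · exact hf.2

attribute [simp] wp_seq wp_instr wp_ite block skip Instr.apply Test.Holds

/-- The closed adjacency relation of the input graph, on vertex numbers. -/
def Input.Conn {n : ℕ} (I : Input n) (u w : ℕ) : Prop :=
  u < n ∧ (u = w ∨ ∃ i < I.degree u, I.neighbour u i = w)

/-- Writes the closed adjacency matrix of the input graph into array 1. -/
def connMatrix : Program :=
  forLoop 3 0 2 (block [.store 1 3 3 1, .degree 4 3]
    (forLoop 5 0 4 (block [.neighbour 9 3 5, .store 1 3 9 1] skip)))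

theorem wp_connMatrix {n : ℕ} {I : Input n} {s : State} (h1 : s.reg 1 = 1) (h2 : s.reg 2 = n)
    (hm : ∀ i j, s.mem 1 i j = 0) :
    wp I connMatrix s fun s' t => (∀ u w, s'.mem 1 u w = 1 ↔ I.Conn u w) ∧
      t ≤ ∑ v ∈ Finset.range n, (5 * I.degree v + 6) + 2 := by
  refine (wp_forLoop (fun m s t => (∀ u w, s.mem 1 u w = 1 ↔ u < m ∧ I.Conn u w) ∧
    t ≤ ∑ v ∈ Finset.range m, (5 * I.degree v + 6) + 1) (Nat.zero_le _) rfl rfl ?_ ?_).mono ?_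
  · simp [hm]
  · rintro m s' t - hlt hi hb hF ⟨hI, ht⟩
    have h1' : s'.reg 1 = 1 := (hF.reg 1 rfl).trans h1
    rw [h2] at hlt
    simp only [block, wp_seq, wp_instr, Instr.apply]
    refine (wp_forLoop (fun k s t => (∀ u w, s.mem 1 u w = 1 ↔ (u < m ∧ I.Conn u w) ∨
      u = m ∧ (u = w ∨ ∃ i < k, I.neighbour u i = w)) ∧ t ≤ 5 * k + 1)
      (Nat.zero_le _) rfl rfl ?_ ?_).mono ?_
    · simp only [State.setReg_mem, State.setMem_mem, hi, h1', le_refl, and_true, true_and]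
      intro u w
      split_ifs with h
      · simp [h.1, h.2]
      · rw [hI]
        simp
        rintro rfl rfl
        exact absurd ⟨rfl, rfl⟩ h
    · rintro k s'' t'' - hlt' hi' hb' hF' ⟨hI', ht'⟩
      have h1'' : s''.reg 1 = 1 := (hF'.reg 1 rfl).trans (by simpa using h1')
      have h3'' : s''.reg 3 = m := (hF'.reg 3 rfl).trans (by simpa using hi)
      simp [h1'', h3'', hi', hI']
      refine ⟨fun u w => ?_, by omega⟩
      by_cases hu : u = m
      · subst hu
        simp only [forall_const, lt_irrefl, false_and, false_or, true_and, Nat.le_iff_lt_or_eq,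
          or_and_right, exists_or, exists_eq_left]
        rw [eq_comm (a := w)]
        by_cases h : I.neighbour u k = w <;> simp [h]
      · simp [hu]
    · rintro s'' t'' ⟨⟨t₀, ⟨hI', ht'⟩, rfl⟩, hF'⟩
      simp [hi] at hI' ht' ⊢
      refine ⟨fun u w => ?_, ?_⟩
      · rw [hI' u w, Nat.le_iff_lt_or_eq, or_and_right]
        refine or_congr_right (and_congr_right ?_)
        rintro rfl
        simp [Input.Conn, hlt]
      · rw [Finset.sum_range_succ]
        omega
  · rintro s' t ⟨⟨t₀, ⟨hI, ht⟩, rfl⟩, hF⟩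
    rw [h2] at hI ht
    refine ⟨fun u w => ?_, by omega⟩
    rw [hI]
    exact and_iff_right_of_imp fun h => h.1

/-! ### The inner neighbourhood of a vertex -/

/-- The neighbours listed of a vertex are distinct, and the adjacency relation is symmetric and
irreflexive. -/
structure Input.Proper {n : ℕ} (I : Input n) : Prop where
  ne : ∀ v < n, ∀ i < I.degree v, I.neighbour v i ≠ v
  inj : ∀ v < n, ∀ i < I.degree v, ∀ j < I.degree v, I.neighbour v i = I.neighbour v j → i = j
  symm : ∀ u w, I.Conn u w → I.Conn w u

/-- The closed neighbours of `v` that are not further from the origin than `v`. -/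
def Input.inner {n : ℕ} (I : Input n) (v : ℕ) : Set ℕ :=
  {w | I.Conn v w ∧ (I.point w).1 ≤ (I.point v).1}

/-- A key that sorts the vertices anticlockwise, starting from `v`, if all angles are in
`[0, 2π)`: the number `7` exceeds `2π`. -/
noncomputable def Input.key {n : ℕ} (I : Input n) (v w : ℕ) : ℝ :=
  open scoped Classical in
  if (I.point w).2 < (I.point v).2 then (I.point w).2 + 7 else (I.point w).2

/-- The positions `1, …, K - 1` of `L` list the inner neighbourhood of `v` without repetition, and
`key` holds the keys. -/
structure ListsInner {n : ℕ} (I : Input n) (v K : ℕ) (L : ℕ → ℕ) (key : ℕ → ℝ) : Prop where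
  two_le : 2 ≤ K
  inj : ∀ i j, 1 ≤ i → i < K → 1 ≤ j → j < K → L i = L j → i = j
  mem_iff : ∀ w, (∃ i, 1 ≤ i ∧ i < K ∧ L i = w) ↔ w ∈ I.inner v
  key_eq : ∀ i, 1 ≤ i → i < K → key i = I.key v (L i)

/-- Lists the inner neighbourhood of the vertex in register 3 in row `v` of array 2, with the keys
in real array 0; register 8 is set to the first free position. -/
def listInner : Program :=
  block [.degree 4 3, .copy 8 1, .store 2 3 8 3, .const 11 7, .rcast 4 11, .radius 0 3, .angle 2 3,
    .rstore 0 3 8 2, .succ 8]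
    (forLoop 5 0 4 (block [.neighbour 9 3 5, .radius 1 9]
      (.ite (.rle 1 0)
        (block [.store 2 3 8 9, .angle 3 9]
          (.seq (.ite (.rlt 3 2) (.instr (.radd 3 3 4)) skip)
            (block [.rstore 0 3 8 3, .succ 8] skip)))
        skip)))

theorem wp_listInner {n : ℕ} {I : Input n} (hI : I.Proper) {s : State} {v : ℕ} (hv : v < n)
    (h1 : s.reg 1 = 1) (h3 : s.reg 3 = v) :
    wp I listInner s fun s' t => ListsInner I v (s'.reg 8) (s'.mem 2 v) (s'.rmem 0 v) ∧
      t ≤ 12 * I.degree v + 11 := by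
  refine wp_block (fun s' => (s'.reg 3 = v ∧ s'.reg 4 = I.degree v ∧ s'.reg 8 = 2 ∧
    s'.mem 2 v 1 = v ∧ s'.rmem 0 v 1 = (I.point v).2 ∧ s'.rreg 0 = (I.point v).1 ∧
    s'.rreg 2 = (I.point v).2 ∧ s'.rreg 4 = 7)) (by simp [h1, h3]) ?_
  rintro s₁ ⟨h3, h4, h8, hm, hrm, h0, h2, hr4⟩
  refine (wp_forLoop (fun m s t => (2 ≤ s.reg 8 ∧
    (∀ i j, 1 ≤ i → i < s.reg 8 → 1 ≤ j → j < s.reg 8 → s.mem 2 v i = s.mem 2 v j → i = j) ∧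
    (∀ w, (∃ i, 1 ≤ i ∧ i < s.reg 8 ∧ s.mem 2 v i = w) ↔
      w = v ∨ (∃ i < m, I.neighbour v i = w) ∧ (I.point w).1 ≤ (I.point v).1) ∧
    (∀ i, 1 ≤ i → i < s.reg 8 → s.rmem 0 v i = I.key v (s.mem 2 v i))) ∧
    t ≤ 12 * m + 1) (Nat.zero_le _) rfl rfl ?_ ?_).mono ?_
  · simp only [State.setReg_reg, State.setReg_mem, State.setReg_rmem, h8]
    refine ⟨⟨by simp, fun i j _ hi _ hj _ => ?_, fun w => ?_, fun i hi hi' => ?_⟩, by simp⟩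
    · simp only [Nat.reduceEqDiff, if_false] at hi hj
      omega
    · constructor
      · rintro ⟨i, hi, hi', h⟩
        have : i = 1 := by
          simp only [Nat.reduceEqDiff, if_false] at hi'
          omega
        rw [this, hm] at h
        exact Or.inl h.symm
      · rintro (rfl | ⟨⟨i, hi, -⟩, -⟩)
        · exact ⟨1, by simp [hm]⟩
        · exact absurd hi (Nat.not_lt_zero i)
    · have : i = 1 := by
        simp only [Nat.reduceEqDiff, if_false] at hi'
        omega
      simp [this, Input.key, hm, hrm]
  · rintro m s' t - hlt hi hb hF ⟨⟨hK, hinj, hmem, hkey⟩, ht⟩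
    have h3' : s'.reg 3 = v := (hF.reg 3 rfl).trans h3
    have hr0 : s'.rreg 0 = (I.point v).1 := (hF.real 0 rfl).trans h0
    have hr2 : s'.rreg 2 = (I.point v).2 := (hF.real 2 rfl).trans h2
    have hr4 : s'.rreg 4 = 7 := (hF.real 4 rfl).trans hr4
    have hlt' : m < I.degree v := h4 ▸ hlt
    have hext : ∀ w, ((∃ i < m + 1, I.neighbour v i = w) ∧ (I.point w).1 ≤ (I.point v).1) ↔
        ((∃ i < m, I.neighbour v i = w) ∧ (I.point w).1 ≤ (I.point v).1) ∨
          (w = I.neighbour v m ∧ (I.point w).1 ≤ (I.point v).1) := by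
      intro w
      rw [← or_and_right]
      refine and_congr_left fun _ => ?_
      simp only [Nat.lt_succ_iff_lt_or_eq, or_and_right, exists_or, exists_eq_left]
      rw [eq_comm (a := w)]
    simp only [block, skip, wp_seq, wp_instr, Instr.apply, wp_ite, Test.Holds]
    constructor
    · intro hle
      have hle' : (I.point (I.neighbour v m)).1 ≤ (I.point v).1 := by
        simpa [h3', hi, hr0] using hle
      have hnew : ∀ i, 1 ≤ i → i < s'.reg 8 → s'.mem 2 v i ≠ I.neighbour v m := by
        intro i hi1 hi2 h
        rcases (hmem (I.neighbour v m)).1 ⟨i, hi1, hi2, h⟩ with h | ⟨⟨j, hj, hj'⟩, -⟩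
        · exact hI.ne v hv m hlt' h
        · exact absurd (hI.inj v hv j (by omega) m hlt' hj') (by omega)
      have hfin : ∀ (x : ℝ) (s'' : State), s''.reg 8 = s'.reg 8 + 1 → s''.mem 2 v = Function.update (s'.mem 2 v)
          (s'.reg 8) (I.neighbour v m) → s''.rmem 0 v = Function.update (s'.rmem 0 v) (s'.reg 8) x →
          x = I.key v (I.neighbour v m) →
        (2 ≤ s''.reg 8 ∧
        (∀ i j, 1 ≤ i → i < s''.reg 8 → 1 ≤ j → j < s''.reg 8 →
          s''.mem 2 v i = s''.mem 2 v j → i = j) ∧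
        (∀ w, (∃ i, 1 ≤ i ∧ i < s''.reg 8 ∧ s''.mem 2 v i = w) ↔
          w = v ∨ (∃ i < m + 1, I.neighbour v i = w) ∧ (I.point w).1 ≤ (I.point v).1) ∧
        (∀ i, 1 ≤ i → i < s''.reg 8 → s''.rmem 0 v i = I.key v (s''.mem 2 v i))) := by
        intro x s'' hreg hmm hrm hx
        simp only [hreg, hmm, hrm, Function.update_apply]
        refine ⟨by omega, ?_, ?_, ?_⟩
        · intro i j hi1 hi2 hj1 hj2 h
          split_ifs at h with h1 h2 h2
          · omega
          · exact absurd h.symm (hnew j hj1 (by omega))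
          · exact absurd h (hnew i hi1 (by omega))
          · exact hinj i j hi1 (by omega) hj1 (by omega) h
        · intro w
          rw [hext, ← or_assoc, ← hmem]
          constructor
          · rintro ⟨i, hi1, hi2, h⟩
            split_ifs at h with h1
            · exact Or.inr ⟨h.symm, h ▸ hle'⟩
            · exact Or.inl ⟨i, hi1, by omega, h⟩
          · rintro (⟨i, hi1, hi2, h⟩ | ⟨rfl, -⟩)
            · exact ⟨i, hi1, by omega, by rwa [if_neg (by omega)]⟩
            · exact ⟨s'.reg 8, by omega, by omega, if_pos rfl⟩
        · intro i hi1 hi2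
          split_ifs with h1
          · exact hx
          · exact hkey i hi1 (by omega)
      constructor
      · intro hlt2
        have hlt3 : (I.point (I.neighbour v m)).2 < (I.point v).2 := by
          simpa [h3', hi, hr2] using hlt2
        refine ⟨hfin ((I.point (I.neighbour v m)).2 + 7) _ ?_ ?_ ?_ ?_, by omega⟩
        · simp
        · ext r
          simp [Function.update_apply, hi, h3']
        · ext r
          simp [Function.update_apply, hi, h3', hr4]
        · simp [Input.key, hlt3]
      · intro hlt2
        have hlt3 : ¬ (I.point (I.neighbour v m)).2 < (I.point v).2 := by
          simpa [h3', hi, hr2] using hlt2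
        refine ⟨hfin ((I.point (I.neighbour v m)).2) _ ?_ ?_ ?_ ?_, by omega⟩
        · simp
        · ext r
          simp [Function.update_apply, hi, h3']
        · ext r
          simp [Function.update_apply, hi, h3']
        · simp [Input.key, hlt3]
    · intro hle
      have hle' : ¬ (I.point (I.neighbour v m)).1 ≤ (I.point v).1 := by
        simpa [h3', hi, hr0] using hle
      refine ⟨⟨hK, hinj, fun w => ?_, hkey⟩, by omega⟩
      simp only [State.setReg_reg, State.setReal_reg, State.setReg_mem, State.setReal_mem]
      rw [hext, ← or_assoc, ← hmem]
      refine (or_iff_left ?_).symm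
      rintro ⟨rfl, h⟩
      exact hle' h
  · rintro s' t ⟨⟨t₀, ⟨⟨hK, hinj, hmem, hkey⟩, ht⟩, rfl⟩, hF⟩
    rw [h4] at ht hmem
    refine ⟨⟨hK, hinj, fun w => ?_, hkey⟩, by simp; omega⟩
    rw [hmem]
    simp only [Input.inner, Input.Conn, hv, true_and, Set.mem_ofPred_eq, or_and_right]
    refine or_congr ⟨?_, fun h => h.1.symm⟩ Iff.rfl
    rintro rfl
    exact ⟨rfl, le_rfl⟩

theorem exists_lt_add_one {a m : ℕ} (h : a ≤ m) {P : ℕ → Prop} :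
    (∃ j, a ≤ j ∧ j < m + 1 ∧ P j) ↔ (∃ j, a ≤ j ∧ j < m ∧ P j) ∨ P m := by
  constructor
  · rintro ⟨j, h1, h2, hP⟩
    rcases Nat.lt_succ_iff_lt_or_eq.1 h2 with h3 | rfl
    · exact Or.inl ⟨j, h1, h3, hP⟩
    · exact Or.inr hP
  · rintro (⟨j, h1, h2, hP⟩ | hP)
    · exact ⟨j, h1, by omega, hP⟩
    · exact ⟨m, h, by omega, hP⟩

/-! ### Splitting the inner neighbourhood into two sides -/

/-- Stores in array 3 the side of each position of the list: side 1 if some earlier vertex (in the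
order of the keys) is not adjacent, and side 0 otherwise. -/
def chooseSides : Program :=
  forLoop 5 1 8 (block [.const 11 0, .load 9 2 3 5, .rload 0 0 3 5]
    (.seq
      (forLoop 6 1 8 (block [.load 10 2 3 6, .load 12 1 9 10, .rload 1 0 3 6]
        (.ite (.ne 12 1) (.ite (.rle 1 0) (.instr (.const 11 1)) skip) skip)))
      (.instr (.store 3 3 5 11))))

theorem wp_chooseSides {n : ℕ} {I : Input n} {s : State} {v : ℕ} (h1 : s.reg 1 = 1)
    (h3 : s.reg 3 = v) (h8 : 1 ≤ s.reg 8) :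
    wp I chooseSides s fun s' t => (∀ i, 1 ≤ i → i < s.reg 8 →
      (s'.mem 3 v i = 0 ∨ s'.mem 3 v i = 1) ∧ (s'.mem 3 v i = 1 ↔ ∃ j, 1 ≤ j ∧ j < s.reg 8 ∧
        s.mem 1 (s.mem 2 v i) (s.mem 2 v j) ≠ 1 ∧ s.rmem 0 v j ≤ s.rmem 0 v i)) ∧
      t ≤ s.reg 8 * (8 * s.reg 8 + 8) + 2 := by
  refine (wp_forLoop (fun m s' t => (∀ i, 1 ≤ i → i < m →
      (s'.mem 3 v i = 0 ∨ s'.mem 3 v i = 1) ∧ (s'.mem 3 v i = 1 ↔ ∃ j, 1 ≤ j ∧ j < s.reg 8 ∧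
        s.mem 1 (s.mem 2 v i) (s.mem 2 v j) ≠ 1 ∧ s.rmem 0 v j ≤ s.rmem 0 v i)) ∧
      t ≤ m * (8 * s.reg 8 + 8) + 1) h8 rfl rfl ?_ ?_).mono ?_
  · refine ⟨fun i hi hi' => by omega, by simp⟩
  · rintro m s' t hm hlt hi hb hF ⟨hI, ht⟩
    have h3' : s'.reg 3 = v := (hF.reg 3 rfl).trans h3
    have h1' : s'.reg 1 = 1 := (hF.reg 1 rfl).trans h1
    have hm1 : s'.mem 1 = s.mem 1 := hF.mem 1 rfl
    have hm2 : s'.mem 2 = s.mem 2 := hF.mem 2 rfl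
    have hrm : s'.rmem 0 = s.rmem 0 := hF.rmem 0 rfl
    refine wp_block (fun s₁ => s₁.reg 11 = 0 ∧ s₁.reg 9 = s.mem 2 v m ∧ s₁.rreg 0 = s.rmem 0 v m ∧
      s₁.reg 8 = s.reg 8 ∧ s₁.reg 3 = v ∧ s₁.reg 5 = m ∧ s₁.reg 1 = 1 ∧ s₁.mem = s'.mem ∧
      s₁.rmem = s'.rmem) (by simp [h1', h3', hi, hm2, hrm, hb]) ?_
    rintro s₁ ⟨h11, h9, hr0, h8', h3₁, h5₁, h1₁, hmem₁, hrm₁⟩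
    rw [wp_seq]
    refine (wp_forLoop (fun k s₂ t₂ => (s₂.reg 11 = 0 ∨ s₂.reg 11 = 1) ∧
      (s₂.reg 11 = 1 ↔ ∃ j, 1 ≤ j ∧ j < k ∧
        s.mem 1 (s.mem 2 v m) (s.mem 2 v j) ≠ 1 ∧ s.rmem 0 v j ≤ s.rmem 0 v m) ∧
      t₂ ≤ k * 8) (h8'.symm ▸ h8) rfl rfl ?_ ?_).mono ?_
    · simp [h11]
    · rintro k s₂ t₂ hk1 hk2 hi₂ hb₂ hF₂ ⟨hI1, hI2, ht₂⟩
      have e3 : s₂.reg 3 = v := (hF₂.reg 3 rfl).trans h3₁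
      have e9 : s₂.reg 9 = s.mem 2 v m := (hF₂.reg 9 rfl).trans h9
      have er0 : s₂.rreg 0 = s.rmem 0 v m := (hF₂.real 0 rfl).trans hr0
      have em1 : s₂.mem 1 = s.mem 1 := (hF₂.mem 1 rfl).trans (by rw [hmem₁, hm1])
      have em2 : s₂.mem 2 = s.mem 2 := (hF₂.mem 2 rfl).trans (by rw [hmem₁, hm2])
      have erm : s₂.rmem 0 = s.rmem 0 := (hF₂.rmem 0 rfl).trans (by rw [hrm₁, hrm])
      have e1 : s₂.reg 1 = 1 := (hF₂.reg 1 rfl).trans h1₁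
      refine wp_block (fun s₃ => s₃.reg 11 = s₂.reg 11 ∧ s₃.reg 1 = 1 ∧
        s₃.reg 12 = s.mem 1 (s.mem 2 v m) (s.mem 2 v k) ∧ s₃.rreg 1 = s.rmem 0 v k ∧
        s₃.rreg 0 = s.rmem 0 v m) (by simp [e1, e3, e9, er0, em1, em2, erm, hi₂]) ?_
      rintro s₃ ⟨f11, f1, f12, fr1, fr0⟩
      simp only [exists_lt_add_one hk1, wp_ite, skip, wp_instr, Test.Holds, f12, f1, fr1, fr0,
        State.setReg_reg, Instr.apply, List.length]
      refine ⟨fun hne => ⟨fun hle => ?_, fun hle => ?_⟩, fun hne => ?_⟩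
      · simp [hne, hle]
        omega
      · simp [hle, f11, ← hI2, hI1]
        omega
      · simp [hne, f11, ← hI2, hI1]
        omega
    · rintro s₂ t₂ ⟨⟨t₃, ⟨hI1, hI2, ht₃⟩, rfl⟩, hF₂⟩
      have e3 : s₂.reg 3 = v := (hF₂.reg 3 rfl).trans h3₁
      have e5 : s₂.reg 5 = m := (hF₂.reg 5 rfl).trans h5₁
      have em3 : s₂.mem 3 = s'.mem 3 := (hF₂.mem 3 rfl).trans (by rw [hmem₁])
      simp only [wp_instr, Instr.apply, State.setReg_mem, State.setMem_mem, e3, e5, true_and, em3]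
      rw [h8'] at hI2 ht₃
      refine ⟨fun i hi1 hi2 => ?_, ?_⟩
      · split_ifs with him
        · subst him
          exact ⟨hI1, hI2⟩
        · exact hI i hi1 (by omega)
      · simp only [List.length]
        nlinarith
  · rintro s' t ⟨⟨t₀, ⟨hI, ht⟩, rfl⟩, hF⟩
    exact ⟨hI, by omega⟩

/-- Sets register 13 if two positions on the same side are not adjacent. -/
def checkSides : Program :=
  forLoop 5 1 8 (forLoop 6 1 8 (block [.load 9 2 3 5, .load 10 2 3 6, .load 12 1 9 10,
    .load 21 3 3 5, .load 22 3 3 6]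
    (.ite (.eq 21 22) (.ite (.ne 12 1) (.instr (.const 13 1)) skip) skip)))

theorem wp_checkSides {n : ℕ} {I : Input n} {s : State} {v : ℕ} (h1 : s.reg 1 = 1)
    (h3 : s.reg 3 = v) (h8 : 1 ≤ s.reg 8) :
    wp I checkSides s fun s' t => (s'.reg 13 = 0 ↔ s.reg 13 = 0 ∧
      ∀ i j, 1 ≤ i → i < s.reg 8 → 1 ≤ j → j < s.reg 8 → s.mem 3 v i = s.mem 3 v j →
        s.mem 1 (s.mem 2 v i) (s.mem 2 v j) = 1) ∧
      t ≤ s.reg 8 * (10 * s.reg 8 + 4) + 2 := by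
  have hneg : ∀ k m : ℕ, (∀ i j, 1 ≤ i → i < k → 1 ≤ j → j < m → s.mem 3 v i = s.mem 3 v j →
        s.mem 1 (s.mem 2 v i) (s.mem 2 v j) = 1) ↔ ¬ ∃ i, 1 ≤ i ∧ i < k ∧ ∃ j, 1 ≤ j ∧ j < m ∧
        s.mem 3 v i = s.mem 3 v j ∧ s.mem 1 (s.mem 2 v i) (s.mem 2 v j) ≠ 1 := by
    intro k m
    constructor
    · rintro h ⟨i, hi, hi', j, hj, hj', h1, h2⟩
      exact h2 (h i j hi hi' hj hj' h1)
    · intro h i j hi hi' hj hj' h1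
      by_contra h2
      exact h ⟨i, hi, hi', j, hj, hj', h1, h2⟩
  refine (wp_forLoop (fun m s' t => (s'.reg 13 = 0 ↔ s.reg 13 = 0 ∧
      ¬ ∃ i, 1 ≤ i ∧ i < m ∧ ∃ j, 1 ≤ j ∧ j < s.reg 8 ∧
        s.mem 3 v i = s.mem 3 v j ∧ s.mem 1 (s.mem 2 v i) (s.mem 2 v j) ≠ 1) ∧
      t ≤ m * (10 * s.reg 8 + 4) + 1) h8 rfl rfl ?_ ?_).mono ?_
  · refine ⟨?_, by simp⟩
    simp
  · rintro m s' t hm hlt hi hb hF ⟨hI, ht⟩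
    have h3' : s'.reg 3 = v := (hF.reg 3 rfl).trans h3
    have h1' : s'.reg 1 = 1 := (hF.reg 1 rfl).trans h1
    have hmm : s'.mem 1 = s.mem 1 ∧ s'.mem 2 = s.mem 2 ∧ s'.mem 3 = s.mem 3 :=
      ⟨hF.mem 1 rfl, hF.mem 2 rfl, hF.mem 3 rfl⟩
    refine (wp_forLoop (fun k s₂ t₂ => (s₂.reg 13 = 0 ↔ s'.reg 13 = 0 ∧
      ¬ ∃ j, 1 ≤ j ∧ j < k ∧
        s.mem 3 v m = s.mem 3 v j ∧ s.mem 1 (s.mem 2 v m) (s.mem 2 v j) ≠ 1) ∧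
      t₂ ≤ k * 10) (by rwa [hb]) rfl rfl ?_ ?_).mono ?_
    · simp
    · rintro k s₂ t₂ hk1 hk2 hi₂ hb₂ hF₂ ⟨hI2, ht₂⟩
      have e3 : s₂.reg 3 = v := (hF₂.reg 3 rfl).trans h3'
      have e5 : s₂.reg 5 = m := (hF₂.reg 5 rfl).trans hi
      have e1 : s₂.reg 1 = 1 := (hF₂.reg 1 rfl).trans h1'
      have em1 : s₂.mem 1 = s.mem 1 := (hF₂.mem 1 rfl).trans hmm.1
      have em2 : s₂.mem 2 = s.mem 2 := (hF₂.mem 2 rfl).trans hmm.2.1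
      have em3 : s₂.mem 3 = s.mem 3 := (hF₂.mem 3 rfl).trans hmm.2.2
      refine wp_block (fun s₃ => s₃.reg 13 = s₂.reg 13 ∧ s₃.reg 1 = 1 ∧
        s₃.reg 12 = s.mem 1 (s.mem 2 v m) (s.mem 2 v k) ∧ s₃.reg 21 = s.mem 3 v m ∧
        s₃.reg 22 = s.mem 3 v k) (by simp [e1, e3, e5, em1, em2, em3, hi₂]) ?_
      rintro s₃ ⟨f13, f1, f12, f21, f22⟩
      simp only [exists_lt_add_one hk1, wp_ite, skip, wp_instr, Test.Holds, f12, f1, f21, f22,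
        State.setReg_reg, Instr.apply, List.length]
      refine ⟨fun hle => ⟨fun hne => ?_, fun hne => ?_⟩, fun hne => ?_⟩
      · simp [hne, hle]
        omega
      · have hne' := not_not.1 hne
        simp only [hne', ne_eq, not_true, and_false, or_false]
        refine ⟨by simpa [f13] using hI2, by omega⟩
      · simp only [hne, false_and, or_false]
        refine ⟨by simpa [f13] using hI2, by omega⟩
    · rintro s₂ t₂ ⟨⟨t₃, ⟨hI2, ht₃⟩, rfl⟩, hF₂⟩
      rw [hb] at hI2 ht₃
      refine ⟨?_, by nlinarith⟩
      simp only [exists_lt_add_one hm, State.setReg_reg]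
      simp only [Nat.reduceEqDiff, if_false]
      rw [hI2, hI, not_or, and_assoc]
  · rintro s' t ⟨⟨t₀, ⟨hI, ht⟩, rfl⟩, hF⟩
    refine ⟨?_, by omega⟩
    rw [hneg, hI]

/-! ### Bipartite matching by auction -/

/-- The state of the auction for the bipartite graph `W` on positions below `K`: `own b` is the
owner of `b` (`0` if there is none), `h b` is the price of `b`, and `sel x = 1` if the bidder `x`
has given up, having found only goods of the limit price `K`. The bidders up to `a` have entered,
and `cur` is the active bidder (`0` if there is none). By `slack`, an owner could save at most one
unit with another good that it wants. -/
structure Auction (K : ℕ) (W : ℕ → ℕ → Prop) (own h sel : ℕ → ℕ) (a cur : ℕ) : Prop where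
  own_adj : ∀ b, own b ≠ 0 → W (own b) b ∧ own b ≤ a ∧ own b < K
  own_inj : ∀ b b', own b ≠ 0 → own b = own b' → b = b'
  slack : ∀ b, own b ≠ 0 → ∀ b', W (own b) b' → h b ≤ h b' + 1
  price_zero : ∀ b, own b = 0 → h b = 0
  price_le : ∀ b, h b ≤ K
  gave_up : ∀ x, sel x = 1 → (∀ b, W x b → K ≤ h b) ∧ (∀ b, own b ≠ x) ∧ 1 ≤ x ∧ x ≤ a
  entered : ∀ x, 1 ≤ x → x ≤ a → x < K → sel x = 1 ∨ cur = x ∨ ∃ b, own b = x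
  active : cur ≠ 0 → cur < K ∧ cur ≤ a ∧ sel cur ≠ 1 ∧ ∀ b, own b ≠ cur

namespace Auction

variable {K : ℕ} {W : ℕ → ℕ → Prop} {own h sel : ℕ → ℕ} {a cur : ℕ}

theorem init {own h sel : ℕ → ℕ} (ho : ∀ b, own b = 0) (hh : ∀ b, h b = 0) (hs : ∀ b, sel b = 0) :
    Auction K W own h sel 0 0 where
  own_adj b hb := absurd (ho b) hb
  own_inj b _ hb := absurd (ho b) hb
  slack b hb := absurd (ho b) hb
  price_zero b _ := hh b
  price_le b := by simp [hh]
  gave_up x hx := by simp [hs] at hx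
  entered x h1 h2 := by omega
  active h := absurd rfl h

theorem enter (A : Auction K W own h sel a 0) (ha : a + 1 < K) :
    Auction K W own h sel (a + 1) (a + 1) where
  own_adj b hb := ⟨(A.own_adj b hb).1, (A.own_adj b hb).2.1.trans (Nat.le_succ a),
    (A.own_adj b hb).2.2⟩
  own_inj := A.own_inj
  slack := A.slack
  price_zero := A.price_zero
  price_le := A.price_le
  gave_up x hx := by
    obtain ⟨h1, h2, h3, h4⟩ := A.gave_up x hx
    exact ⟨h1, h2, h3, by omega⟩
  entered x h1 h2 h3 := by
    rcases Nat.lt_or_ge a x with h4 | h4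
    · exact Or.inr (Or.inl (by omega))
    · rcases A.entered x h1 h4 h3 with h5 | h5 | h5
      · exact Or.inl h5
      · omega
      · exact Or.inr (Or.inr h5)
  active _ := by
    refine ⟨ha, le_rfl, fun hs => ?_, fun b hb => ?_⟩
    · have := (A.gave_up _ hs).2.2.2
      omega
    · have := (A.own_adj b (by omega)).2.1
      omega

theorem finish (A : Auction K W own h sel a 0) (ha : K ≤ a + 1) :
    Auction K W own h sel (a + 1) 0 where
  own_adj b hb := ⟨(A.own_adj b hb).1, (A.own_adj b hb).2.1.trans (Nat.le_succ a),
    (A.own_adj b hb).2.2⟩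
  own_inj := A.own_inj
  slack := A.slack
  price_zero := A.price_zero
  price_le := A.price_le
  gave_up x hx := by
    obtain ⟨h1, h2, h3, h4⟩ := A.gave_up x hx
    exact ⟨h1, h2, h3, by omega⟩
  entered x h1 h2 h3 := A.entered x h1 (by omega) h3
  active h := absurd rfl h

theorem giveUp (A : Auction K W own h sel a cur) (hc : cur ≠ 0) (hW : ∀ b, W cur b → K ≤ h b) :
    Auction K W own h (Function.update sel cur 1) a 0 where
  own_adj := A.own_adj
  own_inj := A.own_inj
  slack := A.slack
  price_zero := A.price_zero
  price_le := A.price_le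
  gave_up x hx := by
    by_cases hxc : x = cur
    · subst hxc
      exact ⟨hW, (A.active hc).2.2.2, by omega, (A.active hc).2.1⟩
    · rw [Function.update_of_ne hxc] at hx
      exact A.gave_up x hx
  entered x h1 h2 h3 := by
    by_cases hxc : x = cur
    · simp [hxc]
    · rw [Function.update_of_ne hxc]
      rcases A.entered x h1 h2 h3 with h5 | h5 | h5
      · exact Or.inl h5
      · exact absurd h5.symm hxc
      · exact Or.inr (Or.inr h5)
  active h := absurd rfl h

/-- The active bidder buys a cheapest good `b`, raises its price by one and displaces the previous
owner, who becomes active. -/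
theorem bid (A : Auction K W own h sel a cur) (hc : cur ≠ 0) {b : ℕ} (hb : W cur b)
    (hmin : ∀ b', W cur b' → h b ≤ h b') (hK : h b < K) :
    Auction K W (Function.update own b cur) (Function.update h b (h b + 1)) sel a (own b) where
  own_adj b' hb' := by
    by_cases hbb : b' = b
    · subst hbb
      simpa using ⟨hb, (A.active hc).2.1, (A.active hc).1⟩
    · rw [Function.update_of_ne hbb] at hb' ⊢
      exact A.own_adj b' hb'
  own_inj b₁ b₂ h1 h2 := by
    have hcur := (A.active hc).2.2.2
    simp only [Function.update_apply] at h1 h2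
    split_ifs at h1 h2 with h3 h4 h4
    · rw [h3, h4]
    · exact absurd h2.symm (hcur b₂)
    · exact absurd h2 (hcur b₁)
    · exact A.own_inj b₁ b₂ h1 h2
  slack b₁ h1 b₂ h2 := by
    simp only [Function.update_apply] at h1 h2 ⊢
    split_ifs at h1 h2 ⊢ with h3 h4 h4
    · omega
    · have := hmin b₂ h2
      omega
    · subst h4
      have := A.slack b₁ h1 b₂ h2
      omega
    · exact A.slack b₁ h1 b₂ h2
  price_zero b₁ h1 := by
    simp only [Function.update_apply] at h1 ⊢
    split_ifs at h1 ⊢ with h3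
    · exact absurd h1 hc
    · exact A.price_zero b₁ h1
  price_le b₁ := by
    simp only [Function.update_apply]
    split_ifs
    · omega
    · exact A.price_le b₁
  gave_up x hx := by
    obtain ⟨h1, h2, h3⟩ := A.gave_up x hx
    refine ⟨fun b₁ hb₁ => ?_, fun b₁ => ?_, h3⟩
    · refine (h1 b₁ hb₁).trans ?_
      simp only [Function.update_apply]
      split_ifs with h4
      · rw [h4]
        omega
      · exact le_rfl
    · simp only [Function.update_apply]
      split_ifs
      · rintro rfl
        exact (A.active hc).2.2.1 hx
      · exact h2 b₁
  entered x h1 h2 h3 := by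
    rcases A.entered x h1 h2 h3 with h5 | h5 | ⟨b₁, h5⟩
    · exact Or.inl h5
    · exact Or.inr (Or.inr ⟨b, by simpa using h5⟩)
    · by_cases hbb : b₁ = b
      · exact Or.inr (Or.inl (hbb ▸ h5))
      · exact Or.inr (Or.inr ⟨b₁, by rwa [Function.update_of_ne hbb]⟩)
  active hob := by
    obtain ⟨-, h2, h1⟩ := A.own_adj b hob
    have hcur := (A.active hc).2.2.2
    refine ⟨h1, h2, fun hs => (A.gave_up _ hs).2.1 b rfl, fun b₁ => ?_⟩
    simp only [Function.update_apply]
    split_ifs with h3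
    · exact (hcur b).symm
    · intro h4
      exact h3 (A.own_inj b₁ b (h4 ▸ hob) h4)

/-- The positions selected with respect to a price level `lev` that no good has: the bidders that
have given up or own a good dearer than `lev`, and the goods cheaper than `lev`. -/
def Selected (right : ℕ → Prop) (own h sel : ℕ → ℕ) (lev x : ℕ) : Prop :=
  (¬ right x ∧ (sel x = 1 ∨ ∃ b, own b = x ∧ lev < h b)) ∨ (right x ∧ h x < lev)

/-- By `slack`, the owner of a good dearer than the level wants no good cheaper than the level, and
the goods that a bidder who has given up wants cost at least `K`. -/
theorem selected_indep {right : ℕ → Prop} (A : Auction K W own h sel a 0)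
    (hW : ∀ x b, W x b → ¬ right x ∧ right b) {lev : ℕ} (hlev : lev ≤ K) {x y : ℕ}
    (hx : Selected right own h sel lev x) (hy : Selected right own h sel lev y) : ¬ W x y := by
  intro hxy
  obtain ⟨h1, h2⟩ := hW x y hxy
  have hlt : h y < lev := by
    rcases hy with hy | hy
    · exact absurd h2 hy.1
    · exact hy.2
  rcases hx with ⟨-, hx | ⟨b, rfl, hbl⟩⟩ | hx
  · have := (A.gave_up x hx).1 y hxy
    omega
  · have hb : own b ≠ 0 := fun h0 => by
      have := A.price_zero b h0
      omega
    have := A.slack b hb y hxy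
    omega
  · exact h1 hx.1

/-- Each vertex outside the selection is matched to a selected vertex, so that the selection is a
maximum independent set. -/
theorem card_le_card_selected {right : ℕ → Prop} (A : Auction K W own h sel a 0)
    (hW : ∀ x b, W x b → ¬ right x ∧ right b) (hWK : ∀ x b, W x b → 1 ≤ x ∧ 1 ≤ b ∧ b < K)
    (ha : K ≤ a + 1) {lev : ℕ} (hfree : ∀ b, 1 ≤ b → b < K → h b ≠ lev) {S T : Finset ℕ}
    (hS : ∀ x, x ∈ S ↔ (1 ≤ x ∧ x < K) ∧ Selected right own h sel lev x)
    (hT : ∀ x ∈ T, 1 ≤ x ∧ x < K) (hind : ∀ x ∈ T, ∀ y ∈ T, ¬ W x y) : T.card ≤ S.card := by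
  have hex : ∀ x, ∃ y, x ∈ T \ S → y ∈ S \ T ∧
      ((right x ∧ ¬ right y ∧ y ≠ 0 ∧ own x = y) ∨ (¬ right x ∧ right y ∧ own y = x)) := by
    intro x
    by_cases hx : x ∈ T \ S
    · rw [Finset.mem_sdiff, hS] at hx
      obtain ⟨hxT, hxS⟩ := hx
      have hxK := hT x hxT
      have hns : ¬ Selected right own h sel lev x := fun hs => hxS ⟨hxK, hs⟩
      by_cases hr : right x
      · have hlt : lev < h x := by
          have h1 := hfree x hxK.1 hxK.2
          have h2 : ¬ h x < lev := fun h2 => hns (Or.inr ⟨hr, h2⟩)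
          omega
        have hox : own x ≠ 0 := fun h0 => by
          have := A.price_zero x h0
          omega
        obtain ⟨hadj, -, hoK⟩ := A.own_adj x hox
        refine ⟨own x, fun _ => ⟨?_, Or.inl ⟨hr, (hW _ _ hadj).1, hox, rfl⟩⟩⟩
        rw [Finset.mem_sdiff, hS]
        exact ⟨⟨⟨by omega, hoK⟩, Or.inl ⟨(hW _ _ hadj).1, Or.inr ⟨x, rfl, hlt⟩⟩⟩,
          fun hoT => hind _ hoT _ hxT hadj⟩
      · rcases A.entered x hxK.1 (by omega) hxK.2 with h5 | h5 | ⟨b, hb⟩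
        · exact absurd (Or.inl ⟨hr, Or.inl h5⟩) hns
        · omega
        · have hadj := (A.own_adj b (by omega)).1
          rw [hb] at hadj
          have hbK := (hWK _ _ hadj).2
          have hlt : h b < lev := by
            have h1 := hfree b hbK.1 hbK.2
            have h2 : ¬ lev < h b := fun h2 => hns (Or.inl ⟨hr, Or.inr ⟨b, hb, h2⟩⟩)
            omega
          refine ⟨b, fun _ => ⟨?_, Or.inr ⟨hr, (hW _ _ hadj).2, hb⟩⟩⟩
          rw [Finset.mem_sdiff, hS]
          exact ⟨⟨hbK, Or.inr ⟨(hW _ _ hadj).2, hlt⟩⟩, fun hbT => hind _ hxT _ hbT hadj⟩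
    · exact ⟨0, fun hx' => absurd hx' hx⟩
  choose f hf using hex
  have hcard : (T \ S).card ≤ (S \ T).card := by
    refine Finset.card_le_card_of_injOn f (fun x hx => (hf x hx).1) fun x hx y hy hxy => ?_
    obtain ⟨-, h1⟩ := hf x hx
    obtain ⟨-, h2⟩ := hf y hy
    rw [← hxy] at h2
    rcases h1 with ⟨-, h1, h0, h1'⟩ | ⟨-, h1, h1'⟩ <;> rcases h2 with ⟨-, h2, -, h2'⟩ | ⟨-, h2, h2'⟩
    · exact A.own_inj x y (h1' ▸ h0) (h1'.trans h2'.symm)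
    · exact absurd h2 h1
    · exact absurd h1 h2
    · exact h1'.symm.trans h2'
  rw [← Finset.card_sdiff_add_card_inter T S, ← Finset.card_sdiff_add_card_inter S T,
    Finset.inter_comm S T]
  omega

end Auction

/-- If `K - 1` numbers leave none of the levels `1, …, K - 1` free, then the level `K` is free. -/
theorem ne_of_forall_exists_eq {K : ℕ} {h : ℕ → ℕ}
    (hall : ∀ l, 1 ≤ l → l < K → ∃ b, 1 ≤ b ∧ b < K ∧ h b = l) (b : ℕ) (hb : 1 ≤ b) (hbK : b < K) :
    h b ≠ K := by
  intro hK
  have hsub : Finset.Icc 1 K ⊆ (Finset.Ico 1 K).image h := by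
    intro l hl
    rw [Finset.mem_Icc] at hl
    rw [Finset.mem_image]
    rcases Nat.lt_or_ge l K with hl' | hl'
    · obtain ⟨b', h1, h2, h3⟩ := hall l hl.1 hl'
      exact ⟨b', Finset.mem_Ico.2 ⟨h1, h2⟩, h3⟩
    · exact ⟨b, Finset.mem_Ico.2 ⟨hb, hbK⟩, by omega⟩
  have := (Finset.card_le_card hsub).trans Finset.card_image_le
  simp at this
  omega

/-- Looks for a cheapest good that the bidder in register 16 wants and that costs less than the
limit: its position is put into register 18 (`0` if there is none), its price into register 19. -/
def scanGoods : Program :=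
  forLoop 6 1 8 (block [.load 22 3 3 6]
    (.ite (.lt 21 22)
      (block [.load 10 2 3 6, .load 12 1 9 10]
        (.ite (.ne 12 1)
          (block [.load 20 5 3 6]
            (.ite (.lt 20 19) (block [.copy 19 20, .copy 18 6] skip) skip))
          skip))
      skip))

/-- One step of the auction: the active bidder buys a good or gives up. -/
def placeBid : Program :=
  block [.const 18 0, .copy 19 8, .load 9 2 3 16, .load 21 3 3 16]
    (.seq scanGoods
      (.ite (.eq 18 0)
        (block [.store 6 3 16 1, .copy 16 0] skip)
        (block [.load 20 4 3 18, .store 4 3 18 16, .succ 19, .store 5 3 18 19, .copy 16 20] skip)))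

/-- The auction for row `v` of the arrays, `v` being in register 3. -/
def auction : Program :=
  block [.const 17 0, .const 16 0]
    (.loop (.lt 17 8)
      (.ite (.eq 16 0)
        (.seq (.instr (.succ 17)) (.ite (.lt 17 8) (.instr (.copy 16 17)) skip))
        placeBid))

/-- The complement of the graph between the two sides of the list, as stored in row `v`. -/
def sideNonAdj (s : State) (v K x b : ℕ) : Prop :=
  (1 ≤ x ∧ x < K) ∧ (1 ≤ b ∧ b < K) ∧ s.mem 3 v x < s.mem 3 v b ∧
    s.mem 1 (s.mem 2 v x) (s.mem 2 v b) ≠ 1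

theorem wp_scanGoods {n : ℕ} {I : Input n} {s : State} {v : ℕ} (h1 : s.reg 1 = 1)
    (h3 : s.reg 3 = v) (h8 : 1 ≤ s.reg 8) (h9 : s.reg 9 = s.mem 2 v (s.reg 16))
    (h21 : s.reg 21 = s.mem 3 v (s.reg 16)) (h18 : s.reg 18 = 0) (h19 : s.reg 19 = s.reg 8)
    (h16 : 1 ≤ s.reg 16 ∧ s.reg 16 < s.reg 8) :
    wp I scanGoods s fun s' t =>
      (∀ b, sideNonAdj s v (s.reg 8) (s.reg 16) b → s'.reg 19 ≤ s.mem 5 v b) ∧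
      ((s'.reg 18 = 0 ∧ s'.reg 19 = s.reg 8) ∨
        (s'.reg 18 ≠ 0 ∧ sideNonAdj s v (s.reg 8) (s.reg 16) (s'.reg 18) ∧
          s'.reg 19 = s.mem 5 v (s'.reg 18) ∧ s'.reg 19 < s.reg 8)) ∧
      t ≤ 14 * s.reg 8 := by
  refine (wp_forLoop (fun m s' t => s'.reg 19 ≤ s.reg 8 ∧
      (∀ b, b < m → sideNonAdj s v (s.reg 8) (s.reg 16) b → s'.reg 19 ≤ s.mem 5 v b) ∧
      ((s'.reg 18 = 0 ∧ s'.reg 19 = s.reg 8) ∨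
        (s'.reg 18 ≠ 0 ∧ sideNonAdj s v (s.reg 8) (s.reg 16) (s'.reg 18) ∧
          s'.reg 19 = s.mem 5 v (s'.reg 18) ∧ s'.reg 19 < s.reg 8)) ∧
      t + 1 ≤ 14 * m) h8 rfl rfl ?_ ?_).mono ?_
  · refine ⟨by simp [h19], fun b hb hadj => ?_, Or.inl (by simp [h18, h19]), by omega⟩
    have := hadj.2.1.1
    omega
  · rintro m s' t hm hlt hi hb hF ⟨hle, hmin, hbest, ht⟩
    have e3 : s'.reg 3 = v := (hF.reg 3 rfl).trans h3
    have e9 := (hF.reg 9 rfl).trans h9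
    have e21 := (hF.reg 21 rfl).trans h21
    have e1 : s'.reg 1 = 1 := (hF.reg 1 rfl).trans h1
    have e16 := hF.reg 16 rfl
    have em1 : s'.mem 1 = s.mem 1 := hF.mem 1 rfl
    have em2 : s'.mem 2 = s.mem 2 := hF.mem 2 rfl
    have em3 : s'.mem 3 = s.mem 3 := hF.mem 3 rfl
    have em5 : s'.mem 5 = s.mem 5 := hF.mem 5 rfl
    have hext : ∀ c, (sideNonAdj s v (s.reg 8) (s.reg 16) m → c ≤ s.mem 5 v m) →
        c ≤ s'.reg 19 → ∀ b, b < m + 1 → sideNonAdj s v (s.reg 8) (s.reg 16) b →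
          c ≤ s.mem 5 v b := by
      intro c hc hc' b hb hadj
      rcases Nat.lt_succ_iff_lt_or_eq.1 hb with hb' | rfl
      · exact hc'.trans (hmin b hb' hadj)
      · exact hc hadj
    simp [e1, e3, e9, e21, em1, em2, em3, em5, hi, hle]
    refine ⟨fun h => ⟨fun h' => ⟨fun h'' => ?_, fun h'' => ?_⟩, fun h' => ?_⟩, fun h => ?_⟩
    · have hadj : sideNonAdj s v (s.reg 8) (s.reg 16) m := ⟨h16, ⟨hm, hlt⟩, h, h'⟩
      exact ⟨by omega, fun b hb => hext _ (fun _ => le_rfl) h''.le b (by omega),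
        Or.inr ⟨by omega, hadj, by omega⟩, by omega⟩
    · exact ⟨fun b hb => hext _ (fun _ => h'') le_rfl b (by omega), hbest, by omega⟩
    · exact ⟨fun b hb => hext _ (fun hadj => absurd h' hadj.2.2.2) le_rfl b (by omega), hbest,
        by omega⟩
    · exact ⟨fun b hb => hext _ (fun hadj => absurd hadj.2.2.1 (by omega)) le_rfl b (by omega),
        hbest, by omega⟩
  · rintro s' t ⟨⟨t₀, ⟨hle, hmin, hbest, ht⟩, rfl⟩, hF⟩
    exact ⟨fun b hb => hmin b hb.2.1.2 hb, hbest, by omega⟩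

/-- The auction after some steps, as stored in row `v`. -/
def State.Auction (s : State) (v : ℕ) : Prop :=
  HyperbolicClique.Auction (s.reg 8) (sideNonAdj s v (s.reg 8)) (s.mem 4 v) (s.mem 5 v) (s.mem 6 v)
    (s.reg 17) (s.reg 16)

/-- A measure that decreases with each step of the auction, as the prices are bounded. -/
def State.auctionMeasure (s : State) (v : ℕ) : ℕ :=
  2 * (s.reg 8 - s.reg 17) + (if s.reg 16 = 0 then 0 else 1) +
    (s.reg 8 * s.reg 8 - ∑ b ∈ Finset.Ico 1 (s.reg 8), s.mem 5 v b)

theorem sideNonAdj_congr {s s' : State} (h1 : s'.mem 1 = s.mem 1) (h2 : s'.mem 2 = s.mem 2)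
    (h3 : s'.mem 3 = s.mem 3) : sideNonAdj s' = sideNonAdj s := by
  funext v K x b
  simp [sideNonAdj, h1, h2, h3]

@[simp] theorem sideNonAdj_setReg (s : State) (x k : ℕ) :
    sideNonAdj (s.setReg x k) = sideNonAdj s := rfl

theorem State.Auction.sum_le {s : State} {v : ℕ} (A : s.Auction v) :
    ∑ b ∈ Finset.Ico 1 (s.reg 8), s.mem 5 v b ≤ s.reg 8 * s.reg 8 := by
  refine (Finset.sum_le_card_nsmul _ _ (s.reg 8) fun b _ => A.price_le b).trans ?_
  simp only [Nat.card_Ico, smul_eq_mul]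
  exact Nat.mul_le_mul_right _ (Nat.sub_le _ _)

theorem wp_placeBid {n : ℕ} {I : Input n} {s : State} {v : ℕ} (h0 : s.reg 0 = 0) (h1 : s.reg 1 = 1)
    (h3 : s.reg 3 = v) (h8 : 1 ≤ s.reg 8) (h16 : s.reg 16 ≠ 0) (A : s.Auction v) :
    wp I placeBid s fun s' t => s'.Auction v ∧ s'.auctionMeasure v < s.auctionMeasure v ∧
      t ≤ 14 * s.reg 8 + 12 := by
  refine wp_block (fun s₁ => (∀ r, r ≠ 18 → r ≠ 19 → r ≠ 9 → r ≠ 21 → s₁.reg r = s.reg r) ∧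
    s₁.mem = s.mem ∧ s₁.reg 18 = 0 ∧ s₁.reg 19 = s.reg 8 ∧ s₁.reg 9 = s.mem 2 v (s.reg 16) ∧
    s₁.reg 21 = s.mem 3 v (s.reg 16)) ?_ ?_
  · simp +contextual [h3]
  rintro s₁ ⟨hr, hm, h18, h19, h9, h21⟩
  have hcur := A.active h16
  have hW : sideNonAdj s₁ = sideNonAdj s := sideNonAdj_congr (by rw [hm]) (by rw [hm]) (by rw [hm])
  have e8 : s₁.reg 8 = s.reg 8 := hr 8 (by simp) (by simp) (by simp) (by simp)
  have e16 : s₁.reg 16 = s.reg 16 := hr 16 (by simp) (by simp) (by simp) (by simp)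
  rw [wp_seq]
  refine (wp_scanGoods (v := v) (by simp [hr, h1]) (by simp [hr, h3]) (e8 ▸ h8) (by rw [h9, e16, hm])
    (by rw [h21, e16, hm]) h18 (h19.trans e8.symm) ?_).frame.mono ?_
  · rw [e16, e8]
    exact ⟨by omega, hcur.1⟩
  rintro s₂ t ⟨⟨hmin, hbest, ht⟩, hF⟩
  rw [hW, e8, e16, hm] at hmin hbest
  have f0 : s₂.reg 0 = 0 := (hF.reg 0 rfl).trans (by simp [hr, h0])
  have f1 : s₂.reg 1 = 1 := (hF.reg 1 rfl).trans (by simp [hr, h1])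
  have f3 : s₂.reg 3 = v := (hF.reg 3 rfl).trans (by simp [hr, h3])
  have f8 : s₂.reg 8 = s.reg 8 := (hF.reg 8 rfl).trans e8
  have f16 : s₂.reg 16 = s.reg 16 := (hF.reg 16 rfl).trans e16
  have f17 : s₂.reg 17 = s.reg 17 := (hF.reg 17 rfl).trans (by simp [hr])
  have fm : ∀ a, s₂.mem a = s.mem a := fun a => (hF.mem a (by rfl)).trans (by rw [hm])
  have hpre : 0 < s.reg 16 := by omega
  simp only [block, skip, wp_ite, wp_seq, wp_instr, Test.Holds, Instr.apply, f0]
  constructor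
  · intro h
    have hlim : ∀ b, sideNonAdj s v (s.reg 8) (s.reg 16) b → s.reg 8 ≤ s.mem 5 v b := by
      rcases hbest with ⟨-, hb⟩ | ⟨hb, -⟩
      · rwa [hb] at hmin
      · exact absurd h hb
    refine ⟨?_, ?_, ?_⟩
    · rw [State.Auction, sideNonAdj_congr (s := s)]
      · convert A.giveUp h16 hlim using 1
        · simp [f8]
        · simp [f8]
        · ext x
          simp [fm]
        · ext x
          simp [fm]
        · ext x
          simp [fm, f3, f1, f16, Function.update_apply]
        · simp [f17]
        · simp [f0]
      all_goals
        ext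
        simp [fm]
    · simp [State.auctionMeasure, f8, f17, f0, fm, h16]
    · simp only [List.length]
      omega
  · intro h
    obtain ⟨hne, hadj, heq, hlt⟩ : _ := hbest.resolve_left fun h' => h h'.1
    have hb := hadj.2.1
    have hA := A.bid h16 hadj (heq ▸ hmin) (heq ▸ hlt)
    have hA' : State.Auction ((((((s₂.setReg 20 (s.mem 4 v (s₂.reg 18))).setMem 4 v (s₂.reg 18)
        (s.reg 16)).setReg 19 (s₂.reg 19 + 1)).setMem 5 v (s₂.reg 18) (s₂.reg 19 + 1)).setReg 16
        (s.mem 4 v (s₂.reg 18)))) v := by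
      rw [State.Auction, sideNonAdj_congr (s := s)]
      · convert hA using 1
        · simp [f8]
        · simp [f8]
        · ext x
          simp [fm, Function.update_apply]
        · ext x
          simp [fm, Function.update_apply, heq]
        · ext x
          simp [fm]
        · simp [f17]
        · simp
      all_goals
        ext
        simp [fm]
    simp [f3, fm, f16]
    refine ⟨hA', ?_, by omega⟩
    have hsum := hA'.sum_le
    have hupd : ∀ b, (if b = s₂.reg 18 then s.mem 5 v (s₂.reg 18) + 1 else s.mem 5 v b) =
        s.mem 5 v b + if b = s₂.reg 18 then 1 else 0 := by
      intro b
      split_ifs with hbb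
      · rw [hbb]
      · rfl
    simp only [State.setReg_reg, State.setMem_reg, State.setReg_mem, State.setMem_mem, true_and, f8,
      f17, fm, heq, Nat.reduceEqDiff, if_false, false_and, hupd, Finset.sum_add_distrib,
      Finset.sum_ite_eq', Finset.mem_Ico, hb.1, hb.2, and_self, if_true,
      State.auctionMeasure] at hsum ⊢
    rw [if_neg h16]
    split_ifs <;> omega

theorem wp_auction {n : ℕ} {I : Input n} {s : State} {v : ℕ} (h0 : s.reg 0 = 0) (h1 : s.reg 1 = 1)
    (h3 : s.reg 3 = v) (h8 : 1 ≤ s.reg 8) (h4 : ∀ j, s.mem 4 v j = 0) (h5 : ∀ j, s.mem 5 v j = 0)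
    (h6 : ∀ j, s.mem 6 v j = 0) :
    wp I auction s fun s' t => (∃ a, s.reg 8 ≤ a + 1 ∧
      Auction (s.reg 8) (sideNonAdj s v (s.reg 8)) (s'.mem 4 v) (s'.mem 5 v) (s'.mem 6 v) a 0) ∧
      t ≤ (14 * s.reg 8 + 20) * (s.reg 8 * s.reg 8 + 2 * s.reg 8) + 3 := by
  refine wp_block (fun s₁ => Frame auction s s₁ ∧ s₁.reg 16 = 0 ∧ s₁.reg 17 = 0 ∧
    s₁.mem = s.mem) ⟨Frame.block I _ _ s, by simp, by simp, by simp⟩ ?_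
  rintro s₁ ⟨hF₁, h16, h17, hm⟩
  have e8 : s₁.reg 8 = s.reg 8 := hF₁.reg 8 rfl
  refine (wp_loop (fun s' t => Frame auction s s' ∧ s'.Auction v ∧
    (s.reg 8 ≤ s'.reg 17 → s'.reg 16 = 0) ∧
    t + (14 * s.reg 8 + 20) * s'.auctionMeasure v ≤
      (14 * s.reg 8 + 20) * (s.reg 8 * s.reg 8 + 2 * s.reg 8)) (fun s' => s'.auctionMeasure v)
      ?_ ?_).mono ?_
  · refine ⟨hF₁, ?_, fun _ => h16, ?_⟩
    · rw [State.Auction, h16, h17]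
      exact .init (by simp [hm, h4]) (by simp [hm, h5]) (by simp [hm, h6])
    · rw [zero_add, State.auctionMeasure, h16, h17, e8]
      refine Nat.mul_le_mul_left _ ?_
      simp
      omega
  · rintro s' t ⟨hF, A, -, ht⟩ hlt
    have f0 : s'.reg 0 = 0 := (hF.reg 0 rfl).trans h0
    have f1 : s'.reg 1 = 1 := (hF.reg 1 rfl).trans h1
    have f3 : s'.reg 3 = v := (hF.reg 3 rfl).trans h3
    have f8 : s'.reg 8 = s.reg 8 := hF.reg 8 rfl
    simp only [Test.Holds, f8] at hlt
    -- A step that decreases the measure pays for itself.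
    have hpay : ∀ {μ t'}, μ < s'.auctionMeasure v → t' ≤ 14 * s.reg 8 + 14 →
        t + t' + 1 + (14 * s.reg 8 + 20) * μ ≤
          (14 * s.reg 8 + 20) * (s.reg 8 * s.reg 8 + 2 * s.reg 8) := by
      intro μ t' hμ ht'
      have := Nat.mul_le_mul_left (14 * s.reg 8 + 20) hμ
      rw [Nat.mul_succ] at this
      omega
    suffices H : wp I (.ite (.eq 16 0) (.seq (.instr (.succ 17))
        (.ite (.lt 17 8) (.instr (.copy 16 17)) skip)) placeBid) s' fun s'' t' =>
        s''.Auction v ∧ (s.reg 8 ≤ s''.reg 17 → s''.reg 16 = 0) ∧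
          s''.auctionMeasure v < s'.auctionMeasure v ∧ t' ≤ 14 * s.reg 8 + 14 by
      refine H.frame.mono ?_
      rintro s'' t' ⟨⟨A', hend, hμ, ht'⟩, hF'⟩
      exact ⟨⟨hF.trans (hF'.of_part fun f hf => by simp_all [auction, Program.all]), A', hend,
        hpay hμ ht'⟩, hμ⟩
    rw [wp_ite]
    refine ⟨fun h16 => ?_, fun h16 => ?_⟩
    · simp only [Test.Holds, f0] at h16
      rw [State.Auction, h16, f8] at A
      simp only [skip, wp_ite, wp_seq, wp_instr, Test.Holds, Instr.apply]
      refine ⟨fun h => ?_, fun h => ?_⟩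
      · simp only [State.setReg_reg, if_true, f8, Nat.reduceEqDiff, if_false] at h
        refine ⟨?_, ?_, ?_, by omega⟩
        · simpa [State.Auction, f8] using A.enter h
        · simp
          omega
        · simp [State.auctionMeasure, f8, h16]
          omega
      · simp only [State.setReg_reg, if_true, f8, Nat.reduceEqDiff, if_false] at h
        refine ⟨?_, ?_, ?_, by omega⟩
        · simpa [State.Auction, f8, h16] using A.finish (not_lt.1 h)
        · simp [h16]
        · simp [State.auctionMeasure, f8, h16]
          omega
    · simp only [Test.Holds, f0] at h16
      refine (wp_placeBid f0 f1 f3 (f8.symm ▸ h8) h16 A).frame.mono ?_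
      rintro s'' t' ⟨⟨A', hμ, ht'⟩, hF'⟩
      refine ⟨A', fun h => ?_, hμ, by omega⟩
      rw [hF'.reg 17 rfl] at h
      omega
  · rintro s' t ⟨t₀, ⟨hF, A, hend, ht⟩, hlt, rfl⟩
    have f8 : s'.reg 8 = s.reg 8 := hF.reg 8 rfl
    simp only [Test.Holds, f8, not_lt] at hlt
    rw [State.Auction, f8, hend hlt, sideNonAdj_congr (hF.mem 1 rfl) (hF.mem 2 rfl) (hF.mem 3 rfl)]
      at A
    refine ⟨⟨_, by omega, A⟩, ?_⟩
    simp only [List.length]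
    have : 0 ≤ (14 * s.reg 8 + 20) * s'.auctionMeasure v := Nat.zero_le _
    omega

/-! ### Reading off a maximum clique -/

/-- Puts a price that no good has into register 23. -/
def findLevel : Program :=
  block [.copy 23 8]
    (forLoop 5 1 8 (block [.const 11 0]
      (.seq
        (forLoop 6 1 8 (block [.load 20 5 3 6] (.ite (.eq 20 5) (.instr (.const 11 1)) skip)))
        (.ite (.eq 11 0) (.instr (.copy 23 5)) skip))))

theorem wp_findLevel {n : ℕ} {I : Input n} {s : State} {v : ℕ} (h0 : s.reg 0 = 0)
    (h3 : s.reg 3 = v) (h8 : 1 ≤ s.reg 8) :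
    wp I findLevel s fun s' t => (s'.reg 23 ≤ s.reg 8 ∧
      ∀ b, 1 ≤ b → b < s.reg 8 → s.mem 5 v b ≠ s'.reg 23) ∧ t ≤ s.reg 8 * (6 * s.reg 8 + 8) + 3 := by
  refine wp_block (fun s₁ => s₁.reg 0 = 0 ∧ s₁.reg 3 = v ∧ s₁.reg 8 = s.reg 8 ∧
    s₁.reg 23 = s.reg 8 ∧ s₁.mem = s.mem) (by simp [h3, h0]) ?_
  rintro s₁ ⟨h0, h3, e8, h23, hm⟩
  refine (wp_forLoop (fun m s' t =>
      ((s'.reg 23 ≤ s.reg 8 ∧ ∀ b, 1 ≤ b → b < s.reg 8 → s.mem 5 v b ≠ s'.reg 23) ∨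
        (s'.reg 23 = s.reg 8 ∧ ∀ l, 1 ≤ l → l < m → ∃ b, 1 ≤ b ∧ b < s.reg 8 ∧ s.mem 5 v b = l)) ∧
      t ≤ m * (6 * s.reg 8 + 8) + 1) (by rwa [e8]) rfl rfl ?_ ?_).mono ?_
  · refine ⟨Or.inr ⟨by simp [h23], fun l h1 h2 => ?_⟩, by simp⟩
    omega
  · rintro m s' t hm1 hlt hi hb hF ⟨hI, ht⟩
    refine wp_block (fun s₂ => s₂.reg 0 = 0 ∧ s₂.reg 3 = v ∧ s₂.reg 8 = s.reg 8 ∧ s₂.reg 5 = m ∧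
      s₂.reg 23 = s'.reg 23 ∧ s₂.reg 11 = 0 ∧ s₂.mem 5 = s.mem 5) ?_ ?_
    · simp [hF.reg 0 rfl, hF.reg 3 rfl, hb, h0, h3, e8, hi, hF.mem 5 rfl, hm]
    rintro s₂ ⟨f0, f3, f8, f5, f23, f11, fm⟩
    rw [wp_seq]
    refine (wp_forLoop (fun k s₃ t₃ => (s₃.reg 11 = 0 ↔ ¬ ∃ b, 1 ≤ b ∧ b < k ∧ s.mem 5 v b = m) ∧
      t₃ ≤ k * 6) (by rwa [f8]) rfl rfl ?_ ?_).mono ?_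
    · simp [f11]
    · rintro k s₃ t₃ hk1 hk2 hi₃ hb₃ hF₃ ⟨hI₃, ht₃⟩
      have g3 : s₃.reg 3 = v := (hF₃.reg 3 rfl).trans f3
      have g5 : s₃.reg 5 = m := (hF₃.reg 5 rfl).trans f5
      have gm : s₃.mem 5 = s.mem 5 := (hF₃.mem 5 rfl).trans fm
      simp only [block, skip, wp_ite, wp_seq, wp_instr, Test.Holds, Instr.apply, g3, gm, hi₃,
        State.setReg_reg, if_true, g5, Nat.reduceEqDiff, if_false, exists_lt_add_one hk1]
      refine ⟨fun h => ⟨?_, by omega⟩, fun h => ⟨?_, by omega⟩⟩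
      · simp [h]
      · simpa [h] using hI₃
    · rintro s₃ t₃ ⟨⟨t₄, ⟨hI₃, ht₄⟩, rfl⟩, hF₃⟩
      have g0 : s₃.reg 0 = 0 := (hF₃.reg 0 rfl).trans f0
      have g5 : s₃.reg 5 = m := (hF₃.reg 5 rfl).trans f5
      have g23 : s₃.reg 23 = s'.reg 23 := (hF₃.reg 23 rfl).trans f23
      rw [f8] at hI₃ ht₄
      rw [e8] at hlt
      simp only [skip, wp_ite, wp_instr, Test.Holds, Instr.apply, g0, g5, hI₃, State.setReg_reg,
        if_true, Nat.reduceEqDiff, if_false, g23, List.length]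
      refine ⟨fun h => ⟨Or.inl ⟨hlt.le, fun b hb1 hb2 hbm => h ⟨b, hb1, hb2, hbm⟩⟩, by linarith⟩,
        fun h => ⟨hI.imp_right fun hI => ⟨hI.1, fun l hl1 hl2 => ?_⟩, by linarith⟩⟩
      rcases Nat.lt_succ_iff_lt_or_eq.1 hl2 with hl3 | rfl
      · exact hI.2 l hl1 hl3
      · exact not_not.1 h
  · rintro s' t ⟨⟨t₀, ⟨hI, ht⟩, rfl⟩, hF⟩
    rw [e8] at hI ht
    refine ⟨?_, by simp only [List.length]; omega⟩
    rcases hI with hI | ⟨h23', hall⟩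
    · exact hI
    · rw [h23']
      exact ⟨le_rfl, ne_of_forall_exists_eq hall⟩

/-- Selects the owners of all goods that are dearer than the level. -/
def markOwners : Program :=
  forLoop 6 1 8 (block [.load 20 5 3 6]
    (.ite (.lt 23 20) (block [.load 20 4 3 6, .store 6 3 20 1] skip) skip))

theorem wp_markOwners {n : ℕ} {I : Input n} {s : State} {v : ℕ} (h1 : s.reg 1 = 1)
    (h3 : s.reg 3 = v) (h8 : 1 ≤ s.reg 8) :
    wp I markOwners s fun s' t => (∀ x, s'.mem 6 v x = 1 ↔ s.mem 6 v x = 1 ∨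
      ∃ b, 1 ≤ b ∧ b < s.reg 8 ∧ s.mem 4 v b = x ∧ s.reg 23 < s.mem 5 v b) ∧
      t ≤ s.reg 8 * 8 + 2 := by
  refine (wp_forLoop (fun m s' t => (∀ x, s'.mem 6 v x = 1 ↔ s.mem 6 v x = 1 ∨
      ∃ b, 1 ≤ b ∧ b < m ∧ s.mem 4 v b = x ∧ s.reg 23 < s.mem 5 v b) ∧
      t ≤ m * 8 + 1) h8 rfl rfl ?_ ?_).mono ?_
  · refine ⟨fun x => ?_, by simp⟩
    simp only [State.setReg_mem, iff_self_or]
    rintro ⟨b, hb1, hb2, -⟩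
    omega
  · rintro m s' t hm1 hlt hi hb hF ⟨hI, ht⟩
    have f1 : s'.reg 1 = 1 := (hF.reg 1 rfl).trans h1
    have f3 : s'.reg 3 = v := (hF.reg 3 rfl).trans h3
    have f23 : s'.reg 23 = s.reg 23 := hF.reg 23 rfl
    have f4 : s'.mem 4 = s.mem 4 := hF.mem 4 rfl
    have f5 : s'.mem 5 = s.mem 5 := hF.mem 5 rfl
    simp only [block, skip, wp_ite, wp_seq, wp_instr, Test.Holds, Instr.apply, f3, f4, f5, hi, f1,
      f23, State.setReg_reg, if_true, Nat.reduceEqDiff, if_false, exists_lt_add_one hm1,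
      State.setReg_mem, State.setMem_mem, true_and]
    refine ⟨fun h => ⟨fun x => ?_, by omega⟩, fun h => ⟨fun x => ?_, by omega⟩⟩
    · split_ifs with hx
      · simp [hx, h]
      · rw [hI]
        have hx' : s.mem 4 v m ≠ x := fun h' => hx h'.symm
        simp [hx']
    · rw [hI]
      simp [h]
  · rintro s' t ⟨⟨t₀, ⟨hI, ht⟩, rfl⟩, hF⟩
    exact ⟨hI, by omega⟩

/-- Marks the selected vertices in row `v` of array 7 and counts them in register 25. -/
def collectSelected : Program :=
  block [.const 25 0]
    (forLoop 6 1 8 (block [.load 21 3 3 6]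
      (.seq
        (.ite (.eq 21 0) (.instr (.load 11 6 3 6))
          (block [.load 20 5 3 6] (.ite (.lt 20 23) (.instr (.const 11 1)) (.instr (.const 11 0)))))
        (.ite (.eq 11 1) (block [.load 9 2 3 6, .succ 25, .store 7 3 9 1] skip) skip))))

open scoped Classical in
theorem wp_collectSelected {n : ℕ} {I : Input n} {s : State} {v : ℕ} (h0 : s.reg 0 = 0)
    (h1 : s.reg 1 = 1) (h3 : s.reg 3 = v) (h8 : 1 ≤ s.reg 8) (h7 : ∀ j, s.mem 7 v j = 0)
    {P : ℕ → Prop} (hP : ∀ x, P x ↔ (s.mem 3 v x = 0 ∧ s.mem 6 v x = 1) ∨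
      (s.mem 3 v x ≠ 0 ∧ s.mem 5 v x < s.reg 23)) :
    wp I collectSelected s fun s' t =>
      (∀ w, s'.mem 7 v w = 1 ↔ ∃ j, 1 ≤ j ∧ j < s.reg 8 ∧ P j ∧ s.mem 2 v j = w) ∧
      s'.reg 25 = ((Finset.Ico 1 (s.reg 8)).filter P).card ∧ t ≤ s.reg 8 * 14 + 3 := by
  refine wp_block (fun s₁ => s₁.reg 0 = 0 ∧ s₁.reg 1 = 1 ∧ s₁.reg 3 = v ∧ s₁.reg 8 = s.reg 8 ∧
    s₁.reg 25 = 0 ∧ s₁.reg 23 = s.reg 23 ∧ s₁.mem = s.mem) (by simp [h3, h0, h1]) ?_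
  rintro s₁ ⟨h0, h1, h3, e8, h25, e23, hm⟩
  refine (wp_forLoop (fun m s' t =>
      (∀ w, s'.mem 7 v w = 1 ↔ ∃ j, 1 ≤ j ∧ j < m ∧ P j ∧ s.mem 2 v j = w) ∧
      s'.reg 25 = ((Finset.Ico 1 m).filter P).card ∧ t ≤ m * 14 + 1)
      (by rwa [e8]) rfl rfl ?_ ?_).mono ?_
  · refine ⟨fun w => ?_, by simp [h25], by simp⟩
    simp only [State.setReg_mem, hm, h7]
    refine ⟨fun h => by simp at h, ?_⟩
    rintro ⟨j, hj1, hj2, -⟩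
    omega
  · rintro m s' t hm1 hlt hi hb hF ⟨hI, hcard, ht⟩
    have f0 : s'.reg 0 = 0 := (hF.reg 0 rfl).trans h0
    have f1 : s'.reg 1 = 1 := (hF.reg 1 rfl).trans h1
    have f3 : s'.reg 3 = v := (hF.reg 3 rfl).trans h3
    have f23 : s'.reg 23 = s.reg 23 := (hF.reg 23 rfl).trans e23
    have fm2 : s'.mem 2 = s.mem 2 := (hF.mem 2 rfl).trans (by rw [hm])
    have fm3 : s'.mem 3 = s.mem 3 := (hF.mem 3 rfl).trans (by rw [hm])
    have fm5 : s'.mem 5 = s.mem 5 := (hF.mem 5 rfl).trans (by rw [hm])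
    have fm6 : s'.mem 6 = s.mem 6 := (hF.mem 6 rfl).trans (by rw [hm])
    rw [block, block, wp_seq, wp_instr, wp_seq]
    suffices H : wp I (.ite (.eq 21 0) (.instr (.load 11 6 3 6))
        (block [.load 20 5 3 6] (.ite (.lt 20 23) (.instr (.const 11 1)) (.instr (.const 11 0)))))
        ((Instr.load 21 3 3 6).apply I s') fun s₂ t₂ => (s₂.reg 11 = 1 ↔ P m) ∧ t₂ ≤ 4 by
      refine H.frame.mono ?_
      rintro s₂ t₂ ⟨⟨hP₂, ht₂⟩, hF₂⟩
      have g1 : s₂.reg 1 = 1 := (hF₂.reg 1 rfl).trans (by simp [f1])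
      have g3 : s₂.reg 3 = v := (hF₂.reg 3 rfl).trans (by simp [f3])
      have g6 : s₂.reg 6 = m := (hF₂.reg 6 rfl).trans (by simp [hi])
      have g25 : s₂.reg 25 = s'.reg 25 := (hF₂.reg 25 rfl).trans (by simp)
      have gm2 : s₂.mem 2 = s.mem 2 := (hF₂.mem 2 rfl).trans (by simp [fm2])
      have gm7 : s₂.mem 7 = s'.mem 7 := (hF₂.mem 7 rfl).trans (by simp)
      have hIco : Finset.Ico 1 (m + 1) = insert m (Finset.Ico 1 m) :=
        (Finset.insert_Ico_right_eq_Ico_add_one hm1).symm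
      simp only [block, skip, wp_ite, wp_seq, wp_instr, Test.Holds, Instr.apply, g1, g3, g6, hP₂,
        g25, gm2, gm7, State.setReg_reg, if_true, Nat.reduceEqDiff, if_false, exists_lt_add_one hm1,
        State.setReg_mem, State.setMem_mem, true_and, hIco, Finset.filter_insert, State.setMem_reg]
      refine ⟨fun h => ⟨fun w => ?_, ?_, by omega⟩, fun h => ⟨fun w => ?_, ?_, by omega⟩⟩
      · split_ifs with hw
        · simp [hw, h]
        · have hw' : s.mem 2 v m ≠ w := fun h' => hw h'.symm
          rw [hI]
          simp [hw']
      · rw [if_pos h, Finset.card_insert_of_notMem (by simp), hcard]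
      · rw [hI]
        simp [h]
      · rw [if_neg h, hcard]
    rw [hP]
    simp only [block, wp_ite, wp_seq, wp_instr, Test.Holds, Instr.apply, State.setReg_reg, f0, f3,
      f23, State.setReg_mem, fm3, fm5, fm6, hi, if_true, Nat.reduceEqDiff, if_false]
    refine ⟨fun h => ⟨by simp [h], by omega⟩, fun h => ⟨fun h' => ⟨by simp [h, h'], by omega⟩,
      fun h' => ⟨by simp [h, h'], by omega⟩⟩⟩
  · rintro s' t ⟨⟨t₀, ⟨hI, hcard, ht⟩, rfl⟩, hF⟩
    rw [e8] at hI hcard ht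
    exact ⟨hI, hcard, by simp only [List.length]; omega⟩

/-- Computes a maximum independent set of the bipartite graph `sideNonAdj`. -/
def selectMaximum : Program :=
  .seq auction (.seq findLevel (.seq markOwners collectSelected))

theorem wp_selectMaximum {n : ℕ} {I : Input n} {s : State} {v : ℕ} (h0 : s.reg 0 = 0)
    (h1 : s.reg 1 = 1) (h3 : s.reg 3 = v) (h8 : 1 ≤ s.reg 8) (h4 : ∀ j, s.mem 4 v j = 0)
    (h5 : ∀ j, s.mem 5 v j = 0) (h6 : ∀ j, s.mem 6 v j = 0) (h7 : ∀ j, s.mem 7 v j = 0)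
    (hside : ∀ i, 1 ≤ i → i < s.reg 8 → s.mem 3 v i = 0 ∨ s.mem 3 v i = 1) :
    wp I selectMaximum s fun s' t => (∃ S : Finset ℕ, (∀ x ∈ S, 1 ≤ x ∧ x < s.reg 8) ∧
      (∀ w, s'.mem 7 v w = 1 ↔ ∃ x ∈ S, s.mem 2 v x = w) ∧ s'.reg 25 = S.card ∧
      (∀ x ∈ S, ∀ y ∈ S, ¬ sideNonAdj s v (s.reg 8) x y) ∧
      ∀ T : Finset ℕ, (∀ x ∈ T, 1 ≤ x ∧ x < s.reg 8) →
        (∀ x ∈ T, ∀ y ∈ T, ¬ sideNonAdj s v (s.reg 8) x y) → T.card ≤ S.card) ∧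
      t ≤ (14 * s.reg 8 + 20) * (s.reg 8 * s.reg 8 + 2 * s.reg 8) +
        s.reg 8 * (6 * s.reg 8 + 30) + 11 := by
  classical
  rw [selectMaximum, wp_seq]
  refine (wp_auction h0 h1 h3 h8 h4 h5 h6).frame.mono ?_
  rintro s₁ t₁ ⟨⟨⟨a, ha, A⟩, ht₁⟩, hF₁⟩
  have e0 : s₁.reg 0 = 0 := (hF₁.reg 0 rfl).trans h0
  have e1 : s₁.reg 1 = 1 := (hF₁.reg 1 rfl).trans h1
  have e3 : s₁.reg 3 = v := (hF₁.reg 3 rfl).trans h3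
  have e8 : s₁.reg 8 = s.reg 8 := hF₁.reg 8 rfl
  rw [wp_seq]
  refine (wp_findLevel e0 e3 (e8.symm ▸ h8)).frame.mono ?_
  rintro s₂ t₂ ⟨⟨⟨hlev, hfree⟩, ht₂⟩, hF₂⟩
  have f0 : s₂.reg 0 = 0 := (hF₂.reg 0 rfl).trans e0
  have f1 : s₂.reg 1 = 1 := (hF₂.reg 1 rfl).trans e1
  have f3 : s₂.reg 3 = v := (hF₂.reg 3 rfl).trans e3
  have f8 : s₂.reg 8 = s.reg 8 := (hF₂.reg 8 rfl).trans e8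
  rw [wp_seq]
  refine (wp_markOwners f1 f3 (f8.symm ▸ h8)).frame.mono ?_
  rintro s₃ t₃ ⟨⟨hmark, ht₃⟩, hF₃⟩
  have g0 : s₃.reg 0 = 0 := (hF₃.reg 0 rfl).trans f0
  have g1 : s₃.reg 1 = 1 := (hF₃.reg 1 rfl).trans f1
  have g3 : s₃.reg 3 = v := (hF₃.reg 3 rfl).trans f3
  have g8 : s₃.reg 8 = s.reg 8 := (hF₃.reg 8 rfl).trans f8
  have m2 : s₃.mem 2 = s.mem 2 := by rw [hF₃.mem 2 rfl, hF₂.mem 2 rfl, hF₁.mem 2 rfl]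
  have m3 : s₃.mem 3 = s.mem 3 := by rw [hF₃.mem 3 rfl, hF₂.mem 3 rfl, hF₁.mem 3 rfl]
  have m4 : s₂.mem 4 = s₁.mem 4 := hF₂.mem 4 rfl
  have m5 : s₂.mem 5 = s₁.mem 5 := hF₂.mem 5 rfl
  have m5' : s₃.mem 5 = s₁.mem 5 := by rw [hF₃.mem 5 rfl, hF₂.mem 5 rfl]
  have m6 : s₂.mem 6 = s₁.mem 6 := hF₂.mem 6 rfl
  have m7 : s₃.mem 7 = s.mem 7 := by rw [hF₃.mem 7 rfl, hF₂.mem 7 rfl, hF₁.mem 7 rfl]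
  have hl : s₃.reg 23 = s₂.reg 23 := hF₃.reg 23 rfl
  rw [e8] at hlev hfree ht₂
  rw [f8, m4, m5, m6] at hmark
  rw [f8] at ht₃
  have hW : ∀ x b, sideNonAdj s v (s.reg 8) x b → ¬ s.mem 3 v x ≠ 0 ∧ s.mem 3 v b ≠ 0 := by
    rintro x b ⟨hx, hb, hlt, -⟩
    rcases hside b hb.1 hb.2 with h | h <;> omega
  refine (wp_collectSelected g0 g1 g3 (g8.symm ▸ h8) (by simpa [m7] using h7)
    (P := Auction.Selected (fun x => s.mem 3 v x ≠ 0) (s₁.mem 4 v) (s₁.mem 5 v) (s₁.mem 6 v)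
      (s₂.reg 23)) fun x => ?_).mono ?_
  · rw [Auction.Selected, m3, hmark, m5', hl, not_not]
    refine or_congr_left (and_congr_right fun _ => or_congr_right ⟨?_, ?_⟩)
    · rintro ⟨b, hb, hlt⟩
      have hb0 : s₁.mem 4 v b ≠ 0 := fun h => by
        have := A.price_zero b h
        omega
      have hbr := (A.own_adj b hb0).1.2.1
      exact ⟨b, hbr.1, hbr.2, hb, hlt⟩
    · rintro ⟨b, -, -, hb, hlt⟩
      exact ⟨b, hb, hlt⟩
  · rintro s₄ t₄ ⟨hmem, hcard, ht₄⟩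
    rw [g8] at hmem hcard ht₄
    rw [m2] at hmem
    refine ⟨⟨_, fun x hx => ?_, fun w => ?_, hcard, fun x hx y hy => ?_, fun T hT hind => ?_⟩, ?_⟩
    · simpa using (Finset.mem_filter.1 hx).1
    · rw [hmem]
      simp only [Finset.mem_filter, Finset.mem_Ico, and_assoc]
    · exact A.selected_indep hW hlev (Finset.mem_filter.1 hx).2 (Finset.mem_filter.1 hy).2
    · refine A.card_le_card_selected hW (fun x b h => ⟨h.1.1, h.2.1⟩) ha hfree (fun x => ?_) hT hind
      rw [Finset.mem_filter, Finset.mem_Ico]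
    · linarith

/-! ### Visiting a vertex -/

/-- A set of vertices that are pairwise adjacent. -/
def Input.IsClique {n : ℕ} (I : Input n) (S : Finset ℕ) : Prop := ∀ u ∈ S, ∀ w ∈ S, I.Conn u w

/-- The vertex `w` is put on side 1 of the inner neighbourhood of `v`. -/
def Input.Late {n : ℕ} (I : Input n) (v w : ℕ) : Prop :=
  ∃ u ∈ I.inner v, ¬ I.Conn w u ∧ I.key v u ≤ I.key v w

/-- Both sides of the inner neighbourhood of `v` are cliques. -/
def Input.Splits {n : ℕ} (I : Input n) (v : ℕ) : Prop :=
  ∀ u ∈ I.inner v, ∀ w ∈ I.inner v, (I.Late v u ↔ I.Late v w) → I.Conn u w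

/-- Computes a maximum clique of the inner neighbourhood of the vertex in register 3, provided it
splits, and updates the largest clique found so far, of the size in register 14 and found at the
vertex in register 15. -/
def visit : Program :=
  .seq listInner (.seq chooseSides (.seq checkSides (.seq selectMaximum
    (.ite (.lt 14 25) (block [.copy 14 25, .copy 15 3] skip) skip))))

theorem ListsInner.ncard_add_one {n : ℕ} {I : Input n} {v K : ℕ} {L : ℕ → ℕ} {key : ℕ → ℝ}
    (h : ListsInner I v K L key) : (I.inner v).ncard + 1 = K := by
  have himg : I.inner v = ((Finset.Ico 1 K).image L : Finset ℕ) := by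
    ext w
    simp [← h.mem_iff w, and_assoc]
  rw [himg, Set.ncard_coe_finset, Finset.card_image_of_injOn, Nat.card_Ico]
  · have := h.two_le
    omega
  · intro i hi j hj hij
    rw [Finset.mem_coe, Finset.mem_Ico] at hi hj
    exact h.inj i j hi.1 hi.2 hj.1 hj.2 hij

theorem wp_visit {n : ℕ} {I : Input n} (hI : I.Proper) {s : State} {v : ℕ} (hv : v < n)
    (h0 : s.reg 0 = 0) (h1 : s.reg 1 = 1) (h3 : s.reg 3 = v)
    (hconn : ∀ u w, s.mem 1 u w = 1 ↔ I.Conn u w)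
    (h4 : ∀ j, s.mem 4 v j = 0) (h5 : ∀ j, s.mem 5 v j = 0) (h6 : ∀ j, s.mem 6 v j = 0)
    (h7 : ∀ j, s.mem 7 v j = 0) :
    wp I visit s fun s' t => (∃ S : Finset ℕ, (∀ w, s'.mem 7 v w = 1 ↔ w ∈ S) ∧
      (I.Splits v → I.IsClique S ∧ ∀ T : Finset ℕ, I.IsClique T → (∀ w ∈ T, w ∈ I.inner v) →
        T.card ≤ S.card) ∧
      ((s.reg 14 < S.card ∧ s'.reg 14 = S.card ∧ s'.reg 15 = v) ∨
        (S.card ≤ s.reg 14 ∧ s'.reg 14 = s.reg 14 ∧ s'.reg 15 = s.reg 15))) ∧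
      (s'.reg 13 = 0 ↔ s.reg 13 = 0 ∧ I.Splits v) ∧
      t ≤ 12 * I.degree v + 100 * ((I.inner v).ncard + 1) ^ 3 := by
  classical
  rw [visit, wp_seq]
  refine (wp_listInner hI hv h1 h3).frame.mono ?_
  rintro s₁ t₁ ⟨⟨hL, ht₁⟩, hF₁⟩
  have e0 : s₁.reg 0 = 0 := (hF₁.reg 0 rfl).trans h0
  have e1 : s₁.reg 1 = 1 := (hF₁.reg 1 rfl).trans h1
  have e3 : s₁.reg 3 = v := (hF₁.reg 3 rfl).trans h3
  have hK := hL.two_le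
  have e8 : 1 ≤ s₁.reg 8 := by omega
  rw [wp_seq]
  refine (wp_chooseSides e1 e3 e8).frame.mono ?_
  rintro s₂ t₂ ⟨⟨hside, ht₂⟩, hF₂⟩
  have f0 : s₂.reg 0 = 0 := (hF₂.reg 0 rfl).trans e0
  have f1 : s₂.reg 1 = 1 := (hF₂.reg 1 rfl).trans e1
  have f3 : s₂.reg 3 = v := (hF₂.reg 3 rfl).trans e3
  have f8 : s₂.reg 8 = s₁.reg 8 := hF₂.reg 8 rfl
  have f13 : s₂.reg 13 = s.reg 13 := (hF₂.reg 13 rfl).trans (hF₁.reg 13 rfl)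
  rw [wp_seq]
  refine (wp_checkSides f1 f3 (f8.symm ▸ e8)).frame.mono ?_
  rintro s₃ t₃ ⟨⟨hcheck, ht₃⟩, hF₃⟩
  have g0 : s₃.reg 0 = 0 := (hF₃.reg 0 rfl).trans f0
  have g1 : s₃.reg 1 = 1 := (hF₃.reg 1 rfl).trans f1
  have g3 : s₃.reg 3 = v := (hF₃.reg 3 rfl).trans f3
  have g8 : s₃.reg 8 = s₁.reg 8 := (hF₃.reg 8 rfl).trans f8
  have hm : ∀ a, a ≠ 2 → a ≠ 3 → s₃.mem a = s.mem a := by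
    intro a h2 h3
    rw [hF₃.mem a rfl, hF₂.mem a (by simpa [chooseSides, forLoop, Program.keepsMem, Program.all,
      Instr.storeTarget] using h3.symm), hF₁.mem a (by simpa [listInner, forLoop, Program.keepsMem,
      Program.all, Instr.storeTarget] using h2.symm)]
  have m1 : s₁.mem 1 = s.mem 1 := hF₁.mem 1 rfl
  have m1' : s₂.mem 1 = s.mem 1 := (hF₂.mem 1 rfl).trans m1
  have m2 : s₂.mem 2 = s₁.mem 2 := hF₂.mem 2 rfl
  have m2' : s₃.mem 2 = s₁.mem 2 := (hF₃.mem 2 rfl).trans m2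
  have m3 : s₃.mem 3 = s₂.mem 3 := hF₃.mem 3 rfl
  rw [wp_seq]
  refine (wp_selectMaximum g0 g1 g3 (g8.symm ▸ e8) (by simpa [hm] using h4) (by simpa [hm] using h5)
    (by simpa [hm] using h6) (by simpa [hm] using h7) ?_).frame.mono ?_
  · rw [g8, m3]
    exact fun i hi hi' => (hside i hi hi').1
  rintro s₄ t₄ ⟨⟨⟨S, hS, hmem, hcard, hind, hmax⟩, ht₄⟩, hF₄⟩
  have k3 : s₄.reg 3 = v := (hF₄.reg 3 rfl).trans g3
  have k13 : s₄.reg 13 = s₃.reg 13 := hF₄.reg 13 rfl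
  have k14 : s₄.reg 14 = s.reg 14 := by
    rw [hF₄.reg 14 rfl, hF₃.reg 14 rfl, hF₂.reg 14 rfl, hF₁.reg 14 rfl]
  have k15 : s₄.reg 15 = s.reg 15 := by
    rw [hF₄.reg 15 rfl, hF₃.reg 15 rfl, hF₂.reg 15 rfl, hF₁.reg 15 rfl]
  rw [g8] at hS hind hmax ht₄
  rw [f8] at hcheck ht₃
  rw [m2'] at hmem
  have hmemL : ∀ i, 1 ≤ i → i < s₁.reg 8 → s₁.mem 2 v i ∈ I.inner v := fun i hi hi' =>
    (hL.mem_iff _).1 ⟨i, hi, hi', rfl⟩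
  have hadj : ∀ i j, s.mem 1 (s₁.mem 2 v i) (s₁.mem 2 v j) = 1 ↔
      I.Conn (s₁.mem 2 v i) (s₁.mem 2 v j) := fun i j => hconn _ _
  have hlate : ∀ i, 1 ≤ i → i < s₁.reg 8 → (s₂.mem 3 v i = 1 ↔ I.Late v (s₁.mem 2 v i)) := by
    intro i hi hi'
    rw [(hside i hi hi').2, m1]
    constructor
    · rintro ⟨j, hj, hj', hne, hle⟩
      rw [hL.key_eq j hj hj', hL.key_eq i hi hi'] at hle
      exact ⟨_, hmemL j hj hj', fun h => hne ((hadj i j).2 h), hle⟩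
    · rintro ⟨u, hu, hne, hle⟩
      obtain ⟨j, hj, hj', rfl⟩ := (hL.mem_iff u).2 hu
      rw [← hL.key_eq j hj hj', ← hL.key_eq i hi hi'] at hle
      exact ⟨j, hj, hj', fun h => hne ((hadj i j).1 h), hle⟩
  have hcol : ∀ i j, 1 ≤ i → i < s₁.reg 8 → 1 ≤ j → j < s₁.reg 8 →
      (s₂.mem 3 v i = s₂.mem 3 v j ↔
        (I.Late v (s₁.mem 2 v i) ↔ I.Late v (s₁.mem 2 v j))) := by
    intro i j hi hi' hj hj'
    rw [← hlate i hi hi', ← hlate j hj hj']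
    rcases (hside i hi hi').1 with h1 | h1 <;> rcases (hside j hj hj').1 with h2 | h2 <;>
      simp [h1, h2]
  have hsplit : I.Splits v ↔ ∀ i j, 1 ≤ i → i < s₁.reg 8 → 1 ≤ j → j < s₁.reg 8 →
      s₂.mem 3 v i = s₂.mem 3 v j → s₂.mem 1 (s₂.mem 2 v i) (s₂.mem 2 v j) = 1 := by
    simp only [m1', m2, hadj]
    constructor
    · intro h i j hi hi' hj hj' hij
      exact h _ (hmemL i hi hi') _ (hmemL j hj hj') ((hcol i j hi hi' hj hj').1 hij)
    · intro h u hu w hw huw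
      obtain ⟨i, hi, hi', rfl⟩ := (hL.mem_iff u).2 hu
      obtain ⟨j, hj, hj', rfl⟩ := (hL.mem_iff w).2 hw
      exact h i j hi hi' hj hj' ((hcol i j hi hi' hj hj').2 huw)
  have hnon : ∀ x y, sideNonAdj s₃ v (s₁.reg 8) x y ↔ (1 ≤ x ∧ x < s₁.reg 8) ∧
      (1 ≤ y ∧ y < s₁.reg 8) ∧ s₂.mem 3 v x < s₂.mem 3 v y ∧
        ¬ I.Conn (s₁.mem 2 v x) (s₁.mem 2 v y) := by
    intro x y
    rw [sideNonAdj, m3, hm 1 (by simp) (by simp), m2', ne_eq, hadj]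
  have hinj : Set.InjOn (s₁.mem 2 v) (S : Set ℕ) := fun i hi j hj hij =>
    hL.inj i j (hS i hi).1 (hS i hi).2 (hS j hj).1 (hS j hj).2 hij
  -- The running time of all parts is a polynomial of degree three in the length of the list.
  have htime : t₁ + (t₂ + (t₃ + (t₄ + 4))) ≤
      12 * I.degree v + 100 * ((I.inner v).ncard + 1) ^ 3 := by
    rw [hL.ncard_add_one]
    generalize s₁.reg 8 = K at *
    have h2 : 2 * (K * K) ≤ K * (K * K) := Nat.mul_le_mul_right _ hK
    have h1 : 2 * K ≤ K * K := Nat.mul_le_mul_right _ hK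
    ring_nf at *
    omega
  have hclique : I.Splits v → I.IsClique (S.image (s₁.mem 2 v)) ∧ ∀ T : Finset ℕ, I.IsClique T →
      (∀ w ∈ T, w ∈ I.inner v) → T.card ≤ (S.image (s₁.mem 2 v)).card := by
    intro hsp
    constructor
    · intro u hu w hw
      obtain ⟨x, hx, rfl⟩ := Finset.mem_image.1 hu
      obtain ⟨y, hy, rfl⟩ := Finset.mem_image.1 hw
      have hxK := hS x hx
      have hyK := hS y hy
      rcases lt_trichotomy (s₂.mem 3 v x) (s₂.mem 3 v y) with hlt | heq | hlt
      · by_contra hne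
        exact hind x hx y hy ((hnon x y).2 ⟨hxK, hyK, hlt, hne⟩)
      · exact hsp _ (hmemL x hxK.1 hxK.2) _ (hmemL y hyK.1 hyK.2)
          ((hcol x y hxK.1 hxK.2 hyK.1 hyK.2).1 heq)
      · by_contra hne
        exact hind y hy x hx ((hnon y x).2 ⟨hyK, hxK, hlt, fun h => hne (hI.symm _ _ h)⟩)
    · intro T hT hTv
      rw [Finset.card_image_of_injOn hinj]
      have hTimg : T ⊆ ((Finset.Ico 1 (s₁.reg 8)).filter fun x => s₁.mem 2 v x ∈ T).image
          (s₁.mem 2 v) := by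
        intro w hw
        obtain ⟨i, hi, hi', rfl⟩ := (hL.mem_iff w).2 (hTv w hw)
        exact Finset.mem_image.2 ⟨i, by simp [hi, hi', hw], rfl⟩
      refine (Finset.card_le_card hTimg).trans (Finset.card_image_le.trans (hmax _ ?_ ?_))
      · intro x hx
        simpa using (Finset.mem_filter.1 hx).1
      · intro x hx y hy hxy
        exact ((hnon x y).1 hxy).2.2.2
          (hT _ (Finset.mem_filter.1 hx).2 _ (Finset.mem_filter.1 hy).2)
  have hcard' : (S.image (s₁.mem 2 v)).card = S.card := Finset.card_image_of_injOn hinj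
  simp only [block, skip, wp_ite, wp_seq, wp_instr, Test.Holds, Instr.apply, k14, hcard]
  refine ⟨fun hlt => ⟨⟨S.image (s₁.mem 2 v), ?_, hclique, Or.inl ?_⟩, ?_, ?_⟩,
    fun hlt => ⟨⟨S.image (s₁.mem 2 v), ?_, hclique, Or.inr ?_⟩, ?_, ?_⟩⟩
  · intro w
    rw [Finset.mem_image]
    exact hmem w
  · rw [hcard']
    simpa [hcard, k3] using hlt
  · simp only [State.setReg_reg, Nat.reduceEqDiff, if_false]
    rw [k13, hcheck, f13, ← hsplit]
  · omega
  · intro w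
    rw [Finset.mem_image]
    exact hmem w
  · rw [hcard']
    exact ⟨not_lt.1 hlt, trivial, k15⟩
  · rw [k13, hcheck, f13, ← hsplit]
  · omega

/-! ### Visiting all vertices -/

/-- Outputs the vertices marked in the row of array `a` whose number is in register 15. -/
def copyOut (a : ℕ) : Program :=
  forLoop 5 0 2 (block [.load 9 a 15 5, .store 0 5 0 9] skip)

theorem wp_copyOut {n : ℕ} {I : Input n} {s : State} {a : ℕ} (ha : a ≠ 0) (h0 : s.reg 0 = 0) :
    wp I (copyOut a) s fun s' t =>
      (∀ u < s.reg 2, s'.mem 0 u 0 = s.mem a (s.reg 15) u) ∧ t ≤ 5 * s.reg 2 + 2 := by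
  refine (wp_forLoop (fun m s' t => (∀ u < m, s'.mem 0 u 0 = s.mem a (s.reg 15) u) ∧
    t ≤ 5 * m + 1) (Nat.zero_le _) rfl rfl ?_ ?_).mono ?_
  · simp
  · rintro m s' t - hlt hi hb hF ⟨hI, ht⟩
    have f0 : s'.reg 0 = 0 := (hF.reg 0 rfl).trans h0
    have f15 : s'.reg 15 = s.reg 15 := hF.reg 15 rfl
    have fa : s'.mem a = s.mem a := hF.mem a (by simpa [forLoop, Program.keepsMem, Program.all,
      Instr.storeTarget] using ha.symm)
    simp only [block, skip, wp_seq, wp_instr, Instr.apply, State.setReg_reg, State.setReg_mem,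
      State.setMem_mem, f0, f15, fa, hi, true_and, if_true, Nat.reduceEqDiff, if_false, and_true]
    refine ⟨fun u hu => ?_, by omega⟩
    split_ifs with hum
    · rw [hum]
    · exact hI u (by omega)
  · rintro s' t ⟨⟨t₀, ⟨hI, ht⟩, rfl⟩, hF⟩
    exact ⟨hI, by omega⟩

/-- Visits all vertices. -/
def visitAll : Program := forLoop 3 0 2 visit

theorem Input.Conn.refl {n : ℕ} {I : Input n} {v : ℕ} (hv : v < n) : I.Conn v v := ⟨hv, Or.inl rfl⟩

/-- A clique is contained in the inner neighbourhood of its vertex of largest radius. -/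
theorem Input.IsClique.exists_subset_inner {n : ℕ} {I : Input n} {T : Finset ℕ} (hT : I.IsClique T)
    (hne : T.Nonempty) : ∃ v < n, ∀ w ∈ T, w ∈ I.inner v := by
  obtain ⟨v, hv, hmax⟩ := T.exists_max_image (fun w => (I.point w).1) hne
  exact ⟨v, (hT v hv v hv).1, fun w hw => ⟨hT v hv w hw, hmax w hw⟩⟩

theorem wp_visitAll {n : ℕ} {I : Input n} (hI : I.Proper) {s : State} (h0 : s.reg 0 = 0)
    (h1 : s.reg 1 = 1) (h2 : s.reg 2 = n) (h13 : s.reg 13 = 0) (h14 : s.reg 14 = 0)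
    (hconn : ∀ u w, s.mem 1 u w = 1 ↔ I.Conn u w) (hm : ∀ a, a ≠ 1 → s.mem a = fun _ _ => 0) :
    wp I visitAll s fun s' t => (s'.reg 13 = 0 ↔ ∀ v < n, I.Splits v) ∧
      ((∀ v < n, I.Splits v) → ∃ S : Finset ℕ, I.IsClique S ∧
        (∀ T : Finset ℕ, I.IsClique T → T.card ≤ S.card) ∧
        ∀ w < n, s'.mem 7 (s'.reg 15) w = 1 ↔ w ∈ S) ∧
      t ≤ ∑ v ∈ Finset.range n,
        (12 * I.degree v + 100 * ((I.inner v).ncard + 1) ^ 3 + 2) + 2 := by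
  refine (wp_forLoop (fun m s' t =>
    (∀ a, 4 ≤ a → a ≤ 7 → ∀ i, m ≤ i → ∀ j, s'.mem a i j = 0) ∧
    (s'.reg 13 = 0 ↔ ∀ v < m, I.Splits v) ∧
    (∀ v < m, I.Splits v → ∀ T : Finset ℕ, I.IsClique T → (∀ w ∈ T, w ∈ I.inner v) →
      T.card ≤ s'.reg 14) ∧
    (s'.reg 14 ≠ 0 → s'.reg 15 < m ∧ ∃ S : Finset ℕ, S.card = s'.reg 14 ∧
      (∀ w, s'.mem 7 (s'.reg 15) w = 1 ↔ w ∈ S) ∧ (I.Splits (s'.reg 15) → I.IsClique S)) ∧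
    t ≤ ∑ v ∈ Finset.range m,
        (12 * I.degree v + 100 * ((I.inner v).ncard + 1) ^ 3 + 2) + 1)
    (Nat.zero_le _) rfl rfl ?_ ?_).mono ?_
  · refine ⟨fun a ha ha' i _ j => ?_, by simp [h13], by simp, by simp [h14], by simp⟩
    rw [State.setReg_mem, hm a (by omega)]
  · rintro m s' t - hlt hi hb hF ⟨hzero, hflag, hmax, hbest, ht⟩
    rw [h2] at hlt
    have hconn' : ∀ u w, s'.mem 1 u w = 1 ↔ I.Conn u w := by rw [hF.mem 1 rfl]; exact hconn
    refine (wp_visit hI hlt ((hF.reg 0 rfl).trans h0) ((hF.reg 1 rfl).trans h1) hi hconn'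
      (hzero 4 (by simp) (by simp) m le_rfl) (hzero 5 (by simp) (by simp) m le_rfl)
      (hzero 6 (by simp) (by simp) m le_rfl) (hzero 7 (by simp) (by simp) m le_rfl)).frame.mono ?_
    rintro s'' t'' ⟨⟨⟨S, hS, hclique, hupd⟩, hflag', ht''⟩, hF'⟩
    have hrow : ∀ a, 4 ≤ a → a ≤ 7 → ∀ i, i ≠ m → s''.mem a i = s'.mem a i := by
      intro a ha ha' i him
      refine hF'.row 3 a i ?_ (by rwa [hi])
      interval_cases a <;> rfl
    simp only [State.setReg_mem, State.setReg_reg, Nat.reduceEqDiff, if_false,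
      Nat.lt_succ_iff_lt_or_eq, or_imp, forall_and, forall_eq]
    refine ⟨?_, ?_, ⟨?_, ?_⟩, ?_, ?_⟩
    · intro a ha ha' i him j
      rw [hrow a ha ha' i (by omega)]
      exact hzero a ha ha' i (by omega) j
    · rw [hflag', hflag]
    · intro v hv hsp T hT hTv
      have := hmax v hv hsp T hT hTv
      omega
    · intro hsp T hT hTv
      have := (hclique hsp).2 T hT hTv
      omega
    · refine imp_and.1 ?_
      rcases hupd with ⟨hlt', h14', h15'⟩ | ⟨hle, h14', h15'⟩
      · intro _
        rw [h14', h15']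
        exact ⟨Or.inr rfl, S, rfl, hS, fun hsp => (hclique hsp).1⟩
      · intro hne
        rw [h14'] at hne ⊢
        rw [h15']
        obtain ⟨h1, h2⟩ := hbest hne
        refine ⟨Or.inl h1, ?_⟩
        rwa [hrow 7 (by simp) le_rfl _ (by omega)]
    · rw [Finset.sum_range_succ]
      omega
  · rintro s' t ⟨⟨t₀, ⟨hzero, hflag, hmax, hbest, ht⟩, rfl⟩, hF⟩
    rw [h2] at hflag hmax hbest ht
    refine ⟨hflag, fun hsp => ?_, by omega⟩
    have hmax' : ∀ T : Finset ℕ, I.IsClique T → T.card ≤ s'.reg 14 := by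
      intro T hT
      rcases T.eq_empty_or_nonempty with rfl | hne
      · simp
      · obtain ⟨v, hv, hTv⟩ := hT.exists_subset_inner hne
        exact hmax v hv (hsp v hv) T hT hTv
    by_cases h : s'.reg 14 = 0
    · have hn : n = 0 := by
        by_contra hn
        have := hmax' {0} (by
          simp only [Input.IsClique, Finset.mem_singleton, forall_eq]
          exact .refl (Nat.pos_of_ne_zero hn))
        simp [h] at this
      refine ⟨∅, by simp [Input.IsClique], fun T hT => ?_, by simp [hn]⟩
      simpa [h] using hmax' T hT
    · obtain ⟨h15, S, hcard, hS, hcl⟩ := hbest h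
      exact ⟨S, hcl (hsp _ h15), fun T hT => hcard ▸ hmax' T hT, fun w _ => hS w⟩

/-! ### Enumeration of all cliques -/

/-- Sets register 11 to 1 if the vertex in register 3 is adjacent to all vertices in the row of
array 8 whose number is in register 5, and to 0 otherwise. -/
def testRow : Program :=
  block [.const 11 1]
    (forLoop 6 0 2 (block [.load 9 8 5 6, .load 12 1 6 3]
      (.ite (.eq 9 1) (.ite (.ne 12 1) (.instr (.const 11 0)) skip) skip)))

/-- Appends a copy of this row, to which the vertex is added. The cells `[j, 0]` of array 9 hold
the number of vertices in row `j`, and a largest row is kept track of. -/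
def extendRow : Program :=
  .seq (forLoop 6 0 2 (block [.load 9 8 5 6, .store 8 16 6 9] skip))
    (block [.store 8 16 3 1, .load 20 9 5 0, .succ 20, .store 9 16 0 20]
      (.seq (.ite (.lt 14 20) (block [.copy 14 20, .copy 15 16] skip) skip) (.instr (.succ 16))))

/-- Lists all cliques as rows of array 8, and outputs a largest one. -/
def enumerateCliques : Program :=
  block [.const 16 1, .const 14 0, .const 15 0]
    (.seq
      (forLoop 3 0 2 (block [.copy 17 16]
        (forLoop 5 0 17 (.seq testRow (.ite (.eq 11 1) extendRow skip)))))
      (copyOut 8))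

/-- The set of vertices marked in row `j` of array 8. -/
def State.rowSet (s : State) (n j : ℕ) : Finset ℕ := (Finset.range n).filter fun u => s.mem 8 j u = 1

theorem State.mem_rowSet {s : State} {n j u : ℕ} : u ∈ s.rowSet n j ↔ u < n ∧ s.mem 8 j u = 1 := by
  simp [State.rowSet]

theorem wp_testRow {n : ℕ} {I : Input n} {s : State} {v : ℕ} (h1 : s.reg 1 = 1) (h2 : s.reg 2 = n)
    (h3 : s.reg 3 = v) (hconn : ∀ u w, s.mem 1 u w = 1 ↔ I.Conn u w) :
    wp I testRow s fun s' _ => (s'.reg 11 = 1 ↔ ∀ u ∈ s.rowSet n (s.reg 5), I.Conn u v) := by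
  refine wp_block (fun s₁ => s₁.reg 1 = 1 ∧ s₁.reg 2 = n ∧ s₁.reg 3 = v ∧ s₁.reg 5 = s.reg 5 ∧
    s₁.reg 11 = 1 ∧ s₁.mem = s.mem) (by simp [h1, h2, h3]) ?_
  rintro s₁ ⟨h1, h2, h3, h5, h11, hm⟩
  refine (wp_forLoop (fun m s' _ => (s'.reg 11 = 1 ↔ ∀ u < m, s.mem 8 (s.reg 5) u = 1 → I.Conn u v))
    (Nat.zero_le _) rfl rfl ?_ ?_).mono ?_
  · simp [h11]
  · rintro m s' t - hlt hi hb hF hI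
    have f1 : s'.reg 1 = 1 := (hF.reg 1 rfl).trans h1
    have f3 : s'.reg 3 = v := (hF.reg 3 rfl).trans h3
    have f5 : s'.reg 5 = s.reg 5 := (hF.reg 5 rfl).trans h5
    have m1 : s'.mem 1 = s.mem 1 := (hF.mem 1 rfl).trans (by rw [hm])
    have m8 : s'.mem 8 = s.mem 8 := (hF.mem 8 rfl).trans (by rw [hm])
    simp only [block, skip, wp_ite, wp_seq, wp_instr, Test.Holds, Instr.apply, State.setReg_reg,
      State.setReg_mem, f1, f3, f5, m1, m8, hi, if_true, Nat.reduceEqDiff, if_false, ne_eq, hconn,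
      Nat.lt_succ_iff_lt_or_eq, or_imp, forall_and, forall_eq, ← hI]
    refine ⟨⟨fun h h' => ?_, fun h h' => ?_⟩, fun h => ?_⟩
    · simp [h, h']
    · simp [not_not.1 h']
    · simp [h]
  · rintro s' t ⟨⟨t₀, hI, rfl⟩, hF⟩
    rw [hI, h2]
    simp [State.mem_rowSet]

/-- The rows of array 8 up to the number in register 16 are cliques below `b`, with their sizes in
array 9; register 15 holds the number of a largest row and register 14 its size. -/
structure RowsInv {n : ℕ} (I : Input n) (b : ℕ) (s : State) : Prop where
  clique : ∀ j < s.reg 16, I.IsClique (s.rowSet n j) ∧ (∀ u ∈ s.rowSet n j, u < b) ∧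
    s.mem 9 j 0 = (s.rowSet n j).card
  card_le : ∀ j < s.reg 16, (s.rowSet n j).card ≤ s.reg 14
  best : s.reg 15 < s.reg 16 ∧ (s.rowSet n (s.reg 15)).card = s.reg 14

theorem RowsInv.congr {n : ℕ} {I : Input n} {b : ℕ} {s s' : State} (h : RowsInv I b s)
    (h8 : s'.mem 8 = s.mem 8) (h9 : s'.mem 9 = s.mem 9) (h14 : s'.reg 14 = s.reg 14)
    (h15 : s'.reg 15 = s.reg 15) (h16 : s'.reg 16 = s.reg 16) : RowsInv I b s' := by
  have hrow : s'.rowSet = s.rowSet := by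
    funext n j
    simp [State.rowSet, h8]
  refine ⟨?_, ?_, ?_⟩
  · rw [h16, hrow, h9]
    exact h.clique
  · rw [h16, h14, hrow]
    exact h.card_le
  · rw [h14, h15, h16, hrow]
    exact h.best

theorem wp_extendRow {n : ℕ} {I : Input n} (hI : I.Proper) {s : State} {v : ℕ} (h0 : s.reg 0 = 0)
    (h1 : s.reg 1 = 1) (h2 : s.reg 2 = n) (h3 : s.reg 3 = v) (hv : v < n)
    (hR : RowsInv I (v + 1) s) (h5 : s.reg 5 < s.reg 16) (hlt : ∀ u ∈ s.rowSet n (s.reg 5), u < v)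
    (hadj : ∀ u ∈ s.rowSet n (s.reg 5), I.Conn u v) :
    wp I extendRow s fun s' _ => RowsInv I (v + 1) s' ∧ s'.reg 16 = s.reg 16 + 1 ∧
      (∀ j < s.reg 16, s'.rowSet n j = s.rowSet n j) ∧
      s'.rowSet n (s.reg 16) = insert v (s.rowSet n (s.reg 5)) := by
  rw [extendRow, wp_seq]
  refine (wp_forLoop (fun m s' _ => (∀ u < m, s'.mem 8 (s.reg 16) u = s.mem 8 (s.reg 5) u) ∧
    ∀ j < s.reg 16, s'.mem 8 j = s.mem 8 j) (Nat.zero_le _) rfl rfl ?_ ?_).mono ?_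
  · simp
  · rintro m s' t - hlt hi hb hF ⟨hcopy, hold⟩
    have f5 : s'.reg 5 = s.reg 5 := hF.reg 5 rfl
    have f16 : s'.reg 16 = s.reg 16 := hF.reg 16 rfl
    simp only [block, skip, wp_seq, wp_instr, Instr.apply, State.setReg_reg, State.setReg_mem, f5,
      f16, hi, if_true, Nat.reduceEqDiff, if_false, State.setMem_mem, true_and, hold _ h5]
    refine ⟨fun u hu => ?_, fun j hj => ?_⟩
    · split_ifs with hum
      · rw [hum]
      · exact hcopy u (by omega)
    · rw [← hold j hj]
      funext u
      simp only [State.setMem_mem, true_and]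
      rw [if_neg (by omega)]
      rfl
  · rintro s₁ t₁ ⟨⟨t₀, ⟨hcopy, hold⟩, rfl⟩, hF⟩
    rw [h2] at hcopy
    have f0 : s₁.reg 0 = 0 := (hF.reg 0 rfl).trans h0
    have f1 : s₁.reg 1 = 1 := (hF.reg 1 rfl).trans h1
    have f3 : s₁.reg 3 = v := (hF.reg 3 rfl).trans h3
    have f5 : s₁.reg 5 = s.reg 5 := hF.reg 5 rfl
    have f14 : s₁.reg 14 = s.reg 14 := hF.reg 14 rfl
    have f15 : s₁.reg 15 = s.reg 15 := hF.reg 15 rfl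
    have f16 : s₁.reg 16 = s.reg 16 := hF.reg 16 rfl
    have m9 : s₁.mem 9 = s.mem 9 := hF.mem 9 rfl
    set S := s.rowSet n (s.reg 5) with hS
    have hvS : v ∉ S := fun h => (hlt v h).ne rfl
    have hcl : I.IsClique (insert v S) := by
      have hSc := (hR.clique _ h5).1
      intro u hu w hw
      rcases Finset.mem_insert.1 hu with rfl | hu' <;> rcases Finset.mem_insert.1 hw with rfl | hw'
      · exact .refl hv
      · exact hI.symm _ _ (hadj w hw')
      · exact hadj u hu'
      · exact hSc u hu' w hw'
    have hcard : s.mem 9 (s.reg 5) 0 + 1 = (insert v S).card := by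
      rw [Finset.card_insert_of_notMem hvS, (hR.clique _ h5).2.2]
    -- What the new row must satisfy, whichever of the two branches has been taken.
    have hfin : ∀ s₂ : State, s₂.reg 16 = s.reg 16 + 1 →
        s₂.mem 8 = (s₁.setMem 8 (s.reg 16) v 1).mem 8 →
        s₂.mem 9 = (s₁.setMem 9 (s.reg 16) 0 (insert v S).card).mem 9 →
        ((s.reg 14 < (insert v S).card ∧ s₂.reg 14 = (insert v S).card ∧
            s₂.reg 15 = s.reg 16) ∨
          ((insert v S).card ≤ s.reg 14 ∧ s₂.reg 14 = s.reg 14 ∧ s₂.reg 15 = s.reg 15)) →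
        RowsInv I (v + 1) s₂ ∧
          (∀ j < s.reg 16, s₂.rowSet n j = s.rowSet n j) ∧
          s₂.rowSet n (s.reg 16) = insert v S := by
      intro s₂ e16 e8 e9 hbest
      have hrow : ∀ j < s.reg 16, s₂.rowSet n j = s.rowSet n j := by
        intro j hj
        ext u
        rw [State.mem_rowSet, State.mem_rowSet, e8, State.setMem_mem, if_neg (by omega), hold j hj]
      have hnew : s₂.rowSet n (s.reg 16) = insert v S := by
        ext u
        rw [State.mem_rowSet, e8, State.setMem_mem, Finset.mem_insert, hS, State.mem_rowSet]
        by_cases hu : u = v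
        · simp [hu, hv]
        · simp only [hu, and_false, if_false, false_or]
          refine and_congr_right fun hun => ?_
          rw [hcopy u hun]
      refine ⟨⟨fun j hj => ?_, fun j hj => ?_, ?_⟩, hrow, hnew⟩
      · rw [e9, State.setMem_mem]
        rcases Nat.lt_succ_iff_lt_or_eq.1 (e16 ▸ hj) with hj' | rfl
        · rw [hrow j hj', if_neg (by omega), m9]
          exact hR.clique j hj'
        · rw [hnew]
          refine ⟨hcl, fun u hu => ?_, by simp⟩
          rcases Finset.mem_insert.1 hu with rfl | hu
          · exact Nat.lt_succ_self _
          · exact (hlt u hu).trans (Nat.lt_succ_self _)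
      · rcases Nat.lt_succ_iff_lt_or_eq.1 (e16 ▸ hj) with hj' | rfl
        · rw [hrow j hj']
          have := hR.card_le j hj'
          omega
        · rw [hnew]
          omega
      · rw [e16]
        rcases hbest with ⟨-, h14, h15⟩ | ⟨-, h14, h15⟩
        · rw [h14, h15, hnew]
          exact ⟨Nat.lt_succ_self _, rfl⟩
        · have := hR.best
          rw [h14, h15, hrow _ this.1]
          exact ⟨by omega, this.2⟩
    have m9' : ∀ i j, s₁.mem 9 i j = s.mem 9 i j := fun i j => by rw [m9]
    simp only [block, skip, wp_ite, wp_seq, wp_instr, Test.Holds, Instr.apply, State.setReg_reg,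
      State.setMem_mem, State.setMem_reg, f0, f1, f3, f5, f14, f16, m9', hcard,
      if_true, Nat.reduceEqDiff, if_false, false_and, true_and]
    refine ⟨fun h => hfin _ ?_ ?_ ?_ (Or.inl ⟨h, ?_, ?_⟩),
      fun h => hfin _ ?_ ?_ ?_ (Or.inr ⟨not_lt.1 h, ?_, ?_⟩)⟩
    all_goals first | rfl | simp [f14, f15]

theorem wp_enumerateCliques {n : ℕ} {I : Input n} (hI : I.Proper) {s : State} (h0 : s.reg 0 = 0)
    (h1 : s.reg 1 = 1) (h2 : s.reg 2 = n) (hconn : ∀ u w, s.mem 1 u w = 1 ↔ I.Conn u w)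
    (h8 : s.mem 8 = fun _ _ => 0) (h9 : s.mem 9 = fun _ _ => 0) :
    wp I enumerateCliques s fun s' _ => ∃ S : Finset ℕ, I.IsClique S ∧
      (∀ T : Finset ℕ, I.IsClique T → T.card ≤ S.card) ∧ ∀ w < n, s'.mem 0 w 0 = 1 ↔ w ∈ S := by
  refine wp_block (fun s₁ => s₁.reg 0 = 0 ∧ s₁.reg 1 = 1 ∧ s₁.reg 2 = n ∧ s₁.reg 16 = 1 ∧
    s₁.reg 14 = 0 ∧ s₁.reg 15 = 0 ∧ s₁.mem = s.mem) (by simp [h0, h1, h2]) ?_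
  rintro s₁ ⟨h0, h1, h2, h16, h14, h15, hm⟩
  rw [wp_seq]
  refine (wp_forLoop (fun m s' _ => RowsInv I m s' ∧ ∀ S : Finset ℕ, I.IsClique S →
    (∀ u ∈ S, u < m) → ∃ j < s'.reg 16, s'.rowSet n j = S) (Nat.zero_le _) rfl rfl ?_ ?_).mono ?_
  · have hrow : ∀ j, (s₁.setReg 3 0).rowSet n j = ∅ := by
      intro j
      simp [State.rowSet, hm, h8]
    refine ⟨⟨fun j hj => ?_, fun j hj => ?_, ?_⟩, fun S hS hS' => ⟨0, by simp [h16], ?_⟩⟩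
    · simp [hrow, Input.IsClique, hm, h9]
    · simp [hrow]
    · simp [hrow, h14, h15, h16]
    · rw [hrow]
      exact (Finset.eq_empty_of_forall_notMem fun u hu => by simpa using hS' u hu).symm
  · rintro m s₂ t₂ - hlt hi hb hF₂ ⟨hR, hall⟩
    rw [h2] at hlt
    refine wp_block (fun s₃ => (∀ r, r ≠ 17 → s₃.reg r = s₂.reg r) ∧ s₃.reg 17 = s₂.reg 16 ∧
      s₃.mem = s₂.mem) (by simp +contextual) ?_
    rintro s₃ ⟨hr, h17, hm₃⟩
    have e0 : s₃.reg 0 = 0 := (hr 0 (by simp)).trans ((hF₂.reg 0 rfl).trans h0)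
    have e1 : s₃.reg 1 = 1 := (hr 1 (by simp)).trans ((hF₂.reg 1 rfl).trans h1)
    have e2 : s₃.reg 2 = n := (hr 2 (by simp)).trans ((hF₂.reg 2 rfl).trans h2)
    have e3 : s₃.reg 3 = m := (hr 3 (by simp)).trans hi
    have e16 : s₃.reg 16 = s₂.reg 16 := hr 16 (by simp)
    have em1 : s₃.mem 1 = s.mem 1 := by rw [hm₃, hF₂.mem 1 rfl, hm]
    refine (wp_forLoop (fun k s₄ _ => RowsInv I (m + 1) s₄ ∧ s₂.reg 16 ≤ s₄.reg 16 ∧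
      (∀ j < s₂.reg 16, s₄.rowSet n j = s₂.rowSet n j) ∧
      ∀ j < k, (∀ u ∈ s₂.rowSet n j, I.Conn u m) →
        ∃ j' < s₄.reg 16, s₄.rowSet n j' = insert m (s₂.rowSet n j)) (Nat.zero_le _) rfl rfl
      ?_ ?_).mono ?_
    · refine ⟨?_, ?_, fun j _ => ?_, fun j hj => absurd hj (Nat.not_lt_zero j)⟩
      · have hR' : RowsInv I (m + 1) s₂ := ⟨fun j hj => ⟨(hR.clique j hj).1,
          fun u hu => ((hR.clique j hj).2.1 u hu).trans (Nat.lt_succ_self m),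
          (hR.clique j hj).2.2⟩, hR.card_le, hR.best⟩
        refine hR'.congr ?_ ?_ ?_ ?_ ?_ <;> simp [hm₃, hr]
      · simp [e16]
      · simp [State.rowSet, hm₃]
    · rintro k s₄ t₄ - hk hi₄ hb₄ hF₄ ⟨hR₄, hle, hold, hnew⟩
      rw [h17] at hk
      have f0 : s₄.reg 0 = 0 := (hF₄.reg 0 rfl).trans e0
      have f1 : s₄.reg 1 = 1 := (hF₄.reg 1 rfl).trans e1
      have f2 : s₄.reg 2 = n := (hF₄.reg 2 rfl).trans e2
      have f3 : s₄.reg 3 = m := (hF₄.reg 3 rfl).trans e3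
      have fm1 : ∀ u w, s₄.mem 1 u w = 1 ↔ I.Conn u w := by
        rw [hF₄.mem 1 rfl, em1]
        exact hconn
      rw [wp_seq]
      refine (wp_testRow f1 f2 f3 fm1).frame.mono ?_
      rintro s₅ t₅ ⟨h11, hF₅⟩
      have g0 : s₅.reg 0 = 0 := (hF₅.reg 0 rfl).trans f0
      have g1 : s₅.reg 1 = 1 := (hF₅.reg 1 rfl).trans f1
      have g2 : s₅.reg 2 = n := (hF₅.reg 2 rfl).trans f2
      have g3 : s₅.reg 3 = m := (hF₅.reg 3 rfl).trans f3
      have g5 : s₅.reg 5 = k := (hF₅.reg 5 rfl).trans hi₄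
      have g16 : s₅.reg 16 = s₄.reg 16 := hF₅.reg 16 rfl
      have hR₅ : RowsInv I (m + 1) s₅ := hR₄.congr (hF₅.mem 8 rfl) (hF₅.mem 9 rfl) (hF₅.reg 14 rfl)
        (hF₅.reg 15 rfl) g16
      have hrow : s₅.rowSet = s₄.rowSet := by
        funext n j
        simp [State.rowSet, hF₅.mem 8 rfl]
      rw [hi₄, hold k hk] at h11
      have hstep : ∀ s₆ : State, RowsInv I (m + 1) s₆ → s₄.reg 16 ≤ s₆.reg 16 →
          (∀ j < s₄.reg 16, s₆.rowSet n j = s₄.rowSet n j) →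
          ((∀ u ∈ s₂.rowSet n k, I.Conn u m) →
            ∃ j' < s₆.reg 16, s₆.rowSet n j' = insert m (s₂.rowSet n k)) →
          RowsInv I (m + 1) (s₆.setReg 5 (k + 1)) ∧ s₂.reg 16 ≤ (s₆.setReg 5 (k + 1)).reg 16 ∧
          (∀ j < s₂.reg 16, (s₆.setReg 5 (k + 1)).rowSet n j = s₂.rowSet n j) ∧
          ∀ j < k + 1, (∀ u ∈ s₂.rowSet n j, I.Conn u m) →
            ∃ j' < (s₆.setReg 5 (k + 1)).reg 16,
              (s₆.setReg 5 (k + 1)).rowSet n j' = insert m (s₂.rowSet n j) := by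
        intro s₆ hR₆ h16₆ hold₆ hnew₆
        refine ⟨hR₆.congr rfl rfl rfl rfl rfl, hle.trans h16₆, fun j hj => ?_, fun j hj hc => ?_⟩
        · exact (hold₆ j (by omega)).trans (hold j hj)
        · rcases Nat.lt_succ_iff_lt_or_eq.1 hj with hj' | rfl
          · obtain ⟨j', h1, h2⟩ := hnew j hj' hc
            exact ⟨j', h1.trans_le h16₆, (hold₆ j' h1).trans h2⟩
          · exact hnew₆ hc
      rw [wp_ite]
      simp only [Test.Holds, g1, h11]
      refine ⟨fun hadj => ?_, fun hadj => ?_⟩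
      · refine (wp_extendRow hI g0 g1 g2 g3 hlt hR₅ (by omega) ?_ ?_).mono ?_
        · rw [hrow, g5, hold k hk]
          exact (hR.clique k hk).2.1
        · rwa [hrow, g5, hold k hk]
        · rintro s₆ t₆ ⟨hR₆, h16₆, hold₆, hnew₆⟩
          rw [hrow, g16] at hold₆
          rw [hrow, g5, hold k hk, g16] at hnew₆
          rw [g16] at h16₆
          exact hstep s₆ hR₆ (by omega) hold₆ fun _ => ⟨_, by omega, hnew₆⟩
      · simp only [skip, wp_instr, Instr.apply]
        exact hstep s₅ hR₅ g16.ge (fun j _ => by rw [hrow]) fun h => absurd h hadj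
    · rintro s₄ t₄ ⟨⟨t₅, ⟨hR₄, hle, hold, hnew⟩, rfl⟩, hF₄⟩
      rw [h17] at hnew
      refine ⟨hR₄.congr rfl rfl rfl rfl rfl, fun S hS hSm => ?_⟩
      by_cases hmS : m ∈ S
      · obtain ⟨j, hj, hjS⟩ := hall (S.erase m)
          (fun u hu w hw => hS u (Finset.mem_of_mem_erase hu) w (Finset.mem_of_mem_erase hw))
          fun u hu => lt_of_le_of_ne (Nat.lt_succ_iff.1 (hSm u (Finset.mem_of_mem_erase hu)))
            (Finset.ne_of_mem_erase hu)
        obtain ⟨j', h1, h2⟩ := hnew j hj fun u hu => hS u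
          (Finset.mem_of_mem_erase (hjS ▸ hu)) m hmS
        refine ⟨j', h1, ?_⟩
        rw [hjS, Finset.insert_erase hmS] at h2
        exact h2
      · obtain ⟨j, hj, hjS⟩ := hall S hS fun u hu =>
          lt_of_le_of_ne (Nat.lt_succ_iff.1 (hSm u hu)) fun h => hmS (h ▸ hu)
        exact ⟨j, hj.trans_le hle, (hold j hj).trans hjS⟩
  · rintro s₂ t₂ ⟨⟨t₃, ⟨hR, hall⟩, rfl⟩, hF₂⟩
    rw [h2] at hR hall
    refine (wp_copyOut (by simp) ((hF₂.reg 0 rfl).trans h0)).mono ?_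
    rintro s₃ t₄ ⟨hout, -⟩
    rw [(hF₂.reg 2 rfl).trans h2] at hout
    refine ⟨s₂.rowSet n (s₂.reg 15), (hR.clique _ hR.best.1).1, fun T hT => ?_, fun w hw => ?_⟩
    · obtain ⟨j, hj, rfl⟩ := hall T hT fun u hu => (hT u hu u hu).1
      rw [hR.best.2]
      exact hR.card_le j hj
    · rw [hout w hw, State.mem_rowSet]
      simp [hw]

/-! ### The clique program -/

/-- Computes a maximum clique. If the inner neighbourhoods of all vertices split, a largest of the
cliques found in them is output; otherwise all cliques are enumerated. -/
def cliqueProgram : Program :=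
  block [.const 1 1, .size 2]
    (.seq connMatrix (.seq visitAll (.ite (.eq 13 0) (copyOut 7) enumerateCliques)))

theorem wp_cliqueProgram {n : ℕ} {I : Input n} (hI : I.Proper) :
    wp I cliqueProgram State.init fun s t => (∃ S : Finset ℕ, I.IsClique S ∧
      (∀ T : Finset ℕ, I.IsClique T → T.card ≤ S.card) ∧ ∀ w < n, s.mem 0 w 0 = 1 ↔ w ∈ S) ∧
      ((∀ v < n, I.Splits v) → t ≤ ∑ v ∈ Finset.range n,
        (17 * I.degree v + 100 * ((I.inner v).ncard + 1) ^ 3 + 13) + 9) := by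
  refine wp_block (fun s => s.reg 0 = 0 ∧ s.reg 1 = 1 ∧ s.reg 2 = n ∧ s.reg 13 = 0 ∧
    s.reg 14 = 0 ∧ s.mem = fun _ _ _ => 0) (by simp [State.init]) ?_
  rintro s ⟨h0, h1, h2, h13, h14, hm⟩
  rw [wp_seq]
  refine (wp_connMatrix h1 h2 (by simp [hm])).frame.mono ?_
  rintro s₁ t₁ ⟨⟨hconn, ht₁⟩, hF₁⟩
  have e0 : s₁.reg 0 = 0 := (hF₁.reg 0 rfl).trans h0
  have e1 : s₁.reg 1 = 1 := (hF₁.reg 1 rfl).trans h1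
  have e2 : s₁.reg 2 = n := (hF₁.reg 2 rfl).trans h2
  have em : ∀ a, a ≠ 1 → s₁.mem a = fun _ _ => 0 := fun a ha => by
    rw [hF₁.mem a (by simpa [connMatrix, forLoop, Program.keepsMem, Program.all,
      Instr.storeTarget] using ha.symm), hm]
  rw [wp_seq]
  refine (wp_visitAll hI e0 e1 e2 ((hF₁.reg 13 rfl).trans h13) ((hF₁.reg 14 rfl).trans h14) hconn
    em).frame.mono ?_
  rintro s₂ t₂ ⟨⟨hflag, hbest, ht₂⟩, hF₂⟩
  have f0 : s₂.reg 0 = 0 := (hF₂.reg 0 rfl).trans e0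
  have f1 : s₂.reg 1 = 1 := (hF₂.reg 1 rfl).trans e1
  have f2 : s₂.reg 2 = n := (hF₂.reg 2 rfl).trans e2
  rw [wp_ite]
  simp only [Test.Holds, f0, hflag]
  refine ⟨fun hsp => ?_, fun hsp => ?_⟩
  · refine (wp_copyOut (by simp) f0).mono ?_
    rintro s₃ t₃ ⟨hout, ht₃⟩
    rw [f2] at hout ht₃
    obtain ⟨S, hS, hmax, hmem⟩ := hbest hsp
    refine ⟨⟨S, hS, hmax, fun w hw => by rw [hout w hw, hmem w hw]⟩, fun _ => ?_⟩
    simp only [List.length, Finset.sum_add_distrib, ← Finset.mul_sum, Finset.sum_const,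
      Finset.card_range, smul_eq_mul] at *
    omega
  · refine (wp_enumerateCliques hI f0 f1 f2 (by rw [hF₂.mem 1 rfl]; exact hconn)
      (by rw [hF₂.mem 8 rfl, em 8 (by simp)]) (by rw [hF₂.mem 9 rfl, em 9 (by simp)])).mono ?_
    rintro s₃ t₃ hS
    exact ⟨hS, fun h => absurd h hsp⟩

section graph

variable {n : ℕ} {G : SimpleGraph (Fin n)} {x : Fin n → Point} {nbrs : Fin n → List (Fin n)}

theorem Input.degree_val (I : Input n) (v : Fin n) : I.degree v = (I.nbrs v).length := by
  simp [Input.degree]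

theorem Input.neighbour_val (I : Input n) (v : Fin n) {i : ℕ} (hi : i < (I.nbrs v).length) :
    I.neighbour v i = (I.nbrs v)[i] := by
  simp [Input.neighbour, hi]

theorem Input.point_val (I : Input n) (v : Fin n) : I.point v = I.pts v := by
  simp [Input.point]

theorem Input.neighbour_lt (I : Input n) {v i : ℕ} (hv : v < n) (hi : i < I.degree v) :
    I.neighbour v i < n := by
  have h := I.neighbour_val ⟨v, hv⟩ (i := i) (by rwa [← I.degree_val])
  exact h ▸ Fin.is_lt _

theorem conn_iff (hG : IsAdjacencyList G nbrs) (u w : Fin n) :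
    (Input.mk x nbrs).Conn u w ↔ u = w ∨ G.Adj u w := by
  rw [Input.Conn, and_iff_right u.2, Fin.val_inj]
  refine or_congr_right ?_
  rw [← (hG u).2, List.mem_iff_getElem, Input.degree_val]
  constructor
  · rintro ⟨i, hi, h⟩
    rw [Input.neighbour_val _ _ hi, Fin.val_inj] at h
    exact ⟨i, hi, h⟩
  · rintro ⟨i, hi, h⟩
    refine ⟨i, hi, ?_⟩
    rw [Input.neighbour_val _ _ hi, h]

theorem Input.Conn.lt {I : Input n} {u w : ℕ} (h : I.Conn u w) : u < n ∧ w < n := by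
  refine ⟨h.1, ?_⟩
  rcases h.2 with rfl | ⟨i, hi, rfl⟩
  · exact h.1
  · exact I.neighbour_lt h.1 hi

theorem proper (hG : IsAdjacencyList G nbrs) : (Input.mk x nbrs).Proper where
  ne v hv i hi h := by
    have hi' : i < (nbrs ⟨v, hv⟩).length := by
      rwa [← Input.degree_val (Input.mk x nbrs)]
    have h1 := Input.neighbour_val (Input.mk x nbrs) ⟨v, hv⟩ hi'
    rw [h1] at h
    have h2 : (nbrs ⟨v, hv⟩)[i] = ⟨v, hv⟩ := Fin.ext h
    have h3 := ((hG ⟨v, hv⟩).2 _).1 (List.getElem_mem hi')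
    rw [h2] at h3
    exact G.irrefl h3
  inj v hv i hi j hj h := by
    have hi' : i < (nbrs ⟨v, hv⟩).length := by
      rwa [← Input.degree_val (Input.mk x nbrs)]
    have hj' : j < (nbrs ⟨v, hv⟩).length := by
      rwa [← Input.degree_val (Input.mk x nbrs)]
    have h1 := Input.neighbour_val (Input.mk x nbrs) ⟨v, hv⟩ hi'
    have h2 := Input.neighbour_val (Input.mk x nbrs) ⟨v, hv⟩ hj'
    rw [h1, h2, Fin.val_inj] at h
    exact (hG ⟨v, hv⟩).1.getElem_inj_iff.1 h
  symm u w h := by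
    obtain ⟨hu, hw⟩ := h.lt
    have h' := (conn_iff (x := x) hG ⟨u, hu⟩ ⟨w, hw⟩).1 h
    exact (conn_iff (x := x) hG ⟨w, hw⟩ ⟨u, hu⟩).2 (h'.imp Eq.symm fun h => G.adj_symm h)

theorem computesMaximumClique_cliqueProgram (G : SimpleGraph (Fin n)) (x : Fin n → Point) :
    ComputesMaximumClique cliqueProgram G x := by
  intro nbrs hG
  obtain ⟨s, t, hrun, ⟨S, hS, hmax, hmem⟩, -⟩ := wp_cliqueProgram (proper (x := x) hG)
  refine ⟨s, t, hrun, ?_⟩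
  have hout : (s.output n).map Fin.valEmbedding = S := by
    ext w
    simp only [State.output, Finset.mem_map, Finset.mem_filter, Finset.mem_univ, true_and,
      Fin.valEmbedding_apply]
    constructor
    · rintro ⟨v, hv, rfl⟩
      exact (hmem v v.2).1 hv
    · intro hw
      have hwn := (hS w hw w hw).1
      exact ⟨⟨w, hwn⟩, (hmem w hwn).2 hw, rfl⟩
  rw [SimpleGraph.isMaximumClique_iff]
  refine ⟨fun u hu w hw hne => ?_, fun T hT => ?_⟩
  · have hu' : (u : ℕ) ∈ S := hout ▸ Finset.mem_map_of_mem _ hu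
    have hw' : (w : ℕ) ∈ S := hout ▸ Finset.mem_map_of_mem _ hw
    exact ((conn_iff hG u w).1 (hS _ hu' _ hw')).resolve_left hne
  · rw [← Finset.card_map Fin.valEmbedding (s := s.output n), hout,
      ← Finset.card_map Fin.valEmbedding]
    refine hmax _ fun u hu w hw => ?_
    obtain ⟨u, hu', rfl⟩ := Finset.mem_map.1 hu
    obtain ⟨w, hw', rfl⟩ := Finset.mem_map.1 hw
    refine (conn_iff hG u w).2 ?_
    by_cases huw : u = w
    · exact Or.inl huw
    · exact Or.inr (hT hu' hw' huw)

open scoped Classical in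
/-- The neighbours of `v` in `G` whose points are not further from the origin. -/
noncomputable def innerNbrs (G : SimpleGraph (Fin n)) (x : Fin n → Point) (v : Fin n) :
    Finset (Fin n) :=
  Finset.univ.filter fun w => G.Adj v w ∧ (x w).1 ≤ (x v).1

theorem ncard_inner (hG : IsAdjacencyList G nbrs) (v : Fin n) :
    ((Input.mk x nbrs).inner v).ncard = (innerNbrs G x v).card + 1 := by
  classical
  have h : (Input.mk x nbrs).inner v =
      ((insert v (innerNbrs G x v)).map Fin.valEmbedding : Finset ℕ) := by
    ext w
    simp only [Input.inner, Set.mem_ofPred_eq, Finset.coe_map, Set.mem_image, Finset.mem_coe,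
      Finset.mem_insert, innerNbrs, Finset.mem_filter, Finset.mem_univ, true_and,
      Fin.valEmbedding_apply]
    constructor
    · rintro ⟨hc, hr⟩
      have hw := hc.lt.2
      refine ⟨⟨w, hw⟩, ?_, rfl⟩
      rcases (conn_iff hG v ⟨w, hw⟩).1 hc with h | h
      · exact Or.inl h.symm
      · refine Or.inr ⟨h, ?_⟩
        rwa [Input.point_val, show w = ((⟨w, hw⟩ : Fin n) : ℕ) from rfl, Input.point_val] at hr
    · rintro ⟨w, hw, rfl⟩
      rw [Input.point_val, Input.point_val]
      rcases hw with rfl | ⟨h, hr⟩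
      · exact ⟨(conn_iff hG w w).2 (Or.inl rfl), le_rfl⟩
      · exact ⟨(conn_iff hG v w).2 (Or.inr h), hr⟩
  rw [h, Set.ncard_coe_finset, Finset.card_map, Finset.card_insert_of_notMem]
  simp [innerNbrs]

theorem graphTime_cliqueProgram_le (G : SimpleGraph (Fin n)) (x : Fin n → Point)
    (hsplit : ∀ nbrs, IsAdjacencyList G nbrs → ∀ v < n, (Input.mk x nbrs).Splits v) :
    graphTime cliqueProgram G x ≤
      ((34 * G.edgeSet.ncard + ∑ v, (100 * ((innerNbrs G x v).card + 2) ^ 3 + 13) + 9 : ℕ) :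
        ℝ≥0∞) := by
  classical
  refine iSup₂_le fun nbrs hG => ?_
  obtain ⟨s, t, hrun, -, ht⟩ := wp_cliqueProgram (proper (x := x) hG)
  refine (iInf₂_le t ⟨s, hrun⟩).trans (Nat.cast_le.2 ((ht (hsplit nbrs hG)).trans ?_))
  have hdeg : ∀ v : Fin n, (Input.mk x nbrs).degree v = G.degree v := by
    intro v
    rw [Input.degree_val, ← List.toFinset_card_of_nodup (hG v).1, ← G.card_neighborFinset_eq_degree]
    congr 1
    ext w
    simp [(hG v).2]
  have hsum := G.sum_degrees_eq_twice_card_edges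
  rw [← Set.ncard_coe_finset, SimpleGraph.coe_edgeFinset] at hsum
  rw [Finset.sum_range]
  simp only [hdeg, ncard_inner hG, add_assoc, Finset.sum_add_distrib, ← Finset.mul_sum, hsum]
  norm_num
  omega

end graph

/-! ### Inner neighbourhoods split -/

/-- The hyperbolic cosine of the distance of two points with radii `a`, `b` and with an angle of
cosine `c` between them. -/
noncomputable def coshDist (a b c : ℝ) : ℝ :=
  Real.cosh a * Real.cosh b - Real.sinh a * Real.sinh b * c

theorem one_le_coshDist {a b c : ℝ} (h1 : -1 ≤ c) (h2 : c ≤ 1) : 1 ≤ coshDist a b c := by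
  have h3 := Real.one_le_cosh (a - b)
  have h4 := Real.one_le_cosh (a + b)
  rw [Real.cosh_sub] at h3
  rw [Real.cosh_add] at h4
  unfold coshDist
  nlinarith [mul_nonneg (sub_nonneg.2 h2) (sub_nonneg.2 h4),
    mul_nonneg (neg_le_iff_add_nonneg.1 h1) (sub_nonneg.2 h3)]

theorem hdist_le_iff {p q : Point} {R : ℝ} (hR : 0 ≤ R) :
    hdist p q ≤ R ↔ coshDist p.1 q.1 (Real.cos (p.2 - q.2)) ≤ Real.cosh R := by
  have h1 : 1 ≤ coshDist p.1 q.1 (Real.cos (p.2 - q.2)) :=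
    one_le_coshDist (Real.neg_one_le_cos _) (Real.cos_le_one _)
  conv_lhs => rw [← Real.arcosh_cosh hR]
  exact Real.arcosh_le_arcosh (one_pos.trans_le h1) (Real.cosh_pos R)

theorem coshDist_mono {a b c c' : ℝ} (ha : 0 ≤ a) (hb : 0 ≤ b) (h : c ≤ c') :
    coshDist a b c' ≤ coshDist a b c := by
  unfold coshDist
  have := mul_nonneg (Real.sinh_nonneg_iff.2 ha) (Real.sinh_nonneg_iff.2 hb)
  nlinarith

theorem convexOn_coshDist {a c : ℝ} (ha : 0 ≤ a) (h1 : -1 ≤ c) (h2 : c ≤ 1) :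
    ConvexOn ℝ Set.univ fun b => coshDist a b c := by
  have hs := Real.sinh_nonneg_iff.2 ha
  have hc := Real.sinh_lt_cosh a
  have e : (fun b => coshDist a b c) = fun b =>
      ((Real.cosh a - Real.sinh a * c) / 2) • Real.exp b +
        ((Real.cosh a + Real.sinh a * c) / 2) • Real.exp (-b) := by
    funext b
    rw [coshDist, Real.cosh_eq b, Real.sinh_eq b, smul_eq_mul, smul_eq_mul]
    ring
  rw [e]
  refine ConvexOn.add (ConvexOn.smul (by nlinarith) convexOn_exp)
    (ConvexOn.smul (by nlinarith) ?_)
  exact convexOn_exp.comp_linearMap (-LinearMap.id : ℝ →ₗ[ℝ] ℝ)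

/-- If two points at radii `a` and `r` have distance at most `R`, then so have points at radii `a`
and `b ≤ r` that are seen from the origin at a smaller angle. By convexity in the second radius it
suffices to consider the origin and the radius `r`. -/
theorem coshDist_le_of_le {a b r c c' R : ℝ} (ha : 0 ≤ a) (haR : a ≤ R) (hb : 0 ≤ b) (hbr : b ≤ r)
    (h1 : -1 ≤ c) (h2 : c ≤ 1) (hcc : c ≤ c') (h : coshDist a r c ≤ Real.cosh R) :
    coshDist a b c' ≤ Real.cosh R := by
  refine (coshDist_mono ha hb hcc).trans ?_
  refine ((convexOn_coshDist ha h1 h2).le_max_of_mem_Icc (Set.mem_univ 0) (Set.mem_univ r)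
    ⟨hb, hbr⟩).trans (max_le ?_ h)
  simp only [coshDist, Real.cosh_zero, Real.sinh_zero, mul_one, mul_zero, zero_mul, sub_zero]
  exact Real.cosh_le_cosh.2 (by rwa [abs_of_nonneg ha, abs_of_nonneg (ha.trans haR)])

/-- The angle in `[0, 2π)` by which the direction `θ` has to be turned anticlockwise to reach the
direction `φ`. -/
noncomputable def ccwAngle (θ φ : ℝ) : ℝ :=
  open scoped Classical in if φ < θ then φ + 2 * Real.pi - θ else φ - θ

theorem cos_ccwAngle_sub (θ φ ψ : ℝ) :
    Real.cos (ccwAngle θ φ - ccwAngle θ ψ) = Real.cos (φ - ψ) := by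
  unfold ccwAngle
  split_ifs
  · congr 1
    ring
  · rw [← Real.cos_add_two_pi (φ - ψ)]
    congr 1
    ring
  · rw [← Real.cos_sub_two_pi (φ - ψ)]
    congr 1
    ring
  · congr 1
    ring

theorem cos_ccwAngle (θ φ : ℝ) : Real.cos (ccwAngle θ φ) = Real.cos (φ - θ) := by
  unfold ccwAngle
  split_ifs
  · rw [← Real.cos_add_two_pi (φ - θ)]
    congr 1
    ring
  · rfl

theorem ccwAngle_mem {θ φ : ℝ} (hθ : θ ∈ Set.Ico 0 (2 * Real.pi))
    (hφ : φ ∈ Set.Ico 0 (2 * Real.pi)) : ccwAngle θ φ ∈ Set.Ico 0 (2 * Real.pi) := by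
  obtain ⟨h1, h2⟩ := hθ
  obtain ⟨h3, h4⟩ := hφ
  unfold ccwAngle
  split_ifs <;> constructor <;> linarith

section

variable {n : ℕ} {R : ℝ} {x : Fin n → Point} {nbrs : Fin n → List (Fin n)}

theorem conn_iff_hdist_le (hR : 0 ≤ R) (hG : IsAdjacencyList (unitDiskGraph R x) nbrs)
    (u w : Fin n) : (Input.mk x nbrs).Conn u w ↔ hdist (x u) (x w) ≤ R := by
  rw [conn_iff hG]
  constructor
  · rintro (rfl | h)
    · rw [hdist_le_iff hR, sub_self, Real.cos_zero, coshDist, mul_one, ← Real.cosh_sub, sub_self,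
        Real.cosh_zero]
      exact Real.one_le_cosh R
    · exact h.2
  · intro h
    by_cases huw : u = w
    · exact Or.inl huw
    · exact Or.inr ⟨huw, h⟩

theorem key_le_key_iff (hφ : ∀ v, (x v).2 ∈ Set.Ico 0 (2 * Real.pi)) (v u w : Fin n) :
    (Input.mk x nbrs).key v u ≤ (Input.mk x nbrs).key v w ↔
      ccwAngle (x v).2 (x u).2 ≤ ccwAngle (x v).2 (x w).2 := by
  have hπ := Real.pi_lt_d2
  have hu := hφ u
  have hw := hφ w
  simp only [Input.key, Input.point_val, ccwAngle]
  split_ifs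
  · constructor <;> intro <;> linarith
  · constructor
    · intro
      linarith [hu.1, hw.2]
    · intro
      linarith [hu.1, hw.2]
  · constructor
    · intro
      linarith [hu.2, hw.1]
    · intro
      linarith [hu.2, hw.1]
  · constructor <;> intro <;> linarith

/-- The line through the origin and the point of `v` divides the inner neighbourhood of `v` into
two cliques. -/
theorem splits (hR : 0 ≤ R) (hG : IsAdjacencyList (unitDiskGraph R x) nbrs)
    (hr : ∀ v, (x v).1 ∈ Set.Icc 0 R) (hφ : ∀ v, (x v).2 ∈ Set.Ico 0 (2 * Real.pi)) {v : ℕ}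
    (hv : v < n) : (Input.mk x nbrs).Splits v := by
  set I := Input.mk x nbrs with hI
  have hsymm := (proper (x := x) hG).symm
  lift v to Fin n using hv
  have hinner : ∀ w : Fin n, (w : ℕ) ∈ I.inner v →
      coshDist (x w).1 (x v).1 (Real.cos ((x w).2 - (x v).2)) ≤ Real.cosh R ∧
        (x w).1 ≤ (x v).1 := by
    rintro w ⟨hc, hwr⟩
    rw [Input.point_val, Input.point_val] at hwr
    exact ⟨(hdist_le_iff hR).1 ((conn_iff_hdist_le hR hG w v).1 (hsymm _ _ hc)), hwr⟩
  have hang := fun w => ccwAngle_mem (hφ v) (hφ w)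
  -- The two sides are the points at anticlockwise angles up to `π` and from `π`.
  have hleft : ∀ u w : Fin n, (u : ℕ) ∈ I.inner v → (w : ℕ) ∈ I.inner v →
      ccwAngle (x v).2 (x u).2 ≤ ccwAngle (x v).2 (x w).2 →
      ccwAngle (x v).2 (x w).2 ≤ Real.pi → I.Conn w u := by
    intro u w hu hw huw hwπ
    rw [conn_iff_hdist_le hR hG, hdist_le_iff hR]
    refine coshDist_le_of_le (hr w).1 (hr w).2 (hr u).1 (hinner u hu).2 (Real.neg_one_le_cos _)
      (Real.cos_le_one _) ?_ (hinner w hw).1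
    rw [← cos_ccwAngle, ← cos_ccwAngle_sub (x v).2 (x w).2]
    exact Real.cos_le_cos_of_nonneg_of_le_pi (by linarith) hwπ (by linarith [(hang u).1])
  have hright : ∀ u w : Fin n, (u : ℕ) ∈ I.inner v → (w : ℕ) ∈ I.inner v →
      ccwAngle (x v).2 (x u).2 ≤ ccwAngle (x v).2 (x w).2 →
      Real.pi ≤ ccwAngle (x v).2 (x u).2 → I.Conn u w := by
    intro u w hu hw huw huπ
    rw [conn_iff_hdist_le hR hG, hdist_le_iff hR]
    refine coshDist_le_of_le (hr u).1 (hr u).2 (hr w).1 (hinner w hw).2 (Real.neg_one_le_cos _)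
      (Real.cos_le_one _) ?_ (hinner u hu).1
    rw [← cos_ccwAngle, ← cos_ccwAngle_sub (x v).2 (x u).2, ← Real.cos_two_pi_sub,
      ← Real.cos_neg (ccwAngle _ (x u).2 - _)]
    refine Real.cos_le_cos_of_nonneg_of_le_pi (by linarith) (by linarith) ?_
    linarith [(hang w).2]
  have hlate : ∀ w : Fin n, (w : ℕ) ∈ I.inner v → I.Late v w →
      Real.pi ≤ ccwAngle (x v).2 (x w).2 := by
    rintro w hw ⟨u, hu, hne, hkey⟩
    lift u to Fin n using hu.1.lt.2
    rw [hI, key_le_key_iff hφ] at hkey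
    by_contra hlt
    exact hne (hleft u w hu hw hkey (not_le.1 hlt).le)
  have hmain : ∀ u w : Fin n, (u : ℕ) ∈ I.inner v → (w : ℕ) ∈ I.inner v →
      ccwAngle (x v).2 (x u).2 ≤ ccwAngle (x v).2 (x w).2 → (I.Late v u ↔ I.Late v w) →
      I.Conn u w := by
    intro u w hu hw huw hiff
    by_cases hl : I.Late v w
    · exact hright u w hu hw huw (hlate u hu (hiff.2 hl))
    · by_contra hne
      exact hl ⟨u, hu, fun h => hne (hsymm _ _ h), (key_le_key_iff hφ v u w).2 huw⟩
  intro u hu w hw hiff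
  lift u to Fin n using hu.1.lt.2
  lift w to Fin n using hw.1.lt.2
  rcases le_total (ccwAngle (x v).2 (x u).2) (ccwAngle (x v).2 (x w).2) with h | h
  · exact hmain u w hu hw h hiff
  · exact hsymm _ _ (hmain w u hw hu h hiff.symm)

end

/-! ### The law of a random point -/

section

variable {α R : ℝ}

theorem measurable_density : Measurable fun r : ℝ =>
    ENNReal.ofReal (α * Real.sinh (α * r) / (Real.cosh (α * R) - 1)) := by
  fun_prop

theorem density_nonneg (hα : 0 < α) {r : ℝ} (hr : 0 ≤ r) :
    0 ≤ α * Real.sinh (α * r) / (Real.cosh (α * R) - 1) := by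
  have h1 := Real.sinh_nonneg_iff.2 (mul_nonneg hα.le hr)
  have h2 := Real.one_le_cosh (α * R)
  exact div_nonneg (mul_nonneg hα.le h1) (by linarith)

theorem isProbabilityMeasure_radialLaw (hα : 0 < α) (hR : 0 < R) :
    IsProbabilityMeasure (radialLaw α R) := by
  refine ⟨?_⟩
  have hc : 0 < Real.cosh (α * R) - 1 :=
    sub_pos.2 (Real.one_lt_cosh.2 (mul_pos hα hR).ne')
  have hcont : Continuous fun r : ℝ => α * Real.sinh (α * r) / (Real.cosh (α * R) - 1) := by
    fun_prop
  have hint : ∫ r in (0 : ℝ)..R, α * Real.sinh (α * r) / (Real.cosh (α * R) - 1) = 1 := by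
    have hderiv : ∀ r ∈ Set.uIcc 0 R, HasDerivAt
        (fun r => Real.cosh (α * r) / (Real.cosh (α * R) - 1))
        (α * Real.sinh (α * r) / (Real.cosh (α * R) - 1)) r := by
      intro r _
      have := (((hasDerivAt_id r).const_mul α).cosh).div_const (Real.cosh (α * R) - 1)
      simpa [mul_comm] using this
    rw [intervalIntegral.integral_eq_sub_of_hasDerivAt hderiv (hcont.intervalIntegrable _ _),
      mul_zero, Real.cosh_zero, ← sub_div, div_self hc.ne']
  rw [radialLaw, withDensity_apply _ MeasurableSet.univ, Measure.restrict_univ,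
    ← ofReal_integral_eq_lintegral_ofReal (hcont.integrableOn_Icc)
      ((ae_restrict_iff' measurableSet_Icc).2 (.of_forall fun r hr => density_nonneg hα hr.1)),
    integral_Icc_eq_integral_Ioc, ← intervalIntegral.integral_of_le hR.le, hint,
    ENNReal.ofReal_one]

instance isProbabilityMeasure_angularLaw : IsProbabilityMeasure angularLaw := by
  refine ⟨?_⟩
  have h : ENNReal.ofReal (2 * Real.pi) ≠ 0 := by
    simpa using Real.pi_pos
  rw [angularLaw, Measure.smul_apply, Measure.restrict_apply_univ, Real.volume_Ico, sub_zero,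
    smul_eq_mul, ENNReal.inv_mul_cancel h ENNReal.ofReal_ne_top]

theorem ae_radialLaw : ∀ᵐ r ∂radialLaw α R, r ∈ Set.Icc 0 R :=
  (withDensity_absolutelyContinuous _ _).ae_le (ae_restrict_mem measurableSet_Icc)

theorem ae_angularLaw : ∀ᵐ φ ∂angularLaw, φ ∈ Set.Ico 0 (2 * Real.pi) :=
  Measure.ae_smul_measure (ae_restrict_mem measurableSet_Ico) _

theorem isProbabilityMeasure_pointLaw (hα : 0 < α) (hR : 0 < R) :
    IsProbabilityMeasure (pointLaw α R) := by
  have := isProbabilityMeasure_radialLaw hα hR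
  unfold pointLaw
  infer_instance

theorem ae_pointLaw (hα : 0 < α) (hR : 0 < R) :
    ∀ᵐ p ∂pointLaw α R, p.1 ∈ Set.Icc 0 R ∧ p.2 ∈ Set.Ico 0 (2 * Real.pi) := by
  have := isProbabilityMeasure_radialLaw hα hR
  have h1 := Measure.quasiMeasurePreserving_fst (μ := radialLaw α R) (ν := angularLaw)
    |>.ae ae_radialLaw
  have h2 := Measure.quasiMeasurePreserving_snd (μ := radialLaw α R) (ν := angularLaw)
    |>.ae ae_angularLaw
  exact h1.and h2

/-- Integration with respect to the law of the radius. -/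
theorem lintegral_radialLaw {f : ℝ → ℝ≥0∞} (hf : Measurable f) :
    ∫⁻ r, f r ∂radialLaw α R = ∫⁻ r in Set.Icc 0 R,
      ENNReal.ofReal (α * Real.sinh (α * r) / (Real.cosh (α * R) - 1)) * f r := by
  rw [radialLaw, lintegral_withDensity_eq_lintegral_mul _ measurable_density hf]
  rfl

end

/-! ### Sums of independent indicators -/

section

variable {Ω : Type*} [MeasurableSpace Ω] (μ : Measure Ω) [IsProbabilityMeasure μ]

/-- The number of those among the points `y` that lie in `S`, as an extended real
so that it can be integrated. -/
noncomputable def hits {m : ℕ} (S : Set Ω) (y : Fin m → Ω) : ℝ≥0∞ := ∑ j, S.indicator 1 (y j)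

variable {S : Set Ω}

theorem measurable_hits {m : ℕ} (hS : MeasurableSet S) :
    Measurable fun y : Fin m → Ω => hits S y :=
  Finset.measurable_sum _ fun j _ =>
    (measurable_one.indicator hS).comp (measurable_pi_apply j)

/-- Integration over independent points: one of them can be integrated separately. -/
theorem lintegral_pi_succ {m : ℕ} (i : Fin (m + 1)) {f : Ω → (Fin m → Ω) → ℝ≥0∞}
    (hf : Measurable (Function.uncurry f)) :
    ∫⁻ y, f (y i) (fun j => y (i.succAbove j)) ∂Measure.pi (fun _ : Fin (m + 1) => μ) =
      ∫⁻ a, ∫⁻ y, f a y ∂Measure.pi (fun _ : Fin m => μ) ∂μ := by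
  have h := (measurePreserving_piFinSuccAbove (fun _ : Fin (m + 1) => μ) i).lintegral_comp hf
  rw [lintegral_prod _ hf.aemeasurable] at h
  exact h

theorem lintegral_hits_pow_succ {m : ℕ} (hS : MeasurableSet S) (k : ℕ) :
    ∫⁻ y, hits S y ^ k ∂Measure.pi (fun _ : Fin (m + 1) => μ) =
      ∫⁻ a, ∫⁻ y, (S.indicator 1 a + hits S y) ^ k ∂Measure.pi (fun _ : Fin m => μ) ∂μ := by
  rw [← lintegral_pi_succ μ 0 (f := fun a y => (S.indicator 1 a + hits S y) ^ k)]
  · simp only [hits, Fin.sum_univ_succ, Fin.succAbove_zero]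
  · exact (((measurable_one.indicator hS).comp measurable_fst).add
      ((measurable_hits hS).comp measurable_snd)).pow_const k

theorem lintegral_hits (m : ℕ) (hS : MeasurableSet S) :
    ∫⁻ y, hits S y ∂Measure.pi (fun _ : Fin m => μ) = m * μ S := by
  have hb : ∀ j : Fin m, Measurable fun y : Fin m → Ω => S.indicator (1 : Ω → ℝ≥0∞) (y j) :=
    fun j => (measurable_one.indicator hS).comp (measurable_pi_apply j)
  have h : ∀ j : Fin m, ∫⁻ y, S.indicator 1 (y j) ∂Measure.pi (fun _ : Fin m => μ) = μ S := by
    intro j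
    rw [(measurePreserving_eval (fun _ : Fin m => μ) j).lintegral_comp
      (f := S.indicator 1) (measurable_one.indicator hS), lintegral_indicator_one hS]
  simp only [hits]
  rw [lintegral_finsetSum _ fun j _ => hb j]
  simp [h]

/-- A bound on the second moment of a binomial distribution. -/
theorem lintegral_hits_sq_le (m : ℕ) (hS : MeasurableSet S) :
    ∫⁻ y, hits S y ^ 2 ∂Measure.pi (fun _ : Fin m => μ) ≤ m * μ S + (m * μ S) ^ 2 := by
  induction m with
  | zero => simp [hits]
  | succ m ih =>
    have hs := measurable_hits (m := m) hS
    have hstep : ∀ a, ∫⁻ y, (S.indicator 1 a + hits S y) ^ 2 ∂Measure.pi (fun _ : Fin m => μ) =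
        S.indicator 1 a * (1 + 2 * (m * μ S)) +
          ∫⁻ y, hits S y ^ 2 ∂Measure.pi (fun _ : Fin m => μ) := by
      intro a
      by_cases ha : a ∈ S
      · have e : ∀ y : Fin m → Ω, (1 + hits S y) ^ 2 = (1 + 2 * hits S y) + hits S y ^ 2 :=
          fun y => by ring
        simp only [Set.indicator_of_mem ha, Pi.one_apply, e, one_mul]
        rw [lintegral_add_right _ (hs.pow_const 2), lintegral_add_left measurable_const,
          lintegral_const_mul _ hs, lintegral_hits μ m hS, lintegral_const, measure_univ, mul_one]
      · simp [ha]
    rw [lintegral_hits_pow_succ μ hS, lintegral_congr hstep,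
      lintegral_add_right _ measurable_const, lintegral_mul_const _ (measurable_one.indicator hS),
      lintegral_indicator_one hS, lintegral_const, measure_univ, mul_one]
    refine (add_le_add_right ih _).trans ?_
    push_cast
    calc _ ≤ _ + μ S ^ 2 := le_self_add
      _ = _ := by ring

/-- A bound on the third moment of a binomial distribution. -/
theorem lintegral_hits_cube_le (m : ℕ) (hS : MeasurableSet S) :
    ∫⁻ y, hits S y ^ 3 ∂Measure.pi (fun _ : Fin m => μ) ≤
      m * μ S + 3 * (m * μ S) ^ 2 + (m * μ S) ^ 3 := by
  induction m with
  | zero => simp [hits]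
  | succ m ih =>
    have hs := measurable_hits (m := m) hS
    have hstep : ∀ a, ∫⁻ y, (S.indicator 1 a + hits S y) ^ 3 ∂Measure.pi (fun _ : Fin m => μ) ≤
        S.indicator 1 a * (1 + 3 * (m * μ S) + 3 * (m * μ S + (m * μ S) ^ 2)) +
          ∫⁻ y, hits S y ^ 3 ∂Measure.pi (fun _ : Fin m => μ) := by
      intro a
      by_cases ha : a ∈ S
      · have e : ∀ y : Fin m → Ω, (1 + hits S y) ^ 3 =
            (1 + 3 * hits S y + 3 * hits S y ^ 2) + hits S y ^ 3 := fun y => by ring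
        simp only [Set.indicator_of_mem ha, Pi.one_apply, e, one_mul]
        rw [lintegral_add_right _ (hs.pow_const 3),
          lintegral_add_right _ ((hs.pow_const 2).const_mul 3), lintegral_add_left measurable_const,
          lintegral_const_mul _ hs, lintegral_const_mul _ (hs.pow_const 2), lintegral_hits μ m hS,
          lintegral_const, measure_univ, mul_one]
        gcongr
        exact lintegral_hits_sq_le μ m hS
      · simp [ha]
    rw [lintegral_hits_pow_succ μ hS]
    refine (lintegral_mono hstep).trans ?_
    rw [lintegral_add_right _ measurable_const, lintegral_mul_const _ (measurable_one.indicator hS),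
      lintegral_indicator_one hS, lintegral_const, measure_univ, mul_one]
    refine (add_le_add_right ih _).trans ?_
    push_cast
    calc _ ≤ _ + (3 * μ S ^ 2 + (3 * m + 1) * μ S ^ 3) := le_self_add
      _ = _ := by ring

theorem lintegral_hits_add_two_cube_le (m : ℕ) (hS : MeasurableSet S) :
    ∫⁻ y, (hits S y + 2) ^ 3 ∂Measure.pi (fun _ : Fin m => μ) ≤ 36 * (1 + (m * μ S) ^ 3) := by
  have hs := measurable_hits (m := m) hS
  have e : ∀ y : Fin m → Ω, (hits S y + 2) ^ 3 =
      (8 + 12 * hits S y + 6 * hits S y ^ 2) + hits S y ^ 3 := fun y => by ring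
  simp only [e]
  rw [lintegral_add_right _ (hs.pow_const 3), lintegral_add_right _ ((hs.pow_const 2).const_mul 6),
    lintegral_add_left measurable_const, lintegral_const_mul _ hs,
    lintegral_const_mul _ (hs.pow_const 2), lintegral_hits μ m hS, lintegral_const, measure_univ,
    mul_one]
  refine (add_le_add (add_le_add_right (mul_le_mul_right (lintegral_hits_sq_le μ m hS) _) _)
    (lintegral_hits_cube_le μ m hS)).trans ?_
  generalize (m : ℝ≥0∞) * μ S = t
  have h1 : t ≤ 1 + t ^ 3 := by
    rcases le_total t 1 with h | h
    · exact h.trans le_self_add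
    · exact (le_self_pow h (by norm_num)).trans le_add_self
  have h2 : t ^ 2 ≤ 1 + t ^ 3 := by
    rcases le_total t 1 with h | h
    · exact (pow_le_one' h 2).trans le_self_add
    · exact (pow_le_pow_right₀ h (by norm_num)).trans le_add_self
  calc 8 + 12 * t + 6 * (t + t ^ 2) + (t + 3 * t ^ 2 + t ^ 3)
      = 8 + 19 * t + 9 * t ^ 2 + t ^ 3 := by ring
    _ ≤ 8 + 19 * (1 + t ^ 3) + 9 * (1 + t ^ 3) + t ^ 3 := by gcongr
    _ ≤ 8 + 19 * (1 + t ^ 3) + 9 * (1 + t ^ 3) + t ^ 3 + 7 * t ^ 3 := le_self_add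
    _ = 36 * (1 + t ^ 3) := by ring

end

/-! ### The third moment of the size of an inner neighbourhood -/

/-- The points at distance at most `R` from `p` that are not further from the origin than `p`. -/
def lens (R : ℝ) (p : Point) : Set Point :=
  {q | coshDist p.1 q.1 (Real.cos (p.2 - q.2)) ≤ Real.cosh R ∧ q.1 ≤ p.1}

theorem measurableSet_lens_graph (R : ℝ) :
    MeasurableSet {z : Point × Point | z.2 ∈ lens R z.1} := by
  have h1 : Continuous fun z : Point × Point =>
      coshDist z.1.1 z.2.1 (Real.cos (z.1.2 - z.2.2)) := by
    unfold coshDist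
    fun_prop
  have h2 : IsClosed {z : Point × Point | z.2.1 ≤ z.1.1} := isClosed_le (by fun_prop) (by fun_prop)
  exact ((isClosed_le h1 continuous_const).inter h2).measurableSet

theorem measurableSet_lens (R : ℝ) (p : Point) : MeasurableSet (lens R p) :=
  measurable_prodMk_left (measurableSet_lens_graph R)

theorem card_innerNbrs_le_hits {m : ℕ} {R : ℝ} (hR : 0 ≤ R) (x : Fin (m + 1) → Point)
    (v : Fin (m + 1)) :
    ((innerNbrs (unitDiskGraph R x) x v).card : ℝ≥0∞) ≤
      hits (lens R (x v)) fun j => x (v.succAbove j) := by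
  classical
  rw [innerNbrs, Finset.card_filter, Nat.cast_sum, Fin.sum_univ_succAbove _ v]
  rw [if_neg fun h => h.1.1 rfl, Nat.cast_zero, zero_add, hits]
  refine Finset.sum_le_sum fun j _ => ?_
  split_ifs with h
  · rw [Set.indicator_of_mem]
    · simp
    · exact ⟨(hdist_le_iff hR).1 h.1.2, h.2⟩
  · simp

theorem measurable_hits_lens {m : ℕ} (R : ℝ) :
    Measurable fun z : Point × (Fin m → Point) => hits (lens R z.1) z.2 := by
  refine Finset.measurable_sum Finset.univ fun j _ => ?_
  have h0 : Measurable fun z : Point × (Fin m → Point) => (z.1, z.2 j) :=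
    measurable_fst.prodMk ((measurable_pi_apply j).comp measurable_snd)
  have h1 : MeasurableSet {z : Point × (Fin m → Point) | z.2 j ∈ lens R z.1} :=
    h0 (measurableSet_lens_graph R)
  have h2 : (fun z : Point × (Fin m → Point) => (lens R z.1).indicator (1 : Point → ℝ≥0∞) (z.2 j))
      = Set.indicator {z : Point × (Fin m → Point) | z.2 j ∈ lens R z.1} 1 := by
    funext z
    by_cases h : z.2 j ∈ lens R z.1
    · rw [Set.indicator_of_mem h, Set.indicator_of_mem (by exact h), Pi.one_apply, Pi.one_apply]
    · rw [Set.indicator_of_notMem h, Set.indicator_of_notMem (by exact h)]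
  rw [h2]
  exact measurable_one.indicator h1

theorem lintegral_innerNbrs_cube_le {n : ℕ} {R : ℝ} (hR : 0 ≤ R) (μ : Measure Point)
    [IsProbabilityMeasure μ] (v : Fin n) :
    ∫⁻ x, ((innerNbrs (unitDiskGraph R x) x v).card + 2 : ℝ≥0∞) ^ 3
        ∂Measure.pi (fun _ : Fin n => μ) ≤
      ∫⁻ p, 36 * (1 + (n * μ (lens R p)) ^ 3) ∂μ := by
  obtain _ | m := n
  · exact v.elim0
  have hmeas : Measurable (Function.uncurry fun (p : Point) (y : Fin m → Point) =>
      (hits (lens R p) y + 2) ^ 3) := ((measurable_hits_lens R).add_const 2).pow_const 3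
  calc _ ≤ ∫⁻ x, (hits (lens R (x v)) (fun j => x (v.succAbove j)) + 2) ^ 3
        ∂Measure.pi (fun _ : Fin (m + 1) => μ) := by
        refine lintegral_mono fun x => ?_
        gcongr
        exact card_innerNbrs_le_hits hR x v
    _ = ∫⁻ p, ∫⁻ y, (hits (lens R p) y + 2) ^ 3 ∂Measure.pi (fun _ : Fin m => μ) ∂μ :=
        lintegral_pi_succ μ v hmeas
    _ ≤ _ := by
        refine lintegral_mono fun p =>
          (lintegral_hits_add_two_cube_le μ m (measurableSet_lens R p)).trans ?_
        gcongr
        simp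

/-! ### The measure of a lens -/

theorem angularLaw_apply (S : Set ℝ) :
    angularLaw S = (ENNReal.ofReal (2 * Real.pi))⁻¹ * volume (S ∩ Set.Ico 0 (2 * Real.pi)) := by
  rw [angularLaw, Measure.smul_apply, Measure.restrict_apply' measurableSet_Ico, smul_eq_mul]

theorem exp_div_four_le_sinh {a : ℝ} (ha : 1 ≤ a) : Real.exp a / 4 ≤ Real.sinh a := by
  have h1 : 2 ≤ Real.exp a := by
    linarith [Real.add_one_le_exp a]
  have h2 : Real.exp (-a) * Real.exp a = 1 := by
    rw [← Real.exp_add, neg_add_cancel, Real.exp_zero]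
  rw [Real.sinh_eq]
  nlinarith [Real.exp_pos (-a)]

/-- An angle with a cosine close to `1` is close to a multiple of `2π`. -/
theorem exists_abs_sub_le {δ ψ : ℝ} (h1 : -(2 * Real.pi) < ψ) (h2 : ψ < 2 * Real.pi)
    (hδ : 0 ≤ δ) (h : 1 - Real.cos ψ ≤ 2 / Real.pi ^ 2 * δ ^ 2) :
    |ψ| ≤ δ ∨ |ψ - 2 * Real.pi| ≤ δ ∨ |ψ + 2 * Real.pi| ≤ δ := by
  have hπ := Real.pi_pos
  have key : ∀ χ, Real.cos χ = Real.cos ψ → |χ| ≤ Real.pi → |χ| ≤ δ := by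
    intro χ hχ hle
    have h3 := Real.cos_le_one_sub_mul_cos_sq hle
    rw [hχ] at h3
    have h4 : 2 / Real.pi ^ 2 * χ ^ 2 ≤ 2 / Real.pi ^ 2 * δ ^ 2 := by linarith
    exact abs_le_of_sq_le_sq (le_of_mul_le_mul_left h4 (by positivity)) hδ
  rcases le_or_gt ψ (-Real.pi) with h3 | h3
  · exact Or.inr (Or.inr (key _ (Real.cos_add_two_pi ψ) (abs_le.2 ⟨by linarith, by linarith⟩)))
  · rcases le_or_gt ψ Real.pi with h4 | h4
    · exact Or.inl (key _ rfl (abs_le.2 ⟨by linarith, by linarith⟩))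
    · exact Or.inr (Or.inl (key _ (Real.cos_sub_two_pi ψ) (abs_le.2 ⟨by linarith, by linarith⟩)))

/-- The points at radius `a` within distance `R` of a point at radius `r` lie in a sector of angle
`O(exp ((R - a - r) / 2))`. -/
theorem angularLaw_le {R r a θ : ℝ} (ha : 0 ≤ a) (har : a ≤ r) (hrR : r ≤ R)
    (hθ : θ ∈ Set.Ico 0 (2 * Real.pi)) :
    angularLaw {φ | coshDist r a (Real.cos (θ - φ)) ≤ Real.cosh R} ≤
      ENNReal.ofReal (9 * Real.exp ((R - a - r) / 2)) := by
  set E := Real.exp ((R - a - r) / 2) with hE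
  have hE0 : 0 < E := Real.exp_pos _
  -- The hyperbolic sine is only exponential away from the origin; near it the bound is trivial.
  rcases lt_or_ge a 1 with ha1 | ha1
  · refine prob_le_one.trans ?_
    rw [← ENNReal.ofReal_one]
    refine ENNReal.ofReal_le_ofReal ?_
    have := Real.add_one_le_exp ((R - a - r) / 2)
    linarith
  -- The angle is at most `π √8 E ≤ 9 E` modulo `2π`.
  have hsub : {φ | coshDist r a (Real.cos (θ - φ)) ≤ Real.cosh R} ∩ Set.Ico 0 (2 * Real.pi) ⊆
      Set.Icc (θ - 9 * E) (θ + 9 * E) ∪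
        (Set.Icc (θ - 2 * Real.pi - 9 * E) (θ - 2 * Real.pi + 9 * E) ∪
          Set.Icc (θ + 2 * Real.pi - 9 * E) (θ + 2 * Real.pi + 9 * E)) := by
    rintro φ ⟨hφ, hφ'⟩
    have h1 : Real.sinh r * Real.sinh a * (1 - Real.cos (θ - φ)) ≤ Real.exp R := by
      have h2 := Real.cosh_sub r a
      have h3 := Real.one_le_cosh (r - a)
      have h4 := Real.sinh_lt_cosh (-R)
      have h5 := Real.cosh_add_sinh R
      rw [Real.cosh_neg, Real.sinh_neg] at h4
      have h6 : Real.cosh R ≤ Real.exp R := by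
        have := Real.sinh_nonneg_iff.2 (ha.trans (har.trans hrR))
        linarith
      have h7 : coshDist r a (Real.cos (θ - φ)) ≤ Real.cosh R := hφ
      unfold coshDist at h7
      nlinarith
    have h2 : Real.exp r / 4 * (Real.exp a / 4) * (1 - Real.cos (θ - φ)) ≤ Real.exp R := by
      refine le_trans ?_ h1
      have h3 := exp_div_four_le_sinh (ha1.trans har)
      have h4 := exp_div_four_le_sinh ha1
      have h5 := Real.cos_le_one (θ - φ)
      have h6 := Real.exp_pos r
      have h7 := Real.exp_pos a
      gcongr
      linarith
    have h3 : Real.exp R = Real.exp r * Real.exp a * E ^ 2 := by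
      rw [hE, ← Real.exp_nat_mul, ← Real.exp_add, ← Real.exp_add]
      congr 1
      push_cast
      ring
    have h4 : 1 - Real.cos (θ - φ) ≤ 16 * E ^ 2 := by
      rw [h3] at h2
      have h5 : 0 < Real.exp r * Real.exp a := by positivity
      refine le_of_mul_le_mul_left ?_ h5
      linarith
    have h5 : 1 - Real.cos (θ - φ) ≤ 2 / Real.pi ^ 2 * (9 * E) ^ 2 := by
      refine h4.trans ?_
      have h6 : 16 ≤ 2 / Real.pi ^ 2 * 81 := by
        rw [div_mul_eq_mul_div, le_div_iff₀ (by positivity)]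
        nlinarith [Real.pi_lt_d2, Real.pi_pos]
      nlinarith [sq_nonneg E]
    rcases exists_abs_sub_le (by linarith [hθ.1, hφ'.2]) (by linarith [hθ.2, hφ'.1])
      (by positivity) h5 with h6 | h6 | h6
    · exact Or.inl ⟨by linarith [(abs_le.1 h6).2], by linarith [(abs_le.1 h6).1]⟩
    · exact Or.inr (Or.inl ⟨by linarith [(abs_le.1 h6).2], by linarith [(abs_le.1 h6).1]⟩)
    · exact Or.inr (Or.inr ⟨by linarith [(abs_le.1 h6).2], by linarith [(abs_le.1 h6).1]⟩)
  have hvol : volume ({φ | coshDist r a (Real.cos (θ - φ)) ≤ Real.cosh R} ∩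
      Set.Ico 0 (2 * Real.pi)) ≤ ENNReal.ofReal (2 * Real.pi * (9 * E)) := by
    refine (measure_mono hsub).trans ((measure_union_le _ _).trans
      ((add_le_add_right (measure_union_le _ _) _).trans ?_))
    simp only [Real.volume_Icc]
    rw [← ENNReal.ofReal_add (by linarith) (by linarith),
      ← ENNReal.ofReal_add (by linarith) (by linarith)]
    refine ENNReal.ofReal_le_ofReal ?_
    nlinarith [Real.pi_gt_three]
  rw [angularLaw_apply]
  refine (mul_le_mul_right hvol _).trans ?_
  have hπ : 0 < 2 * Real.pi := Real.two_pi_pos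
  rw [ENNReal.ofReal_mul hπ.le, ← mul_assoc, ENNReal.inv_mul_cancel (by simpa using Real.pi_pos)
    ENNReal.ofReal_ne_top, one_mul]

theorem density_le {α R r : ℝ} (hα : 1 / 2 ≤ α) (hα1 : α ≤ 1) (hR : 1 ≤ R) :
    α * Real.sinh (α * r) / (Real.cosh (α * R) - 1) ≤ 9 * Real.exp (-(α * R) + α * r) := by
  have h1 : Real.exp (α * R) / 18 ≤ Real.cosh (α * R) - 1 := by
    have h2 : 3 / 2 ≤ Real.exp (α * R) := by
      have := Real.add_one_le_exp (α * R)
      nlinarith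
    have h3 : Real.exp (-(α * R)) * Real.exp (α * R) = 1 := by
      rw [← Real.exp_add, neg_add_cancel, Real.exp_zero]
    have h4 : 0 < Real.exp (-(α * R)) := Real.exp_pos _
    rw [Real.cosh_eq]
    nlinarith
  have h2 : α * Real.sinh (α * r) ≤ Real.exp (α * r) / 2 := by
    have h3 : Real.sinh (α * r) ≤ Real.exp (α * r) / 2 := by
      rw [Real.sinh_eq]
      linarith [Real.exp_pos (-(α * r))]
    have h4 := Real.exp_pos (α * r)
    nlinarith
  have h5 := Real.exp_pos (α * R)
  rw [div_le_iff₀ (by linarith)]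
  refine h2.trans ?_
  calc Real.exp (α * r) / 2
      = 9 * Real.exp (-(α * R) + α * r) * (Real.exp (α * R) / 18) := by
        have : Real.exp (α * r) = Real.exp (-(α * R) + α * r) * Real.exp (α * R) := by
          rw [← Real.exp_add]
          congr 1
          ring
        rw [this]
        ring
    _ ≤ _ := mul_le_mul_of_nonneg_left h1 (by positivity)

/-- The radial density is at most exponential, so exponentials integrate as expected. -/
theorem lintegral_radialLaw_exp_le {α R r b c : ℝ} (hα : 1 / 2 ≤ α) (hα1 : α ≤ 1) (hR : 1 ≤ R)
    (hb : 0 < α + b) (hc : 0 ≤ c) :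
    ∫⁻ a, (Set.Icc 0 r).indicator (fun a => ENNReal.ofReal (c * Real.exp (b * a))) a
        ∂radialLaw α R ≤
      ENNReal.ofReal (9 * c / (α + b) * Real.exp (-(α * R) + (α + b) * r)) := by
  rw [lintegral_radialLaw ((by fun_prop : Measurable fun a : ℝ =>
    ENNReal.ofReal (c * Real.exp (b * a))).indicator measurableSet_Icc)]
  calc _ ≤ ∫⁻ a, (Set.Iic r).indicator (fun a =>
        ENNReal.ofReal (9 * c * Real.exp (-(α * R)) * Real.exp ((α + b) * a))) a := by
        refine (lintegral_mono fun a => ?_).trans (setLIntegral_le_lintegral _ _)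
        by_cases ha : a ∈ Set.Icc 0 r
        · rw [Set.indicator_of_mem ha, Set.indicator_of_mem (Set.mem_Iic.2 ha.2),
            ← ENNReal.ofReal_mul (density_nonneg (by linarith) ha.1)]
          refine ENNReal.ofReal_le_ofReal ((mul_le_mul_of_nonneg_right (density_le hα hα1 hR)
            (by positivity)).trans (le_of_eq ?_))
          rw [Real.exp_add, add_mul, Real.exp_add]
          ring
        · rw [Set.indicator_of_notMem ha, mul_zero]
          exact bot_le
    _ = _ := by
        rw [lintegral_indicator measurableSet_Iic, ← ofReal_integral_eq_lintegral_ofReal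
          ((integrableOn_exp_mul_Iic hb r).const_mul _) (.of_forall fun a => by positivity),
          integral_const_mul, integral_exp_mul_Iic hb, Real.exp_add]
        congr 1
        ring

theorem pointLaw_lens_le_lintegral {α R r θ : ℝ} {f : ℝ → ℝ≥0∞}
    (hf : ∀ a, 0 ≤ a → a ≤ r →
      angularLaw {φ | coshDist r a (Real.cos (θ - φ)) ≤ Real.cosh R} ≤ f a) :
    pointLaw α R (lens R (r, θ)) ≤ ∫⁻ a, (Set.Icc 0 r).indicator f a ∂radialLaw α R := by
  rw [pointLaw, Measure.prod_apply (measurableSet_lens R _)]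
  refine lintegral_mono_ae (ae_radialLaw.mono fun a ha => ?_)
  by_cases har : a ≤ r
  · rw [Set.indicator_of_mem (Set.mem_Icc.2 ⟨ha.1, har⟩)]
    exact (measure_mono fun φ hφ => hφ.1).trans (hf a ha.1 har)
  · have : Prod.mk a ⁻¹' lens R (r, θ) = ∅ := by
      ext φ
      simp [lens, har]
    rw [this, measure_empty]
    exact bot_le

/-- The bound on the measure of a lens that is used for points near the boundary of the disk. -/
theorem pointLaw_lens_le {α R r θ : ℝ} (hα : 1 / 2 < α) (hα1 : α ≤ 1) (hR : 1 ≤ R) (hrR : r ≤ R)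
    (hθ : θ ∈ Set.Ico 0 (2 * Real.pi)) :
    pointLaw α R (lens R (r, θ)) ≤
      ENNReal.ofReal (81 / (α - 1 / 2) * Real.exp ((1 - α) * (R - r) - R / 2)) := by
  refine (pointLaw_lens_le_lintegral (f := fun a => ENNReal.ofReal
    (9 * Real.exp ((R - r) / 2) * Real.exp (-(1 / 2) * a))) ?_).trans
    ((lintegral_radialLaw_exp_le hα.le hα1 hR (by linarith) (by positivity)).trans (le_of_eq ?_))
  · intro a ha har
    refine (angularLaw_le ha har hrR hθ).trans (le_of_eq ?_)
    rw [mul_assoc, ← Real.exp_add]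
    congr 3
    ring
  · rw [show (1 - α) * (R - r) - R / 2 = (R - r) / 2 + (-(α * R) + (α + -(1 / 2)) * r) by ring,
      Real.exp_add ((R - r) / 2), ← sub_eq_add_neg]
    congr 1
    ring

/-- The bound on the measure of a lens that is used for points near the origin; it takes only the
radii of the points of the lens into account. -/
theorem pointLaw_lens_le_of_radius {α R r θ : ℝ} (hα : 1 / 2 < α) (hα1 : α ≤ 1) (hR : 1 ≤ R) :
    pointLaw α R (lens R (r, θ)) ≤ ENNReal.ofReal (9 / α * Real.exp (-(α * (R - r)))) := by
  refine (pointLaw_lens_le_lintegral (f := fun a => ENNReal.ofReal (1 * Real.exp (0 * a)))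
    ?_).trans ((lintegral_radialLaw_exp_le hα.le hα1 hR (by linarith) one_pos.le).trans
    (le_of_eq ?_))
  · intro a _ _
    simpa using prob_le_one
  · rw [mul_one, add_zero]
    congr 3
    ring

theorem log_eq_of_diskRadius {n : ℕ} {C : ℝ} : Real.log n = (diskRadius n C - C) / 2 := by
  unfold diskRadius
  ring

theorem cast_eq_exp {n : ℕ} (hn : 1 ≤ n) (C : ℝ) :
    (n : ℝ) = Real.exp ((diskRadius n C - C) / 2) := by
  rw [← log_eq_of_diskRadius, Real.exp_log (by exact_mod_cast hn)]

/-- The two bounds on the measure of a lens, weighted geometrically with weights `1 - τ / 3` and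
`τ / 3`. -/
theorem cast_mul_pointLaw_lens_cube_le {n : ℕ} {α C r θ τ : ℝ} (hn : 1 ≤ n) (hα : 1 / 2 < α)
    (hα1 : α < 1) (hR : 1 ≤ diskRadius n C) (hr : r ∈ Set.Icc 0 (diskRadius n C))
    (hθ : θ ∈ Set.Ico 0 (2 * Real.pi)) (hτ : 0 ≤ τ) (hτ3 : τ ≤ 3) :
    (n * pointLaw α (diskRadius n C) (lens (diskRadius n C) (r, θ))) ^ 3 ≤
      ENNReal.ofReal ((81 / (α - 1 / 2) * Real.exp (-(C / 2))) ^ 3 *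
        Real.exp (τ * (diskRadius n C / 2) + (3 * (1 - α) - τ) * (diskRadius n C - r))) := by
  have hcast := cast_eq_exp hn C
  set R := diskRadius n C
  set A := 81 / (α - 1 / 2) * Real.exp (-(C / 2)) with hA
  have hα2 : 0 < α - 1 / 2 := by linarith
  have hA0 : 0 ≤ A := by positivity
  have hn' : (n : ℝ≥0∞) = ENNReal.ofReal (Real.exp ((R - C) / 2)) := by
    rw [← hcast, ENNReal.ofReal_natCast]
  -- Both bounds, multiplied by the number of points.
  have h1 : n * pointLaw α R (lens R (r, θ)) ≤
      ENNReal.ofReal (A * Real.exp ((1 - α) * (R - r))) := by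
    refine (mul_le_mul_right (pointLaw_lens_le hα hα1.le hR hr.2 hθ) _).trans (le_of_eq ?_)
    rw [hn', ← ENNReal.ofReal_mul (Real.exp_pos _).le, hA]
    congr 1
    rw [mul_left_comm, ← Real.exp_add, mul_assoc, ← Real.exp_add]
    congr 2
    ring
  have h2 : n * pointLaw α R (lens R (r, θ)) ≤
      ENNReal.ofReal (A * Real.exp (R / 2 - α * (R - r))) := by
    refine (mul_le_mul_right (pointLaw_lens_le_of_radius hα hα1.le hR) _).trans ?_
    rw [hn', ← ENNReal.ofReal_mul (Real.exp_pos _).le, hA]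
    refine ENNReal.ofReal_le_ofReal ?_
    rw [mul_left_comm, ← Real.exp_add, mul_assoc, ← Real.exp_add,
      show (R - C) / 2 + -(α * (R - r)) = -(C / 2) + (R / 2 - α * (R - r)) by ring]
    gcongr ?_ * _
    rw [div_le_div_iff₀ (by linarith) hα2]
    linarith
  have h3 : ∀ u v : ℝ, 3 * min u v ≤ (3 - τ) * u + τ * v := by
    intro u v
    rcases le_total u v with h | h
    · rw [min_eq_left h]
      nlinarith
    · rw [min_eq_right h]
      nlinarith
  have h4 : n * pointLaw α R (lens R (r, θ)) ≤
      ENNReal.ofReal (A * Real.exp (min ((1 - α) * (R - r)) (R / 2 - α * (R - r)))) := by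
    rcases min_choice ((1 - α) * (R - r)) (R / 2 - α * (R - r)) with h | h <;> rw [h] <;> assumption
  calc (n * pointLaw α R (lens R (r, θ))) ^ 3
      ≤ ENNReal.ofReal (A * Real.exp (min ((1 - α) * (R - r)) (R / 2 - α * (R - r)))) ^ 3 := by
        gcongr
    _ ≤ _ := by
        rw [← ENNReal.ofReal_pow (by positivity), mul_pow, ← Real.exp_nat_mul]
        refine ENNReal.ofReal_le_ofReal (mul_le_mul_of_nonneg_left (Real.exp_le_exp.2 ?_)
          (by positivity))
        push_cast
        refine (h3 _ _).trans (le_of_eq ?_)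
        ring

theorem lintegral_pointLaw_exp_le {α R b c : ℝ} (hα : 1 / 2 ≤ α) (hα1 : α ≤ 1) (hR : 1 ≤ R)
    (hb : 0 < α + b) (hc : 0 ≤ c) :
    ∫⁻ p, ENNReal.ofReal (c * Real.exp (b * p.1)) ∂pointLaw α R ≤
      ENNReal.ofReal (9 * c / (α + b) * Real.exp (b * R)) := by
  have hm : Measurable fun a : ℝ => ENNReal.ofReal (c * Real.exp (b * a)) := by fun_prop
  have hm' : Measurable fun p : Point => ENNReal.ofReal (c * Real.exp (b * p.1)) :=
    hm.comp measurable_fst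
  rw [pointLaw, lintegral_prod _ hm'.aemeasurable]
  simp only [lintegral_const, measure_univ, mul_one]
  calc _ ≤ _ := lintegral_mono_ae (ae_radialLaw.mono fun a ha =>
        (Set.indicator_of_mem ha fun a => ENNReal.ofReal (c * Real.exp (b * a))).ge)
    _ ≤ _ := lintegral_radialLaw_exp_le hα hα1 hR hb hc
    _ = _ := by
        congr 3
        ring

/-- For small `α` the expectation is dominated by the vertices near the origin, for large `α` by
the typical vertices. -/
theorem exists_lintegral_lens_cube_le {α : ℝ} (hα : 1 / 2 < α) (hα1 : α < 1) (C : ℝ) :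
    ∃ A : ℝ≥0, ∀ n : ℕ, 1 ≤ n → 0 < diskRadius n C →
      n * ∫⁻ p, 36 * (1 + (n * pointLaw α (diskRadius n C) (lens (diskRadius n C) p)) ^ 3)
          ∂pointLaw α (diskRadius n C) ≤
        A * (n + ENNReal.ofReal ((n : ℝ) ^ (4.5 * (1 - α)))) := by
  -- The exponent `4.5 * (1 - α) - 1` exceeds the exponent `3 - 4 * α` that suffices.
  set τ := max 0 (3.5 - 4.5 * α) with hτ
  have hτ0 : 0 ≤ τ := le_max_left _ _
  have hτ3 : τ ≤ 3 := max_le (by norm_num) (by linarith)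
  have hb : 0 < 4 * α - 3 + τ := by
    rcases le_total (3.5 - 4.5 * α) 0 with h | h
    · rw [hτ, max_eq_left h]
      linarith
    · rw [hτ, max_eq_right h]
      linarith
  set A := 81 / (α - 1 / 2) * Real.exp (-(C / 2)) with hA
  have hα2 : 0 < α - 1 / 2 := by linarith
  have hA0 : 0 ≤ A := by positivity
  set B := 9 * A ^ 3 / (4 * α - 3 + τ) * Real.exp (τ * (C / 2)) with hB
  have hB0 : 0 ≤ B := by positivity
  set N := Real.exp ((1 - C) / 2) with hN
  have hN0 : 0 ≤ N := (Real.exp_pos _).le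
  refine ⟨(36 * (1 + B + N ^ 3)).toNNReal, fun n hn hR => ?_⟩
  have hprob := isProbabilityMeasure_pointLaw (by linarith : 0 < α) hR
  have hn1 : (1 : ℝ) ≤ n := by exact_mod_cast hn
  have hexp := log_eq_of_diskRadius (n := n) (C := C)
  have hcast := cast_eq_exp hn C
  set R := diskRadius n C
  have key : ∫⁻ p, (n * pointLaw α R (lens R p)) ^ 3 ∂pointLaw α R ≤
      ENNReal.ofReal (B * (n : ℝ) ^ τ + N ^ 3) := by
    -- If `R < 1`, then the number of vertices is bounded.
    rcases lt_or_ge R 1 with h | h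
    · have h1 : (n : ℝ≥0∞) ≤ ENNReal.ofReal N := by
        rw [← ENNReal.ofReal_natCast]
        refine ENNReal.ofReal_le_ofReal ?_
        rw [hcast, hN]
        exact Real.exp_le_exp.2 (by linarith)
      calc _ ≤ ∫⁻ _, ENNReal.ofReal N ^ 3 ∂pointLaw α R := by
            refine lintegral_mono fun p => ?_
            gcongr
            exact (mul_le_mul' h1 prob_le_one).trans (mul_one _).le
        _ = ENNReal.ofReal (N ^ 3) := by
            rw [lintegral_const, measure_univ, mul_one, ENNReal.ofReal_pow hN0]
        _ ≤ _ := ENNReal.ofReal_le_ofReal (le_add_of_nonneg_left (by positivity))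
    · calc _ ≤ ∫⁻ p, ENNReal.ofReal
              ((A ^ 3 * Real.exp (τ * (R / 2) + (3 * (1 - α) - τ) * R)) *
                Real.exp (-(3 * (1 - α) - τ) * p.1)) ∂pointLaw α R := by
            refine lintegral_mono_ae ((ae_pointLaw (by linarith) hR).mono fun p hp => ?_)
            refine (cast_mul_pointLaw_lens_cube_le hn hα hα1 h hp.1 hp.2 hτ0 hτ3).trans
              (le_of_eq ?_)
            rw [mul_assoc, ← Real.exp_add]
            congr 3
            ring
        _ ≤ _ := lintegral_pointLaw_exp_le hα.le hα1.le h (by linarith) (by positivity)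
        _ = ENNReal.ofReal (B * (n : ℝ) ^ τ) := by
            congr 1
            rw [Real.rpow_def_of_pos (by linarith), hexp, hB,
              show α + -(3 * (1 - α) - τ) = 4 * α - 3 + τ by ring, mul_assoc _ (Real.exp _),
              ← Real.exp_add, ← mul_assoc 9, mul_div_right_comm, mul_assoc _ (Real.exp _),
              ← Real.exp_add]
            congr 2
            ring
        _ ≤ _ := ENNReal.ofReal_le_ofReal (le_add_of_nonneg_right (by positivity))
  have hpow : (n : ℝ) * (n : ℝ) ^ τ ≤ n + (n : ℝ) ^ (4.5 * (1 - α)) := by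
    have h1 : 0 ≤ (n : ℝ) ^ (4.5 * (1 - α)) := by positivity
    rcases le_total (3.5 - 4.5 * α) 0 with h | h
    · rw [hτ, max_eq_left h, Real.rpow_zero, mul_one]
      linarith
    · rw [hτ, max_eq_right h, ← Real.rpow_one_add' (by linarith) (by linarith),
        show 1 + (3.5 - 4.5 * α) = 4.5 * (1 - α) by ring]
      linarith
  rw [lintegral_const_mul' _ _ (by norm_num), lintegral_add_left measurable_const, lintegral_const,
    measure_univ, mul_one]
  calc _ ≤ (n : ℝ≥0∞) * (36 * (1 + ENNReal.ofReal (B * (n : ℝ) ^ τ + N ^ 3))) := by gcongr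
    _ = ENNReal.ofReal (n * (36 * (1 + (B * (n : ℝ) ^ τ + N ^ 3)))) := by
        rw [ENNReal.ofReal_mul (by linarith), ENNReal.ofReal_mul (by norm_num),
          ENNReal.ofReal_add one_pos.le (by positivity), ENNReal.ofReal_one,
          ENNReal.ofReal_natCast, ENNReal.ofReal_ofNat]
    _ ≤ ENNReal.ofReal (36 * (1 + B + N ^ 3) * (n + (n : ℝ) ^ (4.5 * (1 - α)))) := by
        refine ENNReal.ofReal_le_ofReal ?_
        have h1 : 0 ≤ (n : ℝ) ^ (4.5 * (1 - α)) := by positivity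
        have h2 := mul_le_mul_of_nonneg_left hpow hB0
        have h3 : 0 ≤ N ^ 3 := by positivity
        nlinarith
    _ = _ := by
        rw [ENNReal.ofReal_mul (by positivity), ENNReal.ofReal_add (by linarith) (by positivity),
          ENNReal.ofReal_natCast]
        rfl

/-! ### The expected number of edges -/

/-- Two points in the disk of radius `R` that are seen from the origin at a small enough angle
have distance at most `R`. -/
theorem coshDist_le_of_abs_le {a b ψ R : ℝ} (ha : a ∈ Set.Icc 0 R) (hb : b ∈ Set.Icc 0 R)
    (hψ : |ψ| ≤ Real.exp (-(R / 2))) : coshDist a b (Real.cos ψ) ≤ Real.cosh R := by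
  have hR : 0 ≤ R := ha.1.trans ha.2
  have h1 := Real.neg_one_le_cos ψ
  have h2 := Real.cos_le_one ψ
  have hcomm : ∀ a b c, coshDist a b c = coshDist b a c := by
    intro a b c
    unfold coshDist
    ring
  -- It suffices to consider two points on the boundary of the disk.
  have hmain : coshDist R R (Real.cos ψ) ≤ Real.cosh R := by
    have h3 : 1 - Real.cos ψ ≤ Real.exp (-(R / 2)) ^ 2 / 2 := by
      have := Real.one_sub_sq_div_two_le_cos (x := ψ)
      have := sq_le_sq' (abs_le.1 hψ).1 (abs_le.1 hψ).2
      linarith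
    have h4 : (1 - Real.cos ψ) * (Real.cosh R + 1) ≤ 1 := by
      have h5 : Real.cosh R + 1 ≤ 2 * Real.exp R := by
        have h6 := Real.one_le_exp hR
        have h7 : Real.exp (-R) ≤ 1 := Real.exp_le_one_iff.2 (by linarith)
        rw [Real.cosh_eq]
        linarith
      have h6 : Real.exp (-(R / 2)) ^ 2 * Real.exp R = 1 := by
        rw [← Real.exp_nat_mul, ← Real.exp_add, ← Real.exp_zero]
        congr 1
        push_cast
        ring
      have h7 := Real.exp_pos R
      have h8 := Real.one_le_cosh R
      nlinarith
    have h5 := Real.cosh_sq R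
    have h6 : Real.sinh R * Real.sinh R = (Real.cosh R - 1) * (Real.cosh R + 1) := by
      nlinarith
    have h7 := Real.one_le_cosh R
    unfold coshDist
    nlinarith
  refine coshDist_le_of_le ha.1 ha.2 hb.1 hb.2 h1 h2 le_rfl ?_
  rw [hcomm]
  exact coshDist_le_of_le hR le_rfl ha.1 ha.2 h1 h2 le_rfl hmain

theorem le_angularLaw {ε θ : ℝ} (hε : 0 ≤ ε) (hε1 : ε ≤ 1) (hθ : θ ∈ Set.Ico 0 (2 * Real.pi)) :
    ENNReal.ofReal (ε / (2 * Real.pi)) ≤ angularLaw {φ | |θ - φ| ≤ ε} := by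
  have hπ := Real.pi_gt_three
  have hvol : ENNReal.ofReal ε ≤ volume ({φ | |θ - φ| ≤ ε} ∩ Set.Ico 0 (2 * Real.pi)) := by
    rcases le_total θ Real.pi with h | h
    · calc ENNReal.ofReal ε = volume (Set.Icc θ (θ + ε)) := by
            rw [Real.volume_Icc, add_sub_cancel_left]
        _ ≤ _ := by
            refine measure_mono ?_
            rintro φ ⟨h1, h2⟩
            have h3 : |θ - φ| ≤ ε := abs_le.2 ⟨by linarith, by linarith⟩
            exact ⟨h3, hθ.1.trans h1, by linarith⟩
    · calc ENNReal.ofReal ε = volume (Set.Icc (θ - ε) θ) := by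
            rw [Real.volume_Icc, sub_sub_cancel]
        _ ≤ _ := by
            refine measure_mono ?_
            rintro φ ⟨h1, h2⟩
            have h3 : |θ - φ| ≤ ε := abs_le.2 ⟨by linarith, by linarith⟩
            exact ⟨h3, by linarith, h2.trans_lt hθ.2⟩
  rw [angularLaw_apply, ENNReal.ofReal_div_of_pos Real.two_pi_pos, div_eq_mul_inv, mul_comm]
  exact mul_le_mul_right hvol _

/-- The points that are seen from the origin at an angle of at most `ε` with `p`. -/
def sector (ε : ℝ) (p : Point) : Set Point := {q | |p.2 - q.2| ≤ ε}

theorem measurableSet_sector (ε : ℝ) (p : Point) : MeasurableSet (sector ε p) := by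
  have h : IsClosed {q : Point | |p.2 - q.2| ≤ ε} := isClosed_le (by fun_prop) (by fun_prop)
  exact h.measurableSet

theorem measurable_hits_sector {m : ℕ} (ε : ℝ) :
    Measurable fun z : Point × (Fin m → Point) => hits (sector ε z.1) z.2 := by
  refine Finset.measurable_sum Finset.univ fun j _ => ?_
  have h1 : IsClosed {z : Point × (Fin m → Point) | |z.1.2 - (z.2 j).2| ≤ ε} :=
    isClosed_le (by fun_prop) (by fun_prop)
  have h2 : (fun z : Point × (Fin m → Point) =>
      (sector ε z.1).indicator (1 : Point → ℝ≥0∞) (z.2 j)) =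
        Set.indicator {z : Point × (Fin m → Point) | |z.1.2 - (z.2 j).2| ≤ ε} 1 := by
    funext z
    by_cases h : z.2 j ∈ sector ε z.1
    · rw [Set.indicator_of_mem h, Set.indicator_of_mem (by exact h), Pi.one_apply, Pi.one_apply]
    · rw [Set.indicator_of_notMem h, Set.indicator_of_notMem (by exact h)]
  rw [h2]
  exact measurable_one.indicator h1.measurableSet

theorem measurable_hits_sector_succAbove {m : ℕ} (ε : ℝ) (v : Fin (m + 1)) :
    Measurable fun x : Fin (m + 1) → Point =>
      hits (sector ε (x v)) fun j => x (v.succAbove j) := by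
  have h1 : Measurable fun x : Fin (m + 1) → Point => (x v, fun j => x (v.succAbove j)) := by
    fun_prop
  have h2 := (measurable_hits_sector (m := m) ε).comp h1
  simp only [Function.comp_def] at h2
  exact h2

theorem le_pointLaw_sector {α R ε : ℝ} {p : Point} (hα : 0 < α) (hR : 0 < R) (hε : 0 ≤ ε)
    (hε1 : ε ≤ 1) (hp : p.2 ∈ Set.Ico 0 (2 * Real.pi)) :
    ENNReal.ofReal (ε / (2 * Real.pi)) ≤ pointLaw α R (sector ε p) := by
  have := isProbabilityMeasure_radialLaw hα hR
  have h : sector ε p = Set.univ ×ˢ {φ | |p.2 - φ| ≤ ε} := by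
    ext q
    simp [sector]
  rw [h, pointLaw, Measure.prod_prod, measure_univ, one_mul]
  exact le_angularLaw hε hε1 hp

theorem hits_sector_le_degree {m : ℕ} {R : ℝ} {x : Fin (m + 1) → Point}
    (hr : ∀ v, (x v).1 ∈ Set.Icc 0 R) (v : Fin (m + 1))
    [Fintype ((unitDiskGraph R x).neighborSet v)] :
    hits (sector (Real.exp (-(R / 2))) (x v)) (fun j => x (v.succAbove j)) ≤
      (unitDiskGraph R x).degree v := by
  classical
  have h : (unitDiskGraph R x).neighborFinset v =
      Finset.univ.filter fun w => (unitDiskGraph R x).Adj v w := by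
    ext w
    simp
  have hR := (hr v).1.trans (hr v).2
  rw [← SimpleGraph.card_neighborFinset_eq_degree, h, Finset.card_filter, Nat.cast_sum,
    Fin.sum_univ_succAbove _ v]
  refine le_add_left (Finset.sum_le_sum fun j _ => ?_)
  by_cases hj : x (v.succAbove j) ∈ sector (Real.exp (-(R / 2))) (x v)
  · rw [Set.indicator_of_mem hj, if_pos]
    · simp
    · exact ⟨(Fin.succAbove_ne v j).symm,
        (hdist_le_iff hR).2 (coshDist_le_of_abs_le (hr v) (hr _) hj)⟩
  · rw [Set.indicator_of_notMem hj]
    exact bot_le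

theorem ae_sampleLaw {n : ℕ} {α C : ℝ} (hα : 0 < α) (hR : 0 < diskRadius n C) :
    ∀ᵐ x ∂sampleLaw n α C, ∀ v, (x v).1 ∈ Set.Icc 0 (diskRadius n C) ∧
      (x v).2 ∈ Set.Ico 0 (2 * Real.pi) := by
  have := isProbabilityMeasure_pointLaw hα hR
  refine ae_all_iff.2 fun v => ?_
  exact (measurePreserving_eval (fun _ : Fin n => pointLaw α (diskRadius n C)) v)
    |>.quasiMeasurePreserving.ae (ae_pointLaw hα hR)

/-- The expected number of edges is at least linear. -/
theorem le_lintegral_ncard_edgeSet {m : ℕ} {α C : ℝ} (hα : 0 < α)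
    (hR : 0 < diskRadius (m + 1) C) :
    ENNReal.ofReal (m * (Real.exp (-(C / 2)) / (4 * Real.pi))) ≤
      ∫⁻ x, ((randomGraph C x).edgeSet.ncard : ℝ≥0∞) ∂sampleLaw (m + 1) α C := by
  classical
  have hprob := isProbabilityMeasure_pointLaw hα hR
  have hae := ae_sampleLaw hα hR
  have hcast := cast_eq_exp (by omega : 1 ≤ m + 1) C
  unfold sampleLaw at hae ⊢
  set R := diskRadius (m + 1) C with hRdef
  set ε := Real.exp (-(R / 2)) with hε
  have hε1 : ε ≤ 1 := Real.exp_le_one_iff.2 (by linarith)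
  have hdeg : ∀ v : Fin (m + 1), ENNReal.ofReal (m * (ε / (2 * Real.pi))) ≤
      ∫⁻ x, hits (sector ε (x v)) (fun j => x (v.succAbove j))
        ∂Measure.pi (fun _ : Fin (m + 1) => pointLaw α R) := by
    intro v
    rw [lintegral_pi_succ (pointLaw α R) v (f := fun p y => hits (sector ε p) y)
      (measurable_hits_sector ε)]
    calc ENNReal.ofReal (m * (ε / (2 * Real.pi)))
        = ∫⁻ _, m * ENNReal.ofReal (ε / (2 * Real.pi)) ∂pointLaw α R := by
          rw [lintegral_const, measure_univ, mul_one, ENNReal.ofReal_mul (by positivity),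
            ENNReal.ofReal_natCast]
      _ ≤ _ := by
          refine lintegral_mono_ae ((ae_pointLaw hα hR).mono fun p hp => ?_)
          rw [lintegral_hits _ m (measurableSet_sector ε p)]
          gcongr
          exact le_pointLaw_sector hα hR (Real.exp_pos _).le hε1 hp.2
  have hsum : ENNReal.ofReal (m * (Real.exp (-(C / 2)) / (4 * Real.pi))) * 2 ≤
      (∫⁻ x, ((randomGraph C x).edgeSet.ncard : ℝ≥0∞)
        ∂Measure.pi (fun _ : Fin (m + 1) => pointLaw α R)) * 2 := by
    rw [← lintegral_mul_const' _ _ (by norm_num)]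
    calc _ = ∑ _v : Fin (m + 1), ENNReal.ofReal (m * (ε / (2 * Real.pi))) := by
          rw [Finset.sum_const, Finset.card_univ, Fintype.card_fin, nsmul_eq_mul,
            ← ENNReal.ofReal_natCast (m + 1), hcast, ← ENNReal.ofReal_mul (Real.exp_pos _).le,
            ← ENNReal.ofReal_ofNat 2, ← ENNReal.ofReal_mul (by positivity)]
          congr 1
          rw [show -(C / 2) = (R - C) / 2 + -(R / 2) by ring, Real.exp_add]
          ring
      _ ≤ ∑ v : Fin (m + 1), ∫⁻ x, hits (sector ε (x v)) (fun j => x (v.succAbove j))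
            ∂Measure.pi (fun _ : Fin (m + 1) => pointLaw α R) :=
          Finset.sum_le_sum fun v _ => hdeg v
      _ = ∫⁻ x, ∑ v : Fin (m + 1), hits (sector ε (x v)) (fun j => x (v.succAbove j))
            ∂Measure.pi (fun _ : Fin (m + 1) => pointLaw α R) :=
          (lintegral_finsetSum _ fun v _ => measurable_hits_sector_succAbove ε v).symm
      _ ≤ _ := by
          refine lintegral_mono_ae (hae.mono fun x hx => ?_)
          have h := (randomGraph C x).sum_degrees_eq_twice_card_edges
          rw [← Set.ncard_coe_finset, SimpleGraph.coe_edgeFinset] at h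
          have h' : ((randomGraph C x).edgeSet.ncard : ℝ≥0∞) * 2 =
              ∑ v, ((randomGraph C x).degree v : ℝ≥0∞) := by
            exact_mod_cast (h.trans (mul_comm _ _)).symm
          rw [h']
          exact Finset.sum_le_sum fun v _ => hits_sector_le_degree (fun v => (hx v).1) v
  exact (ENNReal.mul_le_mul_iff_left (by norm_num) (by norm_num)).1 hsum

/-! ### The expected running time -/

section

variable {n : ℕ} {α C : ℝ}

theorem measurable_card_innerNbrs {R : ℝ} (hR : 0 ≤ R) (v : Fin n) :
    Measurable fun x : Fin n → Point =>
      ((innerNbrs (unitDiskGraph R x) x v).card : ℝ≥0∞) := by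
  classical
  have h : ∀ w, MeasurableSet {x : Fin n → Point | v ≠ w ∧ x w ∈ lens R (x v)} := by
    intro w
    have h1 : Measurable fun x : Fin n → Point => (x v, x w) := by
      fun_prop
    exact (MeasurableSet.const _).inter (h1 (measurableSet_lens_graph R))
  have e : (fun x : Fin n → Point => ((innerNbrs (unitDiskGraph R x) x v).card : ℝ≥0∞)) =
      fun x => ∑ w, Set.indicator {x | v ≠ w ∧ x w ∈ lens R (x v)} 1 x := by
    funext x
    rw [innerNbrs, Finset.card_filter, Nat.cast_sum]
    refine Finset.sum_congr rfl fun w _ => ?_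
    rw [Set.indicator_apply, Nat.cast_ite, Nat.cast_one, Nat.cast_zero]
    refine if_congr ?_ rfl rfl
    exact ⟨fun h => ⟨h.1.1, (hdist_le_iff hR).1 h.1.2, h.2⟩,
      fun h => ⟨⟨h.1, (hdist_le_iff hR).2 h.2.1⟩, h.2.2⟩⟩
  rw [e]
  exact Finset.measurable_sum _ fun w _ => measurable_one.indicator (h w)

theorem lintegral_graphTime_le (hα : 0 < α) (hR : 0 < diskRadius n C) :
    ∫⁻ x, graphTime cliqueProgram (randomGraph C x) x ∂sampleLaw n α C ≤
      34 * ∫⁻ x, ((randomGraph C x).edgeSet.ncard : ℝ≥0∞) ∂sampleLaw n α C +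
        100 * (n * ∫⁻ p,
          36 * (1 + (n * pointLaw α (diskRadius n C) (lens (diskRadius n C) p)) ^ 3)
            ∂pointLaw α (diskRadius n C)) + (13 * n + 9) := by
  have hprob := isProbabilityMeasure_pointLaw hα hR
  have : IsProbabilityMeasure (sampleLaw n α C) := by
    unfold sampleLaw
    infer_instance
  have hmeas : ∀ v, Measurable fun x : Fin n → Point =>
      ((innerNbrs (randomGraph C x) x v).card + 2 : ℝ≥0∞) ^ 3 := by
    intro v
    exact ((measurable_card_innerNbrs hR.le v).add_const 2).pow_const 3
  calc _ ≤ ∫⁻ x, (34 * ((randomGraph C x).edgeSet.ncard : ℝ≥0∞) +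
          100 * ∑ v, ((innerNbrs (randomGraph C x) x v).card + 2 : ℝ≥0∞) ^ 3 + (13 * n + 9))
            ∂sampleLaw n α C := by
        refine lintegral_mono_ae ((ae_sampleLaw hα hR).mono fun x hx => ?_)
        refine (graphTime_cliqueProgram_le (randomGraph C x) x fun nbrs hG v hv =>
          splits hR.le hG (fun v => (hx v).1) (fun v => (hx v).2) hv).trans (le_of_eq ?_)
        push_cast
        rw [Finset.sum_add_distrib, ← Finset.mul_sum, Finset.sum_const, Finset.card_univ,
          Fintype.card_fin, nsmul_eq_mul]
        ring
    _ = 34 * ∫⁻ x, ((randomGraph C x).edgeSet.ncard : ℝ≥0∞) ∂sampleLaw n α C +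
        100 * ∑ v, ∫⁻ x, ((innerNbrs (randomGraph C x) x v).card + 2 : ℝ≥0∞) ^ 3
          ∂sampleLaw n α C + (13 * n + 9) := by
        rw [lintegral_add_right _ measurable_const, lintegral_const, measure_univ, mul_one,
          lintegral_add_right _ ((Finset.measurable_sum _ fun v _ => hmeas v).const_mul 100),
          lintegral_const_mul' _ _ (by norm_num), lintegral_const_mul' _ _ (by norm_num),
          lintegral_finsetSum _ fun v _ => hmeas v]
    _ ≤ _ := by
        gcongr
        calc _ ≤ ∑ _v : Fin n, _ := Finset.sum_le_sum fun v _ =>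
              lintegral_innerNbrs_cube_le hR.le (pointLaw α (diskRadius n C)) v
          _ = _ := by
              rw [Finset.sum_const, Finset.card_univ, Fintype.card_fin, nsmul_eq_mul]

end

theorem exists_expected_graphTime_le {α : ℝ} (hα : 1 / 2 < α) (hα1 : α < 1) (C : ℝ) :
    ∃ K : ℝ≥0, ∀ n : ℕ, 1 ≤ n → 0 < diskRadius n C →
      ∫⁻ x, graphTime cliqueProgram (randomGraph C x) x ∂sampleLaw n α C ≤
        (K : ℝ≥0∞) * ∫⁻ x, (((randomGraph C x).edgeSet.ncard : ℝ≥0∞)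
          + ENNReal.ofReal ((n : ℝ) ^ (4.5 * (1 - α)))) ∂sampleLaw n α C := by
  obtain ⟨A, hA⟩ := exists_lintegral_lens_cube_le hα hα1 C
  set c := Real.exp (-(C / 2)) / (4 * Real.pi) with hc
  have hc0 : 0 < c := by positivity
  have hcc : (c⁻¹.toNNReal : ℝ≥0∞) * ENNReal.ofReal c = 1 := by
    change ENNReal.ofReal c⁻¹ * _ = 1
    rw [← ENNReal.ofReal_mul (inv_nonneg.2 hc0.le), inv_mul_cancel₀ hc0.ne', ENNReal.ofReal_one]
  refine ⟨34 + (100 * A + 22) * (2 + c⁻¹.toNNReal), fun n hn hR => ?_⟩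
  have hprob := isProbabilityMeasure_pointLaw (by linarith : 0 < α) hR
  have : IsProbabilityMeasure (sampleLaw n α C) := by
    unfold sampleLaw
    infer_instance
  rw [lintegral_add_right _ measurable_const, lintegral_const, measure_univ, mul_one]
  refine (lintegral_graphTime_le (by linarith) hR).trans ?_
  have hedges : ((n - 1 : ℕ) : ℝ≥0∞) * ENNReal.ofReal c ≤
      ∫⁻ x, ((randomGraph C x).edgeSet.ncard : ℝ≥0∞) ∂sampleLaw n α C := by
    obtain ⟨m, rfl⟩ := Nat.exists_eq_add_of_le' hn
    have h := le_lintegral_ncard_edgeSet (by linarith : 0 < α) hR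
    rwa [ENNReal.ofReal_mul (Nat.cast_nonneg _), ENNReal.ofReal_natCast] at h
  have hA := hA n hn hR
  have hP : 1 ≤ ENNReal.ofReal ((n : ℝ) ^ (4.5 * (1 - α))) := by
    rw [← ENNReal.ofReal_one]
    exact ENNReal.ofReal_le_ofReal
      (Real.one_le_rpow (by exact_mod_cast hn) (by linarith))
  generalize ENNReal.ofReal ((n : ℝ) ^ (4.5 * (1 - α))) = P at *
  generalize ∫⁻ x, ((randomGraph C x).edgeSet.ncard : ℝ≥0∞) ∂sampleLaw n α C = M at *
  -- The number of vertices is bounded by the edges and by one further vertex.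
  have hnle : (n : ℝ≥0∞) ≤ (1 + c⁻¹.toNNReal) * (M + P) := by
    calc (n : ℝ≥0∞) = 1 + c⁻¹.toNNReal * ((n - 1 : ℕ) * ENNReal.ofReal c) := by
          rw [mul_left_comm, hcc, mul_one]
          norm_cast
          omega
      _ ≤ P + c⁻¹.toNNReal * M := by gcongr
      _ ≤ P + c⁻¹.toNNReal * M + (M + c⁻¹.toNNReal * P) := le_self_add
      _ = _ := by ring
  have hnP : n + P ≤ (2 + c⁻¹.toNNReal) * (M + P) := by
    calc n + P ≤ (1 + c⁻¹.toNNReal) * (M + P) + (M + P) := add_le_add hnle le_add_self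
      _ = _ := by ring
  push_cast
  calc _ ≤ 34 * M + 100 * (A * (n + P)) + (22 * (n + P)) := by
        gcongr
        calc (13 * n + 9 : ℝ≥0∞) ≤ 13 * n + 9 * P := by
              gcongr
              calc (9 : ℝ≥0∞) = 9 * 1 := (mul_one 9).symm
                _ ≤ _ := by gcongr
          _ ≤ 13 * n + 9 * P + (9 * n + 13 * P) := le_self_add
          _ = _ := by ring
    _ = 34 * M + (100 * A + 22) * (n + P) := by ring
    _ ≤ 34 * (M + P) + (100 * A + 22) * ((2 + c⁻¹.toNNReal) * (M + P)) := by
        gcongr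
        exact le_self_add
    _ = _ := by ring

end HyperbolicClique

theorem mainTheorem1 :
    ∃ p : HyperbolicClique.Program,
      (∀ (n : ℕ) (R : ℝ) (x : Fin n → HyperbolicClique.Point), (∀ v, 0 ≤ (x v).1) →
        HyperbolicClique.ComputesMaximumClique p (HyperbolicClique.unitDiskGraph R x) x) ∧
      ∀ α C : ℝ, 1 / 2 < α → α < 1 →
        ∃ K : ℝ≥0, ∀ n : ℕ, 1 ≤ n → 0 < HyperbolicClique.diskRadius n C →
          ∫⁻ x, HyperbolicClique.graphTime p (HyperbolicClique.randomGraph C x) x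
              ∂(HyperbolicClique.sampleLaw n α C) ≤
            (K : ℝ≥0∞) *
              ∫⁻ x, (((HyperbolicClique.randomGraph C x).edgeSet.ncard : ℝ≥0∞)
                  + ENNReal.ofReal ((n : ℝ) ^ (4.5 * (1 - α))))
                ∂(HyperbolicClique.sampleLaw n α C) :=
  ⟨HyperbolicClique.cliqueProgram,
    fun _ _ x _ => HyperbolicClique.computesMaximumClique_cliqueProgram _ x,
    fun _ C hα hα1 => HyperbolicClique.exists_expected_graphTime_le hα hα1 C⟩
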